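/- Let $V$ be a $C^\infty$, strictly positive function on $[0,1]$. Let $\mathcal P_+$ be the set of strictly positive (continuous) functions on $[0,1]$ that belong to $H^1(]0,1[)$, and $\mathcal P_1=\{f\in\mathcal P_+:\int_0^1 f=1\}$. For $\tilde v_0\in\mathcal P_+$ consider the nonlinear heat equation $$\partial_t\tilde v=\partial_{xx}^2\tilde v-V\tilde v+\Big(\int_0^1V(\xi)\tilde v(t,\xi)\,d\xi\Big)\tilde v,\qquad \partial_x\tilde v(t,0)=\partial_x\tilde v(t,1)=0,\qquad \tilde v(0,\cdot)=\tilde v_0 .$$ A solution on $[0,T[$, $0<T\le\infty$, is a continuous map $t\mapsto \tilde v(t,\cdot)$ from $[0,T[$ to $L^2([0,1])$, with profiles $\tilde v(t,\cdot)$ continuous on $[0,1]$, such that $\tilde v(0,\cdot)=\tilde v_0$ and, for each $\varphi\in C^2([0,1])$ with $\varphi'(0)=\varphi'(1)=0$ and each $t\in[0,T[$, $\frac{d}{dt}\int_0^1\tilde v\varphi=\int_0^1\tilde v(\varphi''-V\varphi)+\big(\int_0^1V\tilde v\big)\int_0^1\tilde v\varphi$ (one-sided derivative at $t=0$). Solutions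 of the linear equation $\partial_t v=\partial^2_{xx}v-Vv$ with Neumann conditions are defined likewise, without the last term. Let $T_*(\tilde v_0)$ be the supremum of the $T$ for which there is a solution of the nonlinear equation, $\Phi^t_{\mathcal N}(\tilde v_0)=\tilde v(t,\cdot)$ its value at $t\in[0,T_*(\tilde v_0)[$, $\tilde g(t)=\int_0^1\tilde v(t,\xi)d\xi$ and $\tilde g_0=\tilde g(0)$. Then the following hold. 1. (Local well-posedness and regularity.) For every $\tilde v_0\in\mathcal P_+$ one has $T_*(\tilde v_0)>0$, there is a solution $\tilde v$ on $[0,T_*(\tilde v_0)[$, and every solution with Cauchy data $\tilde v_0$ is a restriction of it. For $0<t<T_*(\tilde v_0)$, $\tilde v(t,\cdot)\in C^\infty([0,1])$, and the equation and the Neumann conditions hold pointwise on $[0,1]$. 2. (Positivity.) For $\tilde v_0\in\mathcal P_+$ and $0\le t<T_*(\tilde v_0)$: $\Phi^t_{\mathcal N}(\tilde v_0)\in\mathcal P_+$ and $\tilde v(t,x)\ge e^{-t\sup V}\inf_{[0,1]}\tilde v_0$ for all $x\in[0,1]$. 3. (Mean.) For $\tilde v_0\in\mathcal P_+$, on $[0,T_*(\tilde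 v_0)[$: $\frac{d}{dt}(\tilde g-1)=\big(\int_0^1V\tilde v\big)(\tilde g-1)$. If $\tilde g_0>1$, then $\tilde g>1$ and $\tilde g$ is strictly increasing; if $\tilde g_0=1$, then $\tilde g=1$; if $\tilde g_0<1$, then $\tilde g_0e^{-t\sup V}\le\tilde g(t)<1$ and $\tilde g$ is strictly decreasing. 4. (Global existence.) If $\tilde v_0\in\mathcal P_+$ and $\tilde g_0\le1$, then $T_*(\tilde v_0)=\infty$ and $\|\tilde v(t,\cdot)\|_{L^2}\le e^{t\sup V}\|\tilde v_0\|_{L^2}$ for all $t\ge0$. 5. (The flow on $\mathcal P_1$.) If $\tilde v_0\in\mathcal P_1$, then $\Phi^t_{\mathcal N}(\tilde v_0)\in\mathcal P_1$ for all $t\ge0$, and $\Phi_{\mathcal N}^{s+t}(\tilde v_0)=\Phi_{\mathcal N}^t(\Phi_{\mathcal N}^s(\tilde v_0))$ for all $s,t\ge 0$. The linear equation has a solution on $[0,\infty[$ with Cauchy data $\tilde v_0$, and for any such solution $v$ and all $t\ge0$: $g(t):=\int_0^1v(t,\xi)d\xi>0$ and $\Phi^t_{\mathcal N}(\tilde v_0)=v(t,\cdot)/g(t)$.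 6. (Reduction to $\mathcal P_1$.) For $\tilde v_0\in\mathcal P_+$ and $0\le t<T_*(\tilde v_0)$: $\Phi^t_{\mathcal N}(\tilde v_0)=\tilde g(t)\,\Phi^t_{\mathcal N}(\tilde v_0/\tilde g_0)$. 7. (Blow-up.) If $\tilde v_0\in\mathcal P_+$ and $\tilde g_0>1$, then $0<T_*(\tilde v_0)<\infty$, and as $t\uparrow T_*(\tilde v_0)$ one has $\tilde g(t)\to+\infty$ and $\tilde v(t,x)\to+\infty$ for every $x\in[0,1]$. 8. (Steady state.) The operator $-\partial_{xx}^2+V$ with Neumann conditions has a nondecreasing sequence of eigenvalues $(\mu_n)_{n\ge0}$ with a complete orthonormal system in $L^2([0,1])$ of eigenfunctions $e_n\in C^2([0,1])$, where $e_0>0$ on $]0,1[$. For any such $(\mu_n),(e_n)$ let $$\tilde f_0=\frac{e_0}{\int_0^1e_0(\xi)d\xi}=\frac{\mu_0}{\int_0^1V(\xi)e_0(\xi)d\xi}\,e_0 ,$$ the second equality being part of the claim. Then $\tilde f_0\in\mathcal P_1$, and $s\in\mathcal P_+$ is a steady state (i.e. the function constantly equal to $s$ in time is a solution on $[0,\infty[$)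 if and only if $s=\tilde f_0$. 9. (Sink.) For every $\tilde v_0\in\mathcal P_1$, $\Phi^t_{\mathcal N}(\tilde v_0)\to\tilde f_0$ as $t\to\infty$, uniformly on $[0,1]$ and in $H^1$. 10. (Spectral elements of the Koopman operator.) Let $\mathcal F_1$ be the set of maps $\mathcal P_1\to\mathbb R$ that are continuous for the $H^1$ norm, $\mathcal K^t_{\mathcal N}(\phi)=\phi\circ\Phi^t_{\mathcal N}$ for $\phi\in\mathcal F_1$, $t\ge 0$, and $c_n(f)=\int_0^1e_nf$ with $(\mu_n),(e_n)$ as in 8. Then $\mathcal K^t_{\mathcal N}$ maps $\mathcal F_1$ to itself; $c_n\in\mathcal F_1$ for all $n$; $c_0>0$ on $\mathcal P_1$; and for all $m\ge 0$ and $q_0,\dots,q_m\in\mathbb N$ the functional $\psi=\prod_{i=0}^m c_{q_i}/c_0$ belongs to $\mathcal F_1$, is not identically zero on $\mathcal P_1$, and satisfies $\mathcal K^t_{\mathcal N}\psi=e^{-\lambda t}\psi$ for all $t\ge0$, with $\lambda=\sum_{i=0}^m(\mu_{q_i}-\mu_0)$. -/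

import Mathlib

open Set Filter Topology MeasureTheory
open scoped ContDiff

noncomputable section

namespace HeatFlow

/-- The closed space interval `[0,1]`. -/
def I01 : Set ℝ := Icc (0 : ℝ) 1

/-- Lebesgue measure on `[0,1]`. -/
def vol01 : Measure ℝ := volume.restrict I01

/-- The one-variable derivative on `[0,1]` (one-sided at the end points). -/
def D (f : ℝ → ℝ) : ℝ → ℝ := derivWithin f I01

/-- `g` is the weak derivative of `f` on `]0,1[`. -/
def IsWeakDeriv (f g : ℝ → ℝ) : Prop :=
  ∀ φ : ℝ → ℝ, ContDiff ℝ ∞ φ → HasCompactSupport φ → tsupport φ ⊆ Ioo (0 : ℝ) 1 →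
    ∫ x in (0 : ℝ)..1, f x * deriv φ x = -∫ x in (0 : ℝ)..1, g x * φ x

/-- `f` belongs to `H¹(]0,1[)`. -/
def MemH1 (f : ℝ → ℝ) : Prop :=
  MemLp f 2 vol01 ∧ ∃ g : ℝ → ℝ, MemLp g 2 vol01 ∧ IsWeakDeriv f g

open Classical in
/-- A square integrable weak derivative of `f` (unique almost everywhere on `[0,1]`);
`0` if there is none. -/
def weakDeriv (f : ℝ → ℝ) : ℝ → ℝ :=
  if h : ∃ g : ℝ → ℝ, MemLp g 2 vol01 ∧ IsWeakDeriv f g then h.choose else 0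

/-- The `L²([0,1])` norm. -/
def l2norm (f : ℝ → ℝ) : ℝ := Real.sqrt (∫ x in (0 : ℝ)..1, f x ^ 2)

/-- The `H¹` norm on `[0,1]`. -/
def h1norm (f : ℝ → ℝ) : ℝ := Real.sqrt (l2norm f ^ 2 + l2norm (weakDeriv f) ^ 2)

/-- The spatial mean. -/
def mean (f : ℝ → ℝ) : ℝ := ∫ x in (0 : ℝ)..1, f x

/-- The set `P₊` of strictly positive `H¹` functions on `[0,1]` (continuous representatives). -/
def PPlus : Set (ℝ → ℝ) := {f | MemH1 f ∧ ContinuousOn f I01 ∧ ∀ x ∈ I01, 0 < f x}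

/-- The set `P₁` of the elements of `P₊` with integral one. -/
def POne : Set (ℝ → ℝ) := {f | f ∈ PPlus ∧ mean f = 1}

/-- The times `t` with `0 ≤ t < T`. -/
def timeSpan (T : EReal) : Set ℝ := {t | 0 ≤ t ∧ (t : EReal) < T}

/-- `v` is a solution on `[0,T[`, with Cauchy data `v₀`, of
`∂ₜ v = ∂ₓₓ v - V v + N(v(t,·)) v`, `∂ₓ v(t,0) = ∂ₓ v(t,1) = 0`, where `N` is a functional of the
space profile: `v` is continuous in time with values in `L²([0,1])`, its profiles are continuous,
and the equation with its Neumann conditions holds in the weak sense, against every `C²` test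
function `φ` with `φ'(0) = φ'(1) = 0`. -/
structure IsSolution (V : ℝ → ℝ) (N : (ℝ → ℝ) → ℝ) (v₀ : ℝ → ℝ) (T : EReal)
    (v : ℝ → ℝ → ℝ) : Prop where
  pos : 0 < T
  init : EqOn (v 0) v₀ I01
  cont_space : ∀ t ∈ timeSpan T, ContinuousOn (v t) I01
  cont_time : ∀ t ∈ timeSpan T,
    Tendsto (fun s => l2norm (v s - v t)) (𝓝[timeSpan T] t) (𝓝 0)
  weak : ∀ φ : ℝ → ℝ, ContDiffOn ℝ 2 φ I01 → D φ 0 = 0 → D φ 1 = 0 →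
    ∀ t ∈ timeSpan T,
      HasDerivWithinAt (fun s => ∫ x in (0 : ℝ)..1, v s x * φ x)
        ((∫ x in (0 : ℝ)..1, v t x * (D (D φ) x - V x * φ x))
          + N (v t) * ∫ x in (0 : ℝ)..1, v t x * φ x)
        (timeSpan T) t

/-- The nonlocal coefficient `∫₀¹ V f` of the nonlinear heat equation. -/
def nonlocal (V : ℝ → ℝ) (f : ℝ → ℝ) : ℝ := ∫ x in (0 : ℝ)..1, V x * f x

/-- Solutions of the nonlinear heat equation
`∂ₜ v = ∂ₓₓ v - V v + (∫₀¹ V v) v` with Neumann conditions. -/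
abbrev IsNonlinearSolution (V v₀ : ℝ → ℝ) (T : EReal) (v : ℝ → ℝ → ℝ) : Prop :=
  IsSolution V (nonlocal V) v₀ T v

/-- Solutions of the linear heat equation `∂ₜ v = ∂ₓₓ v - V v` with Neumann conditions. -/
abbrev IsLinearSolution (V v₀ : ℝ → ℝ) (T : EReal) (v : ℝ → ℝ → ℝ) : Prop :=
  IsSolution V (fun _ => 0) v₀ T v

/-- The maximal life span `T_*(v₀)` of the solution of the nonlinear heat equation. -/
def lifespan (V v₀ : ℝ → ℝ) : EReal :=
  sSup {T : EReal | ∃ v : ℝ → ℝ → ℝ, IsNonlinearSolution V v₀ T v}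

open Classical in
/-- The nonlinear heat flow `Φᵗ(v₀)`: the value at time `t` of a solution whose life span
contains `t` (`0` if there is none). -/
def flow (V : ℝ → ℝ) (t : ℝ) (v₀ : ℝ → ℝ) : ℝ → ℝ :=
  if h : ∃ (v : ℝ → ℝ → ℝ) (T : EReal), (t : EReal) < T ∧ IsNonlinearSolution V v₀ T v
  then h.choose t else 0

/-- A steady state: the solution that is constant in time exists for all times. -/
def IsSteadyState (V s : ℝ → ℝ) : Prop := IsNonlinearSolution V s ⊤ (fun _ => s)

/-- `(μ, e)` lists the eigenvalues (in nondecreasing order) and a complete orthonormal system of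
eigenfunctions in `L²([0,1])` of `-∂ₓₓ + V` with Neumann conditions, the ground state `e 0` being
normalised to be positive on `]0,1[`. -/
structure IsNeumannSpectrum (V : ℝ → ℝ) (μ : ℕ → ℝ) (e : ℕ → ℝ → ℝ) : Prop where
  mono : Monotone μ
  smooth : ∀ n, ContDiffOn ℝ 2 (e n) I01
  eigen : ∀ n, ∀ x ∈ I01, D (D (e n)) x - V x * e n x = -μ n * e n x
  neumann : ∀ n, D (e n) 0 = 0 ∧ D (e n) 1 = 0
  orthonormal : ∀ m n, ∫ x in (0 : ℝ)..1, e m x * e n x = if m = n then 1 else 0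
  complete : ∀ f : ℝ → ℝ, MemLp f 2 vol01 → (∀ n, ∫ x in (0 : ℝ)..1, e n x * f x = 0) →
    f =ᵐ[vol01] 0
  ground_pos : ∀ x ∈ Ioo (0 : ℝ) 1, 0 < e 0 x

/-- The coefficient functional `c(f) = ∫₀¹ e f` of a function `e`. -/
def coeff (e : ℝ → ℝ) (f : ℝ → ℝ) : ℝ := ∫ x in (0 : ℝ)..1, e x * f x

/-- `φ` is an observable on `P₁`: a real functional, continuous on `P₁` for the `H¹` norm. -/
def IsObservable (φ : (ℝ → ℝ) → ℝ) : Prop :=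
  ∀ f ∈ POne, ∀ ε > 0, ∃ δ > 0, ∀ g ∈ POne, h1norm (g - f) < δ → |φ g - φ f| < ε

/-- The Koopman operator of the nonlinear heat flow at time `t`. -/
def koopman (V : ℝ → ℝ) (t : ℝ) (φ : (ℝ → ℝ) → ℝ) : (ℝ → ℝ) → ℝ :=
  fun v₀ => φ (flow V t v₀)

end HeatFlow

end

namespace HeatFlow

/-! ### Calculus on `[0,1]` -/

/-! The nonlinear term is a scalar multiple of the solution. A solution therefore has the form `v(t)
= G(t) u(t)`, where `u` is the linear heat flow of the same datum and `G' = G ∫ V v = G² ∫ V u`.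
Testing the linear equation against the constant `1` gives `(∫ u)' = -∫ V u = (1/G)'`, so `1/G(t) =
1 + ∫ u(t) - ∫ u(0)`, which is `flowDenom`. The life span is the length of the maximal interval on
which this denominator stays positive. For a positive datum it decreases strictly from `1` to the
limit `1 - ∫ u(0)`: it never vanishes when the initial mean is at most one, and it vanishes once, in
finite time, when that mean exceeds one. At that time `u` is finite and positive, hence blow-up at
every point at once. On `P₁` the denominator is `∫ u(t)` itself, and the flow is the normalised
linear flow.

The rest is linear theory, carried by the eigenfunctions of `L = -∂ₓₓ + V`. The inverse of `L` is
compact: a Green kernel treats constant potentials and a Neumann series the others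
(`exists_compact_resolvent`). The spectral theorem then gives a complete system
(`isCompleteFamily_eigenfunction`), and uniqueness for the Cauchy problem makes the eigenvalues
simple. The Sobolev inequality applied to truncated Green functions gives `∑ 1/μ n < ∞` and
polynomial bounds on `e n`, so that the heat series converges with all its derivatives for `t > 0`.
Weak solutions are unique because testing against `e k` yields a scalar differential equation for
each coefficient (`exists_eq_mul_heat`).

Positivity comes from the maximum principle for resolvents and the formula `exp(-tL) = lim
(N/(L+N))^j` with `N = j/t` (`heat_lower_bound`). The spectral gap `μ 0 < μ n` makes the ground
state the only surviving mode of the normalised flow. In a quotient `c_n/c_0` the normalising factor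
cancels, which leaves a pure exponential in time: these quotients are Koopman eigenfunctionals. -/

theorem uniqueDiffOn_I01 : UniqueDiffOn ℝ I01 := uniqueDiffOn_Icc zero_lt_one

theorem zero_mem_I01 : (0 : ℝ) ∈ I01 := ⟨le_rfl, zero_le_one⟩

theorem one_mem_I01 : (1 : ℝ) ∈ I01 := ⟨zero_le_one, le_rfl⟩

theorem uIcc_eq_I01 : uIcc (0 : ℝ) 1 = I01 := uIcc_of_le zero_le_one

theorem isCompact_I01 : IsCompact I01 := isCompact_Icc

theorem nonempty_I01 : I01.Nonempty := ⟨0, zero_mem_I01⟩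

theorem intervalIntegrable_of_continuousOn {f : ℝ → ℝ} (hf : ContinuousOn f I01) :
    IntervalIntegrable f volume 0 1 :=
  ContinuousOn.intervalIntegrable (by rwa [uIcc_eq_I01])

theorem integral_congr_I01 {f g : ℝ → ℝ} (h : EqOn f g I01) :
    ∫ x in (0 : ℝ)..1, f x = ∫ x in (0 : ℝ)..1, g x :=
  intervalIntegral.integral_congr (by rwa [uIcc_eq_I01])

theorem integral_mono_I01 {f g : ℝ → ℝ} (hf : ContinuousOn f I01) (hg : ContinuousOn g I01)
    (h : ∀ x ∈ I01, f x ≤ g x) : ∫ x in (0 : ℝ)..1, f x ≤ ∫ x in (0 : ℝ)..1, g x :=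
  intervalIntegral.integral_mono_on zero_le_one (intervalIntegrable_of_continuousOn hf)
    (intervalIntegrable_of_continuousOn hg) h

theorem integral_nonneg_I01 {f : ℝ → ℝ} (h : ∀ x ∈ I01, 0 ≤ f x) :
    0 ≤ ∫ x in (0 : ℝ)..1, f x :=
  intervalIntegral.integral_nonneg zero_le_one h

theorem integral_add_I01 {f g : ℝ → ℝ} (hf : ContinuousOn f I01) (hg : ContinuousOn g I01) :
    ∫ x in (0 : ℝ)..1, (f x + g x) = (∫ x in (0 : ℝ)..1, f x) + ∫ x in (0 : ℝ)..1, g x :=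
  intervalIntegral.integral_add (intervalIntegrable_of_continuousOn hf)
    (intervalIntegrable_of_continuousOn hg)

theorem integral_sub_I01 {f g : ℝ → ℝ} (hf : ContinuousOn f I01) (hg : ContinuousOn g I01) :
    ∫ x in (0 : ℝ)..1, (f x - g x) = (∫ x in (0 : ℝ)..1, f x) - ∫ x in (0 : ℝ)..1, g x :=
  intervalIntegral.integral_sub (intervalIntegrable_of_continuousOn hf)
    (intervalIntegrable_of_continuousOn hg)

theorem integral_pos_I01 {f : ℝ → ℝ} (hf : ContinuousOn f I01)
    (h : ∀ x ∈ Ioo (0 : ℝ) 1, 0 < f x) : 0 < ∫ x in (0 : ℝ)..1, f x :=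
  intervalIntegral.intervalIntegral_pos_of_pos_on (intervalIntegrable_of_continuousOn hf) h
    zero_lt_one

/-- A nonnegative continuous function with zero integral vanishes. -/
theorem eqOn_zero_of_integral_eq_zero {f : ℝ → ℝ} (hf : ContinuousOn f I01)
    (h : ∀ x ∈ I01, 0 ≤ f x) (h0 : ∫ x in (0 : ℝ)..1, f x = 0) : ∀ x ∈ I01, f x = 0 := by
  by_contra hc
  push Not at hc
  obtain ⟨c, hc, hne⟩ := hc
  have := intervalIntegral.integral_pos (a := 0) (b := 1) (f := f) zero_lt_one hf
    (fun x hx => h x ⟨hx.1.le, hx.2⟩) ⟨c, hc, lt_of_le_of_ne (h c hc) (Ne.symm hne)⟩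
  linarith

theorem abs_integral_le_integral_I01 {f g : ℝ → ℝ} {a b : ℝ} (ha : a ∈ I01) (hb : b ∈ I01)
    (hf : ContinuousOn f I01) (hg : ContinuousOn g I01) (h : ∀ x ∈ I01, |f x| ≤ g x) :
    |∫ x in a..b, f x| ≤ ∫ x in (0 : ℝ)..1, g x := by
  refine (intervalIntegral.norm_integral_le_integral_norm_uIoc (f := f) (μ := volume)).trans
    (le_trans ?_ (integral_mono_I01 hf.norm hg h))
  rw [intervalIntegral.integral_of_le zero_le_one]
  refine setIntegral_mono_set (intervalIntegrable_of_continuousOn hf.norm).1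
    (Eventually.of_forall fun x => norm_nonneg _) (Eventually.of_forall ?_)
  rw [uIoc]
  exact Ioc_subset_Ioc (le_min ha.1 hb.1) (max_le ha.2 hb.2)

theorem exists_bound_I01 {f : ℝ → ℝ} (hf : ContinuousOn f I01) :
    ∃ C, 0 ≤ C ∧ ∀ x ∈ I01, |f x| ≤ C := by
  obtain ⟨C, hC⟩ := isCompact_I01.exists_bound_of_continuousOn hf
  exact ⟨C, (norm_nonneg _).trans (hC 0 zero_mem_I01), hC⟩

theorem exists_pos_le_of_pos {f : ℝ → ℝ} (hf : ContinuousOn f I01) (h : ∀ x ∈ I01, 0 < f x) :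
    ∃ δ, 0 < δ ∧ ∀ x ∈ I01, δ ≤ f x := by
  obtain ⟨x, hx, hm⟩ := isCompact_I01.exists_isMinOn nonempty_I01 hf
  exact ⟨f x, h x hx, fun y hy => hm hy⟩

/-- Cauchy-Schwarz on `[0,1]`. -/
theorem sq_integral_mul_le {f g : ℝ → ℝ} (hf : ContinuousOn f I01) (hg : ContinuousOn g I01) :
    (∫ x in (0 : ℝ)..1, f x * g x) ^ 2
      ≤ (∫ x in (0 : ℝ)..1, f x ^ 2) * ∫ x in (0 : ℝ)..1, g x ^ 2 := by
  -- The right side is `∫ (f - s g)²`, a nonnegative quadratic in `s`; its discriminant is the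
  -- inequality.
  have key : ∀ s : ℝ, 0 ≤ (∫ x in (0 : ℝ)..1, g x ^ 2) * (s * s)
      + (-2 * ∫ x in (0 : ℝ)..1, f x * g x) * s + ∫ x in (0 : ℝ)..1, f x ^ 2 := by
    intro s
    have h : ∫ x in (0 : ℝ)..1, (f x - s * g x) ^ 2 = (∫ x in (0 : ℝ)..1, g x ^ 2) * (s * s)
      + (-2 * ∫ x in (0 : ℝ)..1, f x * g x) * s + ∫ x in (0 : ℝ)..1, f x ^ 2 := by
      have e : ∀ x, (f x - s * g x) ^ 2 = ((s * s) * g x ^ 2 + (-2 * s) * (f x * g x)) + f x ^ 2 :=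
        fun x => by ring
      simp_rw [e]
      rw [integral_add_I01 (by fun_prop) (by fun_prop), integral_add_I01 (by fun_prop)
        (by fun_prop), intervalIntegral.integral_const_mul, intervalIntegral.integral_const_mul]
      ring
    rw [← h]
    exact integral_nonneg_I01 fun x _ => sq_nonneg _
  have := discrim_le_zero key
  unfold discrim at this
  nlinarith

/-- `f` is twice continuously differentiable on `[0,1]` with first derivative `f₁` and second
derivative `f₂`, and satisfies the Neumann conditions. -/
structure NeumannC2 (f f₁ f₂ : ℝ → ℝ) : Prop where
  d1 : ∀ x ∈ I01, HasDerivWithinAt f (f₁ x) I01 x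
  d2 : ∀ x ∈ I01, HasDerivWithinAt f₁ (f₂ x) I01 x
  cont2 : ContinuousOn f₂ I01
  left : f₁ 0 = 0
  right : f₁ 1 = 0

theorem D_eq_of_hasDerivWithinAt {f f₁ : ℝ → ℝ}
    (h : ∀ x ∈ I01, HasDerivWithinAt f (f₁ x) I01 x) : EqOn (D f) f₁ I01 :=
  fun x hx => (h x hx).derivWithin (uniqueDiffOn_I01 x hx)

theorem contDiffOn_succ_of_hasDerivWithinAt {f f₁ : ℝ → ℝ} {n : ℕ}
    (h : ∀ x ∈ I01, HasDerivWithinAt f (f₁ x) I01 x) (h₁ : ContDiffOn ℝ n f₁ I01) :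
    ContDiffOn ℝ (n + 1 : ℕ) f I01 := by
  push_cast
  rw [contDiffOn_succ_iff_derivWithin uniqueDiffOn_I01]
  exact ⟨fun x hx => (h x hx).differentiableWithinAt, by simp,
    h₁.congr (D_eq_of_hasDerivWithinAt h)⟩

theorem D_congr {f g : ℝ → ℝ} (h : EqOn f g I01) : EqOn (D f) (D g) I01 :=
  fun _ hx => derivWithin_congr h (h hx)

namespace NeumannC2

variable {f f₁ f₂ g g₁ g₂ : ℝ → ℝ}

theorem of_contDiffOn (h : ContDiffOn ℝ 2 f I01) (h0 : D f 0 = 0) (h1 : D f 1 = 0) :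
    NeumannC2 f (D f) (D (D f)) := by
  have h' : ContDiffOn ℝ ((1 : ℕ) + 1) f I01 := by norm_num; exact h
  rw [contDiffOn_succ_iff_derivWithin uniqueDiffOn_I01] at h'
  have h2 : ContDiffOn ℝ ((0 : ℕ) + 1) (D f) I01 := by simpa using! h'.2.2
  rw [contDiffOn_succ_iff_derivWithin uniqueDiffOn_I01] at h2
  exact ⟨fun x hx => (h'.1 x hx).hasDerivWithinAt, fun x hx => (h2.1 x hx).hasDerivWithinAt,
    h2.2.2.continuousOn, h0, h1⟩

theorem D_eq (h : NeumannC2 f f₁ f₂) : EqOn (D f) f₁ I01 := D_eq_of_hasDerivWithinAt h.d1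

theorem DD_eq (h : NeumannC2 f f₁ f₂) : EqOn (D (D f)) f₂ I01 :=
  (D_congr h.D_eq).trans (D_eq_of_hasDerivWithinAt h.d2)

theorem cont (h : NeumannC2 f f₁ f₂) : ContinuousOn f I01 :=
  fun x hx => (h.d1 x hx).continuousWithinAt

theorem cont1 (h : NeumannC2 f f₁ f₂) : ContinuousOn f₁ I01 :=
  fun x hx => (h.d2 x hx).continuousWithinAt

theorem contDiffOn (h : NeumannC2 f f₁ f₂) : ContDiffOn ℝ 2 f I01 := by
  have := contDiffOn_succ_of_hasDerivWithinAt h.d1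
    (contDiffOn_succ_of_hasDerivWithinAt (n := 0) h.d2 (by simpa using! h.cont2))
  simpa using! this

theorem congr (h : NeumannC2 f f₁ f₂) (h0 : EqOn g f I01) (h1 : EqOn g₁ f₁ I01)
    (h2 : EqOn g₂ f₂ I01) : NeumannC2 g g₁ g₂ where
  d1 x hx := by rw [h1 hx]; exact (h.d1 x hx).congr h0 (h0 hx)
  d2 x hx := by rw [h2 hx]; exact (h.d2 x hx).congr h1 (h1 hx)
  cont2 := h.cont2.congr h2
  left := by rw [h1 zero_mem_I01, h.left]
  right := by rw [h1 one_mem_I01, h.right]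

theorem add (hf : NeumannC2 f f₁ f₂) (hg : NeumannC2 g g₁ g₂) :
    NeumannC2 (fun x => f x + g x) (fun x => f₁ x + g₁ x) (fun x => f₂ x + g₂ x) where
  d1 x hx := (hf.d1 x hx).add (hg.d1 x hx)
  d2 x hx := (hf.d2 x hx).add (hg.d2 x hx)
  cont2 := hf.cont2.add hg.cont2
  left := by simp [hf.left, hg.left]
  right := by simp [hf.right, hg.right]

theorem const_mul (a : ℝ) (hf : NeumannC2 f f₁ f₂) :
    NeumannC2 (fun x => a * f x) (fun x => a * f₁ x) (fun x => a * f₂ x) where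
  d1 x hx := (hf.d1 x hx).const_mul a
  d2 x hx := (hf.d2 x hx).const_mul a
  cont2 := continuousOn_const.mul hf.cont2
  left := by simp [hf.left]
  right := by simp [hf.right]

theorem sub (hf : NeumannC2 f f₁ f₂) (hg : NeumannC2 g g₁ g₂) :
    NeumannC2 (fun x => f x - g x) (fun x => f₁ x - g₁ x) (fun x => f₂ x - g₂ x) where
  d1 x hx := (hf.d1 x hx).sub (hg.d1 x hx)
  d2 x hx := (hf.d2 x hx).sub (hg.d2 x hx)
  cont2 := hf.cont2.sub hg.cont2
  left := by simp [hf.left, hg.left]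
  right := by simp [hf.right, hg.right]

theorem const (a : ℝ) : NeumannC2 (fun _ => a) (fun _ => 0) (fun _ => 0) where
  d1 x _ := hasDerivWithinAt_const x _ a
  d2 x _ := hasDerivWithinAt_const x _ 0
  cont2 := continuousOn_const
  left := rfl
  right := rfl

theorem sum {ι : Type*} (s : Finset ι) {f f₁ f₂ : ι → ℝ → ℝ}
    (h : ∀ i ∈ s, NeumannC2 (f i) (f₁ i) (f₂ i)) :
    NeumannC2 (fun x => ∑ i ∈ s, f i x) (fun x => ∑ i ∈ s, f₁ i x) (fun x => ∑ i ∈ s, f₂ i x) where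
  d1 x hx := HasDerivWithinAt.fun_sum fun i hi => (h i hi).d1 x hx
  d2 x hx := HasDerivWithinAt.fun_sum fun i hi => (h i hi).d2 x hx
  cont2 := continuousOn_finsetSum s fun i hi => (h i hi).cont2
  left := Finset.sum_eq_zero fun i hi => (h i hi).left
  right := Finset.sum_eq_zero fun i hi => (h i hi).right

theorem integral_mul_second (hf : NeumannC2 f f₁ f₂) (hg : NeumannC2 g g₁ g₂) :
    ∫ x in (0 : ℝ)..1, f x * g₂ x = -∫ x in (0 : ℝ)..1, f₁ x * g₁ x := by
  rw [intervalIntegral.integral_mul_deriv_eq_deriv_mul_of_hasDerivWithinAt (u := f) (u' := f₁)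
    (v := g₁) (v' := g₂) (by rw [uIcc_eq_I01]; exact hf.d1) (by rw [uIcc_eq_I01]; exact hg.d2)
    (intervalIntegrable_of_continuousOn hf.cont1) (intervalIntegrable_of_continuousOn hg.cont2)]
  simp [hg.left, hg.right]

/-- Green's identity. -/
theorem green (hf : NeumannC2 f f₁ f₂) (hg : NeumannC2 g g₁ g₂) :
    ∫ x in (0 : ℝ)..1, f x * g₂ x = ∫ x in (0 : ℝ)..1, g x * f₂ x := by
  rw [hf.integral_mul_second hg, hg.integral_mul_second hf]
  simp_rw [mul_comm]

end NeumannC2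

/-! ### Mean values, maximum principle, Cauchy uniqueness, Sobolev inequality, series. -/

theorem I01_ordConnected : OrdConnected I01 := ordConnected_Icc

/-- Mean value theorem on `[0,1]`, for end points in any order. -/
theorem exists_mean_value {f f₁ : ℝ → ℝ} (h : ∀ x ∈ I01, HasDerivWithinAt f (f₁ x) I01 x)
    {a b : ℝ} (ha : a ∈ I01) (hb : b ∈ I01) (hab : a ≠ b) :
    ∃ s ∈ I01, f b - f a = f₁ s * (b - a) ∧ 0 < (s - a) * (b - a) ∧ |s - a| < |b - a| := by
  have key : ∀ a b : ℝ, a ∈ I01 → b ∈ I01 → a < b →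
      ∃ s ∈ Ioo a b, f₁ s = (f b - f a) / (b - a) := by
    intro a b ha hb hab
    have hsub : Icc a b ⊆ I01 := I01_ordConnected.out ha hb
    refine exists_hasDerivAt_eq_slope f f₁ hab
      (fun x hx => (h x (hsub hx)).continuousWithinAt.mono hsub) fun x hx => ?_
    exact (h x (hsub (Ioo_subset_Icc_self hx))).hasDerivAt
      (mem_of_superset (Icc_mem_nhds hx.1 hx.2) hsub)
  rcases lt_or_gt_of_ne hab with hlt | hlt
  · obtain ⟨s, hs, e⟩ := key a b ha hb hlt
    refine ⟨s, I01_ordConnected.out ha hb (Ioo_subset_Icc_self hs), ?_, ?_, ?_⟩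
    · rw [e]; field_simp [(sub_pos.2 hlt).ne']
    · exact mul_pos (sub_pos.2 hs.1) (sub_pos.2 hlt)
    · rw [abs_of_pos (sub_pos.2 hs.1), abs_of_pos (sub_pos.2 hlt)]; linarith [hs.2]
  · obtain ⟨s, hs, e⟩ := key b a hb ha hlt
    refine ⟨s, I01_ordConnected.out hb ha (Ioo_subset_Icc_self hs), ?_, ?_, ?_⟩
    · rw [e]; field_simp [(sub_pos.2 hlt).ne']; ring
    · exact mul_pos_of_neg_of_neg (sub_neg.2 hs.2) (sub_neg.2 hlt)
    · rw [abs_of_neg (sub_neg.2 hs.2), abs_of_neg (sub_neg.2 hlt)]; linarith [hs.1]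

/-- At a minimum point of a function with Neumann conditions, boundary included, the second
derivative is nonnegative. -/
theorem NeumannC2.second_nonneg_of_isMinOn {f f₁ f₂ : ℝ → ℝ} (h : NeumannC2 f f₁ f₂) {x₀ : ℝ}
    (hx₀ : x₀ ∈ I01) (hmin : IsMinOn f I01 x₀) : 0 ≤ f₂ x₀ := by
  -- At an end point the Neumann condition replaces the interior criticality argument.
  have hcrit : f₁ x₀ = 0 := by
    rcases eq_or_lt_of_le hx₀.1 with e | h0
    · rw [← e, h.left]
    rcases eq_or_lt_of_le hx₀.2 with e | h1
    · rw [e, h.right]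
    · have hn : I01 ∈ 𝓝 x₀ := Icc_mem_nhds h0 h1
      exact (hmin.isLocalMin hn).hasDerivAt_eq_zero ((h.d1 x₀ hx₀).hasDerivAt hn)
  by_contra hneg
  push Not at hneg
  have hev : ∀ᶠ x in 𝓝[I01] x₀, f₂ x < 0 := (h.cont2 x₀ hx₀).eventually_lt_const hneg
  rw [eventually_nhdsWithin_iff, Metric.eventually_nhds_iff] at hev
  obtain ⟨ε, hε, hball⟩ := hev
  -- The second point is taken on the side where the interval has length at least `1/2`.
  obtain ⟨b, hb, hbne, hbε⟩ : ∃ b ∈ I01, x₀ ≠ b ∧ |b - x₀| < ε := by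
    have := hx₀.1
    have := hx₀.2
    rcases lt_or_ge x₀ (1 / 2) with hlt | hge
    · have hm : 0 < min (ε / 2) (1 / 2) := by positivity
      refine ⟨x₀ + min (ε / 2) (1 / 2), ⟨by linarith, ?_⟩, by linarith, ?_⟩
      · linarith [min_le_right (ε / 2) (1 / 2)]
      · rw [add_sub_cancel_left, abs_of_pos hm]; linarith [min_le_left (ε / 2) (1 / 2)]
    · have hm : 0 < min (ε / 2) (1 / 2) := by positivity
      refine ⟨x₀ - min (ε / 2) (1 / 2), ⟨?_, by linarith⟩, by linarith, ?_⟩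
      · linarith [min_le_right (ε / 2) (1 / 2)]
      · rw [sub_sub_cancel_left, abs_neg, abs_of_pos hm]; linarith [min_le_left (ε / 2) (1 / 2)]
  -- Two mean values give `f b - f x₀ = f₂ r (s - x₀)(b - x₀)`, with a positive product of
  -- increments and `f₂ r < 0`, against minimality.
  obtain ⟨s, hs, e1, hpos, hsb⟩ := exists_mean_value h.d1 hx₀ hb hbne
  have hsne : x₀ ≠ s := by rintro rfl; simp at hpos
  obtain ⟨r, hr, e2, -, hrs⟩ := exists_mean_value h.d2 hx₀ hs hsne
  have hr2 : f₂ r < 0 := hball (by rw [Real.dist_eq]; linarith) hr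
  have hm : f x₀ ≤ f b := hmin hb
  rw [hcrit, sub_zero] at e2
  rw [e2] at e1
  have : f₂ r * ((s - x₀) * (b - x₀)) < 0 := mul_neg_of_neg_of_pos hr2 hpos
  nlinarith

/-- Maximum principle: a lower bound for the solution of `-z'' + W z ≥ f`. -/
theorem NeumannC2.lower_bound {z z₁ z₂ W f : ℝ → ℝ} (h : NeumannC2 z z₁ z₂) {m M : ℝ}
    (hm : 0 ≤ m) (hW : ∀ x ∈ I01, 0 < W x) (hWM : ∀ x ∈ I01, W x ≤ M)
    (heq : ∀ x ∈ I01, f x ≤ W x * z x - z₂ x) (hf : ∀ x ∈ I01, m ≤ f x) :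
    ∀ x ∈ I01, m / M ≤ z x := by
  obtain ⟨x₀, hx₀, hmin⟩ := isCompact_I01.exists_isMinOn nonempty_I01 h.cont
  intro x hx
  refine le_trans ?_ (hmin hx)
  have h2 := h.second_nonneg_of_isMinOn hx₀ hmin
  have h3 := heq x₀ hx₀
  have h4 := hf x₀ hx₀
  have h5 := hW x₀ hx₀
  have h6 := hWM x₀ hx₀
  -- At the minimum `m ≤ W z`; the sign of `z` must be known before `W` is replaced by its upper
  -- bound `M`.
  have h7 : 0 ≤ z x₀ := by
    by_contra hc
    push Not at hc
    nlinarith [mul_neg_of_pos_of_neg h5 hc]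
  rw [div_le_iff₀ (h5.trans_le h6)]
  nlinarith

theorem NeumannC2.nonneg {z z₁ z₂ W : ℝ → ℝ} (h : NeumannC2 z z₁ z₂) (hWc : ContinuousOn W I01)
    (hW : ∀ x ∈ I01, 0 < W x) (heq : ∀ x ∈ I01, 0 ≤ W x * z x - z₂ x) :
    ∀ x ∈ I01, 0 ≤ z x := by
  obtain ⟨C, -, hC⟩ := exists_bound_I01 hWc
  simpa using! h.lower_bound (f := fun _ => 0) (M := C) le_rfl hW
    (fun x hx => (le_abs_self _).trans (hC x hx)) heq (fun _ _ => le_rfl)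

/-- A solution of `z'' = q z` with vanishing Cauchy data at a point is zero. -/
theorem NeumannC2.eq_zero_of_cauchy {z z₁ z₂ q : ℝ → ℝ} (h : NeumannC2 z z₁ z₂)
    (hq : ContinuousOn q I01) (heq : ∀ x ∈ I01, z₂ x = q x * z x) {x₀ : ℝ} (hx₀ : x₀ ∈ I01)
    (h0 : z x₀ = 0) (h1 : z₁ x₀ = 0) : ∀ x ∈ I01, z x = 0 := by
  obtain ⟨C, hC0, hC⟩ := exists_bound_I01 hq
  -- The energy satisfies `|E'| ≤ (1 + C) E`. Exponential weights of either sign then propagate `E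
  -- x₀ = 0` to both sides of `x₀`, as in Grönwall's lemma.
  set E : ℝ → ℝ := fun x => z x ^ 2 + z₁ x ^ 2 with hE
  have hEd : ∀ x ∈ I01, HasDerivWithinAt E (2 * (1 + q x) * (z x * z₁ x)) I01 x := by
    intro x hx
    have := ((h.d1 x hx).pow 2).add ((h.d2 x hx).pow 2)
    rw [heq x hx] at this
    convert! this using 1
    ring
  have hbd : ∀ x ∈ I01, |2 * (1 + q x) * (z x * z₁ x)| ≤ (1 + C) * E x := by
    intro x hx
    rw [abs_mul, abs_mul]
    have ha : |1 + q x| ≤ 1 + C := (abs_add_le _ _).trans (by simpa using hC x hx)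
    have hb : 2 * |z x * z₁ x| ≤ E x := by
      rw [abs_mul, hE]; nlinarith [sq_nonneg (|z x| - |z₁ x|), sq_abs (z x), sq_abs (z₁ x)]
    calc |(2 : ℝ)| * |1 + q x| * |z x * z₁ x| = |1 + q x| * (2 * |z x * z₁ x|) := by
          rw [abs_of_pos (by norm_num : (0 : ℝ) < 2)]; ring
      _ ≤ (1 + C) * E x := by gcongr
  have hE0 : E x₀ = 0 := by simp [hE, h0, h1]
  have hFd : ∀ (k : ℝ), ∀ x ∈ I01, HasDerivWithinAt (fun x => Real.exp (k * x) * E x)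
      (Real.exp (k * x) * (k * E x + 2 * (1 + q x) * (z x * z₁ x))) I01 x := by
    intro k x hx
    have h3 : HasDerivWithinAt (fun x => Real.exp (k * x)) (Real.exp (k * x) * k) I01 x := by
      have := (((hasDerivAt_id x).const_mul k).exp).hasDerivWithinAt (s := I01)
      simpa using! this
    convert! h3.mul (hEd x hx) using 1
    ring
  have hle : ∀ x ∈ I01, E x ≤ 0 := by
    intro x hx
    rcases le_total x₀ x with hxx | hxx
    · have hanti : AntitoneOn (fun x => Real.exp (-(1 + C) * x) * E x) I01 := by
        refine antitoneOn_of_deriv_nonpos (convex_Icc 0 1)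
          (fun y hy => (hFd _ y hy).continuousWithinAt) ?_ ?_ <;> rw [interior_Icc] <;> intro y hy
        · exact ((hFd _ y (Ioo_subset_Icc_self hy)).hasDerivAt
            (Icc_mem_nhds hy.1 hy.2)).differentiableAt.differentiableWithinAt
        · rw [((hFd _ y (Ioo_subset_Icc_self hy)).hasDerivAt (Icc_mem_nhds hy.1 hy.2)).deriv]
          have := abs_le.1 (hbd y (Ioo_subset_Icc_self hy))
          exact mul_nonpos_of_nonneg_of_nonpos (Real.exp_pos _).le (by linarith)
      have := hanti hx₀ hx hxx
      simp only [hE0, mul_zero] at this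
      exact nonpos_of_mul_nonpos_right this (Real.exp_pos _)
    · have hmono : MonotoneOn (fun x => Real.exp ((1 + C) * x) * E x) I01 := by
        refine monotoneOn_of_deriv_nonneg (convex_Icc 0 1)
          (fun y hy => (hFd _ y hy).continuousWithinAt) ?_ ?_ <;> rw [interior_Icc] <;> intro y hy
        · exact ((hFd _ y (Ioo_subset_Icc_self hy)).hasDerivAt
            (Icc_mem_nhds hy.1 hy.2)).differentiableAt.differentiableWithinAt
        · rw [((hFd _ y (Ioo_subset_Icc_self hy)).hasDerivAt (Icc_mem_nhds hy.1 hy.2)).deriv]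
          have := abs_le.1 (hbd y (Ioo_subset_Icc_self hy))
          exact mul_nonneg (Real.exp_pos _).le (by linarith)
      have := hmono hx hx₀ hxx
      simp only [hE0, mul_zero] at this
      exact nonpos_of_mul_nonpos_right this (Real.exp_pos _)
  intro x hx
  have := hle x hx
  simp only [hE] at this
  nlinarith [sq_nonneg (z x), sq_nonneg (z₁ x)]

/-- The Sobolev inequality on `[0,1]`. -/
theorem sq_le_integral_add_integral {f f₁ : ℝ → ℝ}
    (h : ∀ x ∈ I01, HasDerivWithinAt f (f₁ x) I01 x) (hc : ContinuousOn f₁ I01) :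
    ∀ x ∈ I01, f x ^ 2 ≤ 2 * (∫ y in (0 : ℝ)..1, f y ^ 2) + ∫ y in (0 : ℝ)..1, f₁ y ^ 2 := by
  have hfc : ContinuousOn f I01 := fun x hx => (h x hx).continuousWithinAt
  intro x hx
  have hbc : ContinuousOn (fun y => f y ^ 2 + f₁ y ^ 2) I01 := by fun_prop
  -- Write `f(x)² - f(y)² = ∫ 2 f f₁`, bound the integrand by `f² + f₁²`, and then average over `y`.
  have hdiff : ∀ y ∈ I01, f x ^ 2 - f y ^ 2 ≤ ∫ s in (0 : ℝ)..1, (f s ^ 2 + f₁ s ^ 2) := by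
    intro y hy
    have hsub : uIcc y x ⊆ I01 := I01_ordConnected.uIcc_subset hy hx
    have hftc : ∫ s in y..x, 2 * f s * f₁ s = f x ^ 2 - f y ^ 2 := by
      refine intervalIntegral.integral_eq_sub_of_hasDeriv_right
        (f := fun s => f s ^ 2) ((hfc.pow 2).mono hsub) (fun s hs => ?_)
        (ContinuousOn.intervalIntegrable ?_)
      · have hs' : s ∈ I01 := hsub (Ioo_subset_Icc_self hs)
        have hn : I01 ∈ 𝓝 s := mem_of_superset (Icc_mem_nhds hs.1 hs.2) hsub
        have := (((h s hs').hasDerivAt hn).pow 2).hasDerivWithinAt (s := Ioi s)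
        simpa using! this
      · exact ((continuousOn_const.mul hfc).mul hc).mono hsub
    rw [← hftc]
    refine (le_abs_self _).trans (abs_integral_le_integral_I01 hy hx (by fun_prop) hbc
      fun s _ => ?_)
    rw [abs_le]
    constructor <;> nlinarith [sq_nonneg (f s + f₁ s), sq_nonneg (f s - f₁ s)]
  have hint : f x ^ 2 - ∫ y in (0 : ℝ)..1, f y ^ 2 ≤ ∫ s in (0 : ℝ)..1, (f s ^ 2 + f₁ s ^ 2) := by
    have := integral_mono_I01 (f := fun y => f x ^ 2 - f y ^ 2)
      (g := fun _ => ∫ s in (0 : ℝ)..1, (f s ^ 2 + f₁ s ^ 2)) (by fun_prop) (by fun_prop) hdiff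
    rw [integral_sub_I01 (by fun_prop) (by fun_prop)] at this
    simpa using this
  rw [integral_add_I01 (by fun_prop) (by fun_prop)] at hint
  linarith

/-- Termwise differentiation, within a closed interval or a half line. -/
theorem hasDerivWithinAt_tsum {S : Set ℝ} (hS : OrdConnected S) {ρ : ℝ → ℝ} (hρ : Continuous ρ)
    (hρS : ∀ x, ρ x ∈ S) (hρe : ∀ x ∈ S, ρ x = x) {f f₁ : ℕ → ℝ → ℝ} {u : ℕ → ℝ}
    (hu : Summable u) (h : ∀ n, ∀ x ∈ S, HasDerivWithinAt (f n) (f₁ n x) S x)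
    (hc : ∀ n, ContinuousOn (f₁ n) S) (hb : ∀ n, ∀ x ∈ S, |f₁ n x| ≤ u n) {x₀ : ℝ}
    (hx₀ : x₀ ∈ S) (hsum : Summable fun n => f n x₀) :
    ∀ x ∈ S, HasDerivWithinAt (fun y => ∑' n, f n y) (∑' n, f₁ n x) S x := by
  have hc' : ∀ n, Continuous fun x => f₁ n (ρ x) := fun n => (hc n).comp_continuous hρ hρS
  -- Each term is continued beyond `S` as a primitive of `f₁ n ∘ ρ`, with `ρ` a retraction onto `S`;
  -- the two-sided theorem on the whole line then applies.
  set g : ℕ → ℝ → ℝ := fun n x => f n x₀ + ∫ s in x₀..x, f₁ n (ρ s) with hg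
  have hgd : ∀ n x, HasDerivAt (g n) (f₁ n (ρ x)) x := fun n x =>
    ((hc' n).integral_hasStrictDerivAt x₀ x).hasDerivAt.const_add _
  have hfg : ∀ n, ∀ x ∈ S, f n x = g n x := by
    intro n x hx
    have hsub : uIcc x₀ x ⊆ S := hS.uIcc_subset hx₀ hx
    have : ∫ s in x₀..x, f₁ n (ρ s) = f n x - f n x₀ := by
      refine intervalIntegral.integral_eq_sub_of_hasDeriv_right
        (fun s hs => (h n s (hsub hs)).continuousWithinAt.mono hsub) (fun s hs => ?_)
        (hc' n).continuousOn.intervalIntegrable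
      have hs' : s ∈ S := hsub (Ioo_subset_Icc_self hs)
      rw [hρe s hs']
      exact ((h n s hs').hasDerivAt
        (mem_of_superset (Icc_mem_nhds hs.1 hs.2) hsub)).hasDerivWithinAt
    simp [hg, this]
  intro x hx
  have := (hasDerivAt_tsum hu hgd (fun n y => hb n _ (hρS y)) (y₀ := x₀)
    (by simpa [hg] using hsum) x).hasDerivWithinAt (s := S)
  rw [hρe x hx] at this
  exact this.congr (fun y hy => tsum_congr fun n => hfg n y hy) (tsum_congr fun n => hfg n x hx)

theorem hasDerivWithinAt_tsum_I01 {f f₁ : ℕ → ℝ → ℝ} {u : ℕ → ℝ} (hu : Summable u)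
    (h : ∀ n, ∀ x ∈ I01, HasDerivWithinAt (f n) (f₁ n x) I01 x)
    (hc : ∀ n, ContinuousOn (f₁ n) I01) (hb : ∀ n, ∀ x ∈ I01, |f₁ n x| ≤ u n)
    (hsum : Summable fun n => f n 0) :
    ∀ x ∈ I01, HasDerivWithinAt (fun y => ∑' n, f n y) (∑' n, f₁ n x) I01 x :=
  hasDerivWithinAt_tsum I01_ordConnected (ρ := fun x => projIcc (0 : ℝ) 1 zero_le_one x)
    (continuous_subtype_val.comp continuous_projIcc) (fun x => (projIcc _ _ _ x).2)
    (fun x hx => by rw [projIcc_of_mem zero_le_one hx]) hu h hc hb zero_mem_I01 hsum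

theorem hasDerivWithinAt_tsum_Ici {f f₁ : ℕ → ℝ → ℝ} {u : ℕ → ℝ} (hu : Summable u)
    (h : ∀ n, ∀ x ∈ Ici (0 : ℝ), HasDerivWithinAt (f n) (f₁ n x) (Ici 0) x)
    (hc : ∀ n, ContinuousOn (f₁ n) (Ici 0)) (hb : ∀ n, ∀ x ∈ Ici (0 : ℝ), |f₁ n x| ≤ u n)
    (hsum : Summable fun n => f n 0) :
    ∀ x ∈ Ici (0 : ℝ), HasDerivWithinAt (fun y => ∑' n, f n y) (∑' n, f₁ n x) (Ici 0) x :=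
  hasDerivWithinAt_tsum ordConnected_Ici (ρ := fun x => max 0 x) (by fun_prop)
    (fun x => mem_Ici.2 (le_max_left _ _))
    (fun x hx => max_eq_right hx) hu h hc hb self_mem_Ici hsum

end HeatFlow

namespace HeatFlow

/-! ### Orthonormal families of Neumann eigenfunctions -/

/-- An orthonormal family of eigenfunctions of `-∂ₓₓ + V` with Neumann conditions. -/
structure IsEigenFamily {ι : Type*} [DecidableEq ι] (V : ℝ → ℝ) (μ : ι → ℝ) (e : ι → ℝ → ℝ) :
    Prop where
  neumann : ∀ i, NeumannC2 (e i) (D (e i)) (fun x => (V x - μ i) * e i x)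
  orthonormal : ∀ i j, ∫ x in (0 : ℝ)..1, e i x * e j x = if i = j then 1 else 0

/-- A Neumann eigenvalue is determined up to a factor by its value at the left end point. -/
theorem NeumannC2.proportional {f f₁ g g₁ q : ℝ → ℝ} (hq : ContinuousOn q I01)
    (hf : NeumannC2 f f₁ (fun x => q x * f x)) (hg : NeumannC2 g g₁ (fun x => q x * g x)) :
    ∀ x ∈ I01, f 0 * g x = g 0 * f x := by
  -- The combination `f 0 * g - g 0 * f` has zero value and zero slope at the left end point.
  have h := ((hg.const_mul (f 0)).sub (hf.const_mul (g 0))).eq_zero_of_cauchy (q := q) hq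
    (fun x _ => by ring) zero_mem_I01 (by ring) (by simp [hf.left, hg.left])
  exact fun x hx => sub_eq_zero.1 (h x hx)

theorem NeumannC2.eq_zero_of_left {f f₁ q : ℝ → ℝ} (hq : ContinuousOn q I01)
    (hf : NeumannC2 f f₁ (fun x => q x * f x)) (h0 : f 0 = 0) : ∀ x ∈ I01, f x = 0 :=
  hf.eq_zero_of_cauchy hq (fun _ _ => rfl) zero_mem_I01 h0 hf.left

section

variable {ι : Type*} [DecidableEq ι] {V : ℝ → ℝ} {μ : ι → ℝ} {e : ι → ℝ → ℝ}

theorem IsEigenFamily.cont (h : IsEigenFamily V μ e) (i : ι) : ContinuousOn (e i) I01 :=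
  (h.neumann i).cont

theorem IsEigenFamily.integral_sum_mul_sum (h : IsEigenFamily V μ e) (F : Finset ι)
    (a b : ι → ℝ) :
    ∫ x in (0 : ℝ)..1, (∑ i ∈ F, a i * e i x) * (∑ i ∈ F, b i * e i x)
      = ∑ i ∈ F, a i * b i := by
  have hc := h.cont
  simp_rw [Finset.sum_mul_sum]
  rw [intervalIntegral.integral_finsetSum]
  · refine Finset.sum_congr rfl fun i hi => ?_
    rw [intervalIntegral.integral_finsetSum]
    · have : ∀ j, ∫ x in (0 : ℝ)..1, a i * e i x * (b j * e j x)
          = if i = j then a i * b j else 0 := by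
        intro j
        have e1 : ∀ x, a i * e i x * (b j * e j x) = (a i * b j) * (e i x * e j x) :=
          fun x => by ring
        simp_rw [e1]
        rw [intervalIntegral.integral_const_mul, h.orthonormal]
        simp
      simp_rw [this]
      simp [hi]
    · intro j _
      exact intervalIntegrable_of_continuousOn
        ((continuousOn_const.mul (hc i)).mul (continuousOn_const.mul (hc j)))
  · intro i _
    refine intervalIntegrable_of_continuousOn (continuousOn_finsetSum _ fun j _ => ?_)
    exact (continuousOn_const.mul (hc i)).mul (continuousOn_const.mul (hc j))

/-- Integration by parts turns the Dirichlet form of a finite combination into its pairing with its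
image under `-∂ₓₓ + V`, which is diagonal in the family. -/
theorem IsEigenFamily.energy (h : IsEigenFamily V μ e) (hV : ContinuousOn V I01) (F : Finset ι)
    (a : ι → ℝ) :
    (∫ x in (0 : ℝ)..1, (∑ i ∈ F, a i * D (e i) x) ^ 2)
      + ∫ x in (0 : ℝ)..1, V x * (∑ i ∈ F, a i * e i x) ^ 2 = ∑ i ∈ F, μ i * a i ^ 2 := by
  have hN := NeumannC2.sum F fun i _ => (h.neumann i).const_mul (a i)
  have h1 := hN.integral_mul_second hN
  have hc : ContinuousOn (fun x => ∑ i ∈ F, a i * e i x) I01 := hN.cont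
  have hc2 : ContinuousOn (fun x => ∑ i ∈ F, (μ i * a i) * e i x) I01 :=
    continuousOn_finsetSum _ fun i _ => continuousOn_const.mul (h.cont i)
  have h2 : ∀ x, (∑ i ∈ F, a i * e i x) * (∑ i ∈ F, a i * ((V x - μ i) * e i x))
      = V x * (∑ i ∈ F, a i * e i x) ^ 2
        - (∑ i ∈ F, a i * e i x) * (∑ i ∈ F, (μ i * a i) * e i x) := by
    intro x
    have : ∑ i ∈ F, a i * ((V x - μ i) * e i x)
        = V x * (∑ i ∈ F, a i * e i x) - ∑ i ∈ F, (μ i * a i) * e i x := by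
      rw [Finset.mul_sum, ← Finset.sum_sub_distrib]
      exact Finset.sum_congr rfl fun i _ => by ring
    rw [this]; ring
  simp_rw [h2] at h1
  rw [integral_sub_I01 (by fun_prop) (by fun_prop), h.integral_sum_mul_sum] at h1
  simp_rw [← pow_two] at h1
  have h3 : ∑ i ∈ F, a i * (μ i * a i) = ∑ i ∈ F, μ i * a i ^ 2 :=
    Finset.sum_congr rfl fun i _ => by ring
  linarith

theorem IsEigenFamily.le_eigenvalue (h : IsEigenFamily V μ e) (hV : ContinuousOn V I01) {δ : ℝ}
    (hδ : ∀ x ∈ I01, δ ≤ V x) (i : ι) : δ ≤ μ i := by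
  have h1 := h.energy hV {i} (fun _ => 1)
  simp only [Finset.sum_singleton, one_mul, one_pow, mul_one] at h1
  have hc := h.cont i
  have h2 : ∫ x in (0 : ℝ)..1, δ * e i x ^ 2 ≤ ∫ x in (0 : ℝ)..1, V x * e i x ^ 2 :=
    integral_mono_I01 (by fun_prop) (by fun_prop)
      fun x hx => mul_le_mul_of_nonneg_right (hδ x hx) (sq_nonneg _)
  have h3 : ∫ x in (0 : ℝ)..1, e i x ^ 2 = 1 := by simpa [pow_two] using h.orthonormal i i
  rw [intervalIntegral.integral_const_mul, h3] at h2
  have h4 : 0 ≤ ∫ x in (0 : ℝ)..1, D (e i) x ^ 2 := integral_nonneg_I01 fun x _ => sq_nonneg _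
  linarith

/-- The sum is a truncation of the Green function of `-∂ₓₓ + V` on the diagonal. The Sobolev
inequality at `x`, applied to the truncated Green function with pole at `x`, bounds the square of
the sum `s` by a multiple of its energy, which is again `s`. The bound depends neither on `F` nor on
`x`. -/
theorem IsEigenFamily.sum_sq_div_le (h : IsEigenFamily V μ e) (hV : ContinuousOn V I01) {δ : ℝ}
    (hδ0 : 0 < δ) (hδ : ∀ x ∈ I01, δ ≤ V x) (F : Finset ι) :
    ∀ x ∈ I01, ∑ i ∈ F, e i x ^ 2 / μ i ≤ 2 / δ + 1 := by
  intro x hx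
  have hμ : ∀ i, 0 < μ i := fun i => hδ0.trans_le (h.le_eigenvalue hV hδ i)
  -- These are the coefficients of the Green function with pole `x`: the combination takes the value
  -- `s` at `x` and also has energy `s`.
  set a : ι → ℝ := fun i => e i x / μ i with ha
  set s := ∑ i ∈ F, e i x ^ 2 / μ i with hs
  have hN := NeumannC2.sum F fun i _ => (h.neumann i).const_mul (a i)
  have hE := h.energy hV F a
  have hS := sq_le_integral_add_integral hN.d1 hN.cont1 x hx
  have e1 : ∑ i ∈ F, a i * e i x = s :=
    Finset.sum_congr rfl fun i _ => by rw [ha]; ring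
  have e2 : ∑ i ∈ F, μ i * a i ^ 2 = s :=
    Finset.sum_congr rfl fun i _ => by rw [ha]; field_simp [(hμ i).ne']
  rw [e1] at hS
  rw [e2] at hE
  have hc : ContinuousOn (fun x => ∑ i ∈ F, a i * e i x) I01 := hN.cont
  have h2 : δ * ∫ y in (0 : ℝ)..1, (∑ i ∈ F, a i * e i y) ^ 2
      ≤ ∫ y in (0 : ℝ)..1, V y * (∑ i ∈ F, a i * e i y) ^ 2 := by
    rw [← intervalIntegral.integral_const_mul]
    exact integral_mono_I01 (by fun_prop) (by fun_prop)
      fun x hx => mul_le_mul_of_nonneg_right (hδ x hx) (sq_nonneg _)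
  have h4 : 0 ≤ ∫ y in (0 : ℝ)..1, (∑ i ∈ F, a i * D (e i) y) ^ 2 :=
    integral_nonneg_I01 fun x _ => sq_nonneg _
  have h5 : 0 ≤ s := Finset.sum_nonneg fun i _ => div_nonneg (sq_nonneg _) (hμ i).le
  have h6 : 0 ≤ ∫ y in (0 : ℝ)..1, (∑ i ∈ F, a i * e i y) ^ 2 :=
    integral_nonneg_I01 fun x _ => sq_nonneg _
  have h7 : ∫ y in (0 : ℝ)..1, (∑ i ∈ F, a i * e i y) ^ 2 ≤ s / δ := by
    rw [le_div_iff₀ hδ0]; linarith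
  have h8 : s ^ 2 ≤ (2 / δ + 1) * s := by
    have : (2 / δ + 1) * s = 2 * (s / δ) + s := by ring
    have h9 : 0 ≤ δ * ∫ y in (0 : ℝ)..1, (∑ i ∈ F, a i * e i y) ^ 2 := by positivity
    rw [this]; linarith
  by_contra hc
  push Not at hc
  have : 0 < 2 / δ + 1 := by positivity
  nlinarith

/-- Integrating the diagonal bound over `x` gives a trace bound for the inverse operator. It
replaces eigenvalue asymptotics wherever summability or discreteness is needed. -/
theorem IsEigenFamily.sum_inv_le (h : IsEigenFamily V μ e) (hV : ContinuousOn V I01) {δ : ℝ}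
    (hδ0 : 0 < δ) (hδ : ∀ x ∈ I01, δ ≤ V x) (F : Finset ι) :
    ∑ i ∈ F, (μ i)⁻¹ ≤ 2 / δ + 1 := by
  have hc : ∀ i ∈ F, ContinuousOn (fun x => e i x ^ 2 / μ i) I01 := fun i _ =>
    ((h.cont i).pow 2).div_const _
  have h1 := integral_mono_I01 (continuousOn_finsetSum F hc) continuousOn_const
    (h.sum_sq_div_le hV hδ0 hδ F)
  rw [intervalIntegral.integral_finsetSum fun i hi => intervalIntegrable_of_continuousOn (hc i hi)]
    at h1
  simp only [intervalIntegral.integral_const, sub_zero, one_smul] at h1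
  refine le_trans (le_of_eq (Finset.sum_congr rfl fun i _ => ?_)) h1
  rw [intervalIntegral.integral_div]
  have := h.orthonormal i i
  simp only [if_true, ← pow_two] at this
  rw [this, one_div]

/-- A single term of the diagonal bound gives `e i ^ 2 ≤ C μ i`. The equation then controls the
second derivative, and integration from the left end point, where the slope vanishes, controls the
first. Lower powers of `μ i` are absorbed with `δ ≤ μ i`. -/
theorem IsEigenFamily.exists_bounds (h : IsEigenFamily V μ e) (hV : ContinuousOn V I01)
    (hVpos : ∀ x ∈ I01, 0 < V x) :
    ∃ B, 0 < B ∧ ∀ i, ∀ x ∈ I01, |e i x| ≤ B * μ i ^ 2 ∧ |D (e i) x| ≤ B * μ i ^ 2 ∧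
      |(V x - μ i) * e i x| ≤ B * μ i ^ 2 := by
  obtain ⟨δ, hδ0, hδ⟩ := exists_pos_le_of_pos hV hVpos
  obtain ⟨W, hW0, hW⟩ := exists_bound_I01 hV
  have hμ : ∀ i, δ ≤ μ i := h.le_eigenvalue hV hδ
  set C := 2 / δ + 1 with hC
  have hC0 : 0 < C := by positivity
  set B₀ := Real.sqrt (C / δ) with hB₀
  have hB₀p : 0 < B₀ := Real.sqrt_pos.2 (by positivity)
  have he : ∀ i, ∀ x ∈ I01, |e i x| ≤ B₀ * μ i := by
    intro i x hx
    have hμi : 0 < μ i := hδ0.trans_le (hμ i)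
    have h1 := h.sum_sq_div_le hV hδ0 hδ {i} x hx
    rw [Finset.sum_singleton, div_le_iff₀ hμi] at h1
    refine abs_le_of_sq_le_sq ?_ (by positivity)
    rw [mul_pow, Real.sq_sqrt (by positivity)]
    refine h1.trans ?_
    rw [div_mul_eq_mul_div, le_div_iff₀ hδ0]
    nlinarith [mul_le_mul_of_nonneg_left (hμ i) (mul_pos hC0 hμi).le]
  have h2 : ∀ i, ∀ x ∈ I01, |(V x - μ i) * e i x| ≤ ((W / δ + 1) * B₀) * μ i ^ 2 := by
    intro i x hx
    have hμi : 0 < μ i := hδ0.trans_le (hμ i)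
    have h3 : |V x - μ i| ≤ (W / δ + 1) * μ i := by
      refine (abs_sub _ _).trans ?_
      rw [abs_of_pos hμi]
      have : W ≤ W / δ * μ i := by
        rw [div_mul_eq_mul_div, le_div_iff₀ hδ0]
        exact mul_le_mul_of_nonneg_left (hμ i) hW0
      linarith [hW x hx]
    rw [abs_mul]
    calc |V x - μ i| * |e i x| ≤ ((W / δ + 1) * μ i) * (B₀ * μ i) :=
          mul_le_mul h3 (he i x hx) (abs_nonneg _) (by positivity)
      _ = _ := by ring
  -- The first summand serves both derivatives, the second the function itself.
  refine ⟨(W / δ + 1) * B₀ + B₀ / δ, by positivity, fun i x hx => ⟨?_, ?_, ?_⟩⟩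
  · have hμi : 0 < μ i := hδ0.trans_le (hμ i)
    have : B₀ * μ i ≤ B₀ / δ * μ i ^ 2 := by
      rw [div_mul_eq_mul_div, le_div_iff₀ hδ0]
      nlinarith [mul_le_mul_of_nonneg_left (hμ i) (mul_pos hB₀p hμi).le]
    have h4 : 0 ≤ (W / δ + 1) * B₀ * μ i ^ 2 := by positivity
    linarith [he i x hx]
  · have hμi : 0 < μ i := hδ0.trans_le (hμ i)
    have hN := h.neumann i
    have hsub : uIcc 0 x ⊆ I01 := I01_ordConnected.uIcc_subset zero_mem_I01 hx
    have hftc : ∫ s in (0 : ℝ)..x, (V s - μ i) * e i s = D (e i) x - D (e i) 0 := by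
      refine intervalIntegral.integral_eq_sub_of_hasDeriv_right (hN.cont1.mono hsub)
        (fun s hs => ?_) (hN.cont2.mono hsub).intervalIntegrable
      exact ((hN.d2 s (hsub (Ioo_subset_Icc_self hs))).hasDerivAt
        (mem_of_superset (Icc_mem_nhds hs.1 hs.2) hsub)).hasDerivWithinAt
    rw [hN.left, sub_zero] at hftc
    rw [← hftc]
    refine (abs_integral_le_integral_I01 zero_mem_I01 hx hN.cont2 continuousOn_const
      (h2 i)).trans ?_
    have h4 : 0 ≤ B₀ / δ * μ i ^ 2 := by positivity
    simp only [intervalIntegral.integral_const, sub_zero, one_smul]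
    linarith
  · have h4 : 0 ≤ B₀ / δ * μ i ^ 2 := by positivity
    linarith [h2 i x hx]

end

end HeatFlow

namespace HeatFlow

/-! ### The resolvent -/

/-- The Green function of `-∂ₓₓ + κ²` on `[0,1]` with Neumann conditions. -/
noncomputable def greenKernel (κ x y : ℝ) : ℝ :=
  Real.cosh (κ * (1 - max x y)) * Real.cosh (κ * min x y) / (κ * Real.sinh κ)

theorem continuous_greenKernel (κ : ℝ) : Continuous fun p : ℝ × ℝ => greenKernel κ p.1 p.2 := by
  unfold greenKernel
  fun_prop

/-- Variation of constants: on either side of `y = x` the kernel is a product of two solutions of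
`w'' = κ² w`, one satisfying each of the Neumann conditions. -/
theorem neumannC2_integral_greenKernel {κ : ℝ} (hκ : 0 < κ) {h : ℝ → ℝ} (hh : Continuous h) :
    ∃ u₁, NeumannC2 (fun x => ∫ y in (0 : ℝ)..1, greenKernel κ x y * h y) u₁
      (fun x => κ ^ 2 * (∫ y in (0 : ℝ)..1, greenKernel κ x y * h y) - h x) := by
  have hs : 0 < Real.sinh κ := Real.sinh_pos_iff.2 hκ
  set c := (κ * Real.sinh κ)⁻¹ with hc
  set A : ℝ → ℝ := fun x => Real.cosh (κ * (1 - x)) with hA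
  set B : ℝ → ℝ := fun x => Real.cosh (κ * x) with hB
  set A' : ℝ → ℝ := fun x => -(κ * Real.sinh (κ * (1 - x))) with hA'
  set B' : ℝ → ℝ := fun x => κ * Real.sinh (κ * x) with hB'
  have dA : ∀ x, HasDerivAt A (A' x) x := fun x => by
    have := (((hasDerivAt_id x).const_sub 1).const_mul κ).cosh
    convert! this using 1
    simp [hA']; ring
  have dB : ∀ x, HasDerivAt B (B' x) x := fun x => by
    have := ((hasDerivAt_id x).const_mul κ).cosh
    convert! this using 1
    simp [hB']; ring
  have dA' : ∀ x, HasDerivAt A' (κ ^ 2 * A x) x := fun x => by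
    have := ((((hasDerivAt_id x).const_sub 1).const_mul κ).sinh.const_mul κ).neg
    convert! this using 1
    simp [hA]; ring
  have dB' : ∀ x, HasDerivAt B' (κ ^ 2 * B x) x := fun x => by
    have := (((hasDerivAt_id x).const_mul κ).sinh).const_mul κ
    convert! this using 1
    simp [hB]; ring
  have cA : Continuous A := by fun_prop
  have cB : Continuous B := by fun_prop
  set P : ℝ → ℝ := fun x => ∫ y in (0 : ℝ)..x, B y * h y with hP
  -- Based at `1`, so that `R` vanishes at the right end point, as `P` does at the left one.
  set R : ℝ → ℝ := fun x => ∫ y in (1 : ℝ)..x, A y * h y with hR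
  have dP : ∀ x, HasDerivAt P (B x * h x) x := fun x =>
    ((cB.mul hh).integral_hasStrictDerivAt 0 x).hasDerivAt
  have dR : ∀ x, HasDerivAt R (A x * h x) x := fun x =>
    ((cA.mul hh).integral_hasStrictDerivAt 1 x).hasDerivAt
  have hu : ∀ x ∈ I01, ∫ y in (0 : ℝ)..1, greenKernel κ x y * h y
      = c * (A x * P x - B x * R x) := by
    intro x hx
    have hk : Continuous fun y => greenKernel κ x y * h y := by
      have := continuous_greenKernel κ
      fun_prop
    rw [← intervalIntegral.integral_add_adjacent_intervals (hk.intervalIntegrable 0 x)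
      (hk.intervalIntegrable x 1)]
    have e1 : ∫ y in (0 : ℝ)..x, greenKernel κ x y * h y = c * A x * P x := by
      rw [hP, ← intervalIntegral.integral_const_mul]
      refine intervalIntegral.integral_congr fun y hy => ?_
      rw [uIcc_of_le hx.1] at hy
      simp only [greenKernel, max_eq_left hy.2, min_eq_right hy.2, hA, hB, hc]
      ring
    have e2 : ∫ y in x..1, greenKernel κ x y * h y = -(c * B x * R x) := by
      have e3 : R x = -∫ y in x..1, A y * h y := intervalIntegral.integral_symm x 1
      rw [e3, mul_neg, neg_neg, ← intervalIntegral.integral_const_mul]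
      refine intervalIntegral.integral_congr fun y hy => ?_
      rw [uIcc_of_le hx.2] at hy
      simp only [greenKernel, max_eq_right hy.1, min_eq_left hy.1, hA, hB, hc]
      ring
    rw [e1, e2]
    ring
  have hmain : NeumannC2 (fun x => c * (A x * P x - B x * R x))
      (fun x => c * (A' x * P x - B' x * R x))
      (fun x => κ ^ 2 * (c * (A x * P x - B x * R x)) - h x) := by
    refine ⟨fun x _ => ?_, fun x _ => ?_, ?_, ?_, ?_⟩
    · have := (((dA x).mul (dP x)).sub ((dB x).mul (dR x))).const_mul c
      convert! this.hasDerivWithinAt using 1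
      ring
    · have := (((dA' x).mul (dP x)).sub ((dB' x).mul (dR x))).const_mul c
      convert! this.hasDerivWithinAt using 1
      -- The Wronskian is constant; the normalisation of the kernel makes it contribute exactly
      -- `-h`.
      have e : A' x * B x - B' x * A x = -(κ * Real.sinh κ) := by
        have : κ = κ * (1 - x) + κ * x := by ring
        simp only [hA', hB', hA, hB]
        conv_rhs => rw [this, Real.sinh_add]
        ring
      have e' : c * (A' x * B x - B' x * A x) = -1 := by
        rw [e, hc]; field_simp
      linear_combination -(h x) * e'
    · have hPc : Continuous P := continuous_iff_continuousAt.2 fun x => (dP x).continuousAt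
      have hRc : Continuous R := continuous_iff_continuousAt.2 fun x => (dR x).continuousAt
      fun_prop
    · simp [hP, hB']
    · simp [hR, hA']
  refine ⟨_, hmain.congr hu (fun x _ => rfl) fun x hx => ?_⟩
  rw [hu x hx]

/-- The Hilbert space `L²([0,1])`. -/
abbrev L2I : Type := Lp ℝ 2 (volume : Measure unitInterval)

/-- The inclusion of the continuous functions in `L²([0,1])`. -/
noncomputable def toL2 : C(unitInterval, ℝ) →L[ℝ] L2I := ContinuousMap.toLp 2 volume ℝ

/-- Extension of a continuous function from `[0,1]` to the real line. -/
noncomputable def extend (h : C(unitInterval, ℝ)) (x : ℝ) : ℝ := h (projIcc 0 1 zero_le_one x)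

/-- Restriction of a function on the real line to `[0,1]`. -/
def restr (f : ℝ → ℝ) (hf : ContinuousOn f I01) : C(unitInterval, ℝ) where
  toFun x := f x
  continuous_toFun := continuousOn_iff_continuous_domRestrict.1 hf

theorem continuous_extend (h : C(unitInterval, ℝ)) : Continuous (extend h) :=
  h.continuous.comp continuous_projIcc

theorem extend_coe (h : C(unitInterval, ℝ)) (x : unitInterval) : extend h x = h x := by
  simp only [extend, projIcc_val]

theorem extend_restr {f : ℝ → ℝ} (hf : ContinuousOn f I01) : EqOn (extend (restr f hf)) f I01 :=
  fun x hx => extend_coe (restr f hf) ⟨x, hx⟩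

theorem integral_unitInterval (f : ℝ → ℝ) :
    ∫ x : unitInterval, f x = ∫ x in (0 : ℝ)..1, f x := by
  rw [intervalIntegral.integral_of_le zero_le_one, ← integral_Icc_eq_integral_Ioc]
  exact integral_subtype measurableSet_Icc f

theorem inner_toL2 (f g : C(unitInterval, ℝ)) :
    inner ℝ (toL2 f) (toL2 g) = ∫ x in (0 : ℝ)..1, extend f x * extend g x := by
  rw [← integral_unitInterval, toL2, ContinuousMap.inner_toLp]
  refine integral_congr_ae (Eventually.of_forall fun x => ?_)
  simp [extend_coe, mul_comm]

/-! ### Compactness of operators defined by a continuous family of vectors. -/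

section

variable {X H : Type*} [TopologicalSpace X] [CompactSpace X] [NormedAddCommGroup H]
  [InnerProductSpace ℝ H]

/-- The operator `f ↦ (x ↦ ⟪Φ x, f⟫)` from a Hilbert space to continuous functions. -/
noncomputable def innerOp (Φ : C(X, H)) : H →L[ℝ] C(X, ℝ) :=
  LinearMap.mkContinuous
    { toFun := fun f => ⟨fun x => inner ℝ (Φ x) f, by fun_prop⟩
      map_add' := fun f g => by ext x; simp [inner_add_right]
      map_smul' := fun a f => by ext x; simp [inner_smul_right] } ‖Φ‖ fun f => by
    rw [ContinuousMap.norm_le _ (by positivity)]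
    intro x
    exact (norm_inner_le_norm _ _).trans
      (mul_le_mul_of_nonneg_right (Φ.norm_coe_le_norm x) (norm_nonneg f))

theorem innerOp_apply (Φ : C(X, H)) (f : H) (x : X) : innerOp Φ f x = inner ℝ (Φ x) f := rfl

/-- All images of the unit ball share the bound `‖Φ‖` and the modulus of continuity `‖Φ x - Φ y‖`;
Arzelà–Ascoli applies. -/
theorem isCompactOperator_innerOp (Φ : C(X, H)) : IsCompactOperator (innerOp Φ) := by
  rw [isCompactOperator_iff_exists_mem_nhds_image_subset_compact]
  set S : Set C(X, ℝ) := {u | (∀ x, u x ∈ Icc (-‖Φ‖) ‖Φ‖) ∧ ∀ x y, |u x - u y| ≤ ‖Φ x - Φ y‖}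
    with hS
  refine ⟨Metric.ball 0 1, Metric.ball_mem_nhds _ one_pos, S, ?_, ?_⟩
  · refine ArzelaAscoli.isCompact_of_equicontinuous S ?_ ?_
    · have himg : ContinuousMap.toFun '' S
          = (univ.pi fun _ : X => Icc (-‖Φ‖) ‖Φ‖) ∩ ⋂ x, ⋂ y, {u | |u x - u y| ≤ ‖Φ x - Φ y‖} := by
        ext u
        simp only [mem_image, mem_inter_iff, Set.mem_pi, mem_univ, true_implies, mem_iInter,
          mem_ofPred_eq]
        constructor
        · rintro ⟨u, hu, rfl⟩
          exact hu
        · rintro ⟨h1, h2⟩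
          have hc : Continuous u := by
            rw [continuous_iff_continuousAt]
            intro x
            rw [ContinuousAt, tendsto_iff_norm_sub_tendsto_zero]
            refine squeeze_zero (fun _ => norm_nonneg _) (fun y => h2 y x) ?_
            have : Continuous fun y => ‖Φ y - Φ x‖ := by fun_prop
            simpa using this.tendsto x
          exact ⟨⟨u, hc⟩, ⟨h1, h2⟩, rfl⟩
      rw [himg]
      refine (isCompact_univ_pi fun _ => isCompact_Icc).inter_right
        (isClosed_iInter fun x => isClosed_iInter fun y => ?_)
      exact isClosed_le (by fun_prop) continuous_const
    · intro x
      rw [Metric.equicontinuousAt_iff_right]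
      intro ε hε
      have : Continuous fun y => ‖Φ x - Φ y‖ := by fun_prop
      have h0 : ∀ᶠ y in 𝓝 x, ‖Φ x - Φ y‖ < ε :=
        (this.tendsto x).eventually_lt_const (by simpa using hε)
      filter_upwards [h0] with y hy u
      exact (u.2.2 x y).trans_lt hy
  · rintro _ ⟨f, hf, rfl⟩
    have hf1 : ‖f‖ ≤ 1 := by simpa using (mem_ball_zero_iff.1 hf).le
    refine ⟨fun x => ?_, fun x y => ?_⟩
    · have : |inner ℝ (Φ x) f| ≤ ‖Φ‖ := (abs_real_inner_le_norm _ _).trans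
        ((mul_le_of_le_one_right (norm_nonneg _) hf1).trans (Φ.norm_coe_le_norm x))
      exact abs_le.1 this
    · rw [innerOp_apply, innerOp_apply, ← inner_sub_left]
      exact (abs_real_inner_le_norm _ _).trans (mul_le_of_le_one_right (norm_nonneg _) hf1)

end

/-- The resolvent of `-∂ₓₓ` at `-κ²`, as a compact operator from `L²` to continuous functions. -/
theorem exists_compact_resolvent_const {κ : ℝ} (hκ : 0 < κ) :
    ∃ K : L2I →L[ℝ] C(unitInterval, ℝ), IsCompactOperator K ∧ ∀ h : C(unitInterval, ℝ),
      ∃ w₁, NeumannC2 (extend (K (toL2 h))) w₁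
        (fun x => κ ^ 2 * extend (K (toL2 h)) x - extend h x) := by
  have hk := continuous_greenKernel κ
  let k : C(unitInterval × unitInterval, ℝ) := ⟨fun p => greenKernel κ p.1 p.2, by fun_prop⟩
  -- `Φ x` is the class of `greenKernel κ x`, so `innerOp Φ` is the integral operator with the Green
  -- kernel.
  let Φ : C(unitInterval, L2I) := (toL2 : C(C(unitInterval, ℝ), L2I)).comp k.curry
  refine ⟨innerOp Φ, isCompactOperator_innerOp Φ, fun h => ?_⟩
  obtain ⟨u₁, hu⟩ := neumannC2_integral_greenKernel hκ (continuous_extend h)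
  have he : EqOn (extend (innerOp Φ (toL2 h)))
      (fun x => ∫ y in (0 : ℝ)..1, greenKernel κ x y * extend h y) I01 := by
    intro x hx
    have h1 : extend (innerOp Φ (toL2 h)) x = innerOp Φ (toL2 h) ⟨x, hx⟩ :=
      extend_coe _ ⟨x, hx⟩
    have h2 : innerOp Φ (toL2 h) ⟨x, hx⟩ = inner ℝ (toL2 (k.curry ⟨x, hx⟩)) (toL2 h) := rfl
    rw [h1, h2, inner_toL2]
    refine integral_congr_I01 fun y hy => ?_
    have h3 : extend (k.curry ⟨x, hx⟩) y = k.curry ⟨x, hx⟩ ⟨y, hy⟩ := extend_coe _ ⟨y, hy⟩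
    simp only [h3]
    rfl
  refine ⟨u₁, hu.congr he (fun _ _ => rfl) fun x hx => ?_⟩
  simp only [he hx]

/-- The inverse of `-∂ₓₓ + V` with Neumann conditions. -/
theorem exists_compact_resolvent {V : ℝ → ℝ} (hV : ContinuousOn V I01)
    (hVpos : ∀ x ∈ I01, 0 < V x) :
    ∃ T : L2I →L[ℝ] C(unitInterval, ℝ), IsCompactOperator T ∧ ∀ h : C(unitInterval, ℝ),
      ∃ w₁, NeumannC2 (extend (T (toL2 h))) w₁
        (fun x => V x * extend (T (toL2 h)) x - extend h x) := by
  obtain ⟨δ, hδ0, hδ⟩ := exists_pos_le_of_pos hV hVpos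
  obtain ⟨C, hC0, hC⟩ := exists_bound_I01 hV
  -- The equation becomes `-w'' + κ² w = h + Q w` with `Q = κ² - V`, that is, `w - S w = K h`. With
  -- `κ² = C + δ` one has `|Q| ≤ C < κ²`, so `S` contracts the sup norm.
  set κ := Real.sqrt (C + δ) with hκd
  have hκ : 0 < κ := Real.sqrt_pos.2 (by positivity)
  have hκ2 : κ ^ 2 = C + δ := Real.sq_sqrt (by positivity)
  obtain ⟨K, hK, hKs⟩ := exists_compact_resolvent_const hκ
  let Q : C(unitInterval, ℝ) := restr (fun x => κ ^ 2 - V x) (by fun_prop)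
  let S : C(unitInterval, ℝ) →L[ℝ] C(unitInterval, ℝ) :=
    (K ∘L toL2) ∘L ContinuousLinearMap.mul ℝ C(unitInterval, ℝ) Q
  -- Comparison with the constant solution `b / κ²`.
  have hKn : ∀ (h : C(unitInterval, ℝ)) (b : ℝ), (∀ x, h x ≤ b) → 0 ≤ b →
      ∀ x, K (toL2 h) x ≤ b / κ ^ 2 := by
    intro h b hb hb0 x
    obtain ⟨w₁, hw⟩ := hKs h
    have := ((NeumannC2.const (b / κ ^ 2)).sub hw).nonneg (W := fun _ => κ ^ 2)
      continuousOn_const (fun _ _ => by positivity) (fun y hy => ?_) x x.2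
    · rw [extend_coe] at this
      linarith
    · have h1 : κ ^ 2 * (b / κ ^ 2) = b := by field_simp
      have h2 := hb ⟨y, hy⟩
      rw [← extend_coe] at h2
      simp only at h2 ⊢
      linarith
  have hS : ‖S‖ < 1 := by
    have hle : ‖S‖ ≤ C / κ ^ 2 := by
      refine ContinuousLinearMap.opNorm_le_bound _ (by positivity) fun h => ?_
      rw [ContinuousMap.norm_le _ (by positivity)]
      intro x
      have hb : ∀ y, |(Q * h) y| ≤ C * ‖h‖ := by
        intro y
        have h1 : |Q y| ≤ C := by
          have e : Q y = κ ^ 2 - V y := rfl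
          rw [e, hκ2, abs_le]
          have := hδ y y.2
          have := abs_le.1 (hC y y.2)
          constructor <;> linarith
        rw [ContinuousMap.mul_apply, abs_mul]
        exact mul_le_mul h1 (h.norm_coe_le_norm y) (abs_nonneg _) hC0
      have hb0 : 0 ≤ C * ‖h‖ := by positivity
      have e : S h = K (toL2 (Q * h)) := rfl
      have h1 := hKn (Q * h) _ (fun y => (abs_le.1 (hb y)).2) hb0 x
      have h2 := hKn (-(Q * h)) _ (fun y => by
        have := (abs_le.1 (hb y)).1
        rw [ContinuousMap.neg_apply]; linarith) hb0 x
      rw [map_neg, map_neg, ContinuousMap.neg_apply] at h2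
      rw [e, Real.norm_eq_abs, abs_le, div_mul_eq_mul_div]
      constructor <;> linarith
    refine hle.trans_lt ((div_lt_one (by positivity)).2 ?_)
    rw [hκ2]; linarith
  have hunit : IsUnit (1 - S) := by
    have := isUnit_one_sub_of_norm_lt_one (R := C(unitInterval, ℝ) →L[ℝ] C(unitInterval, ℝ)) hS
    exact this
  obtain ⟨U, hU⟩ := hunit
  have hinv : (1 - S) * (↑U⁻¹ : C(unitInterval, ℝ) →L[ℝ] C(unitInterval, ℝ)) = 1 := by
    rw [← hU]; exact U.mul_inv
  refine ⟨(↑U⁻¹ : C(unitInterval, ℝ) →L[ℝ] C(unitInterval, ℝ)) ∘L K, ?_, fun h => ?_⟩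
  · exact hK.clm_comp _
  · set w := ((↑U⁻¹ : C(unitInterval, ℝ) →L[ℝ] C(unitInterval, ℝ)) ∘L K) (toL2 h) with hw
    have h1 : w - S w = K (toL2 h) := by
      have := congrArg (fun L : C(unitInterval, ℝ) →L[ℝ] C(unitInterval, ℝ) => L (K (toL2 h))) hinv
      exact this
    have h2 : w = K (toL2 (h + Q * w)) := by
      rw [map_add, map_add, ← h1]
      have e : S w = K (toL2 (Q * w)) := rfl
      rw [e]; abel
    obtain ⟨w₁, hw₁⟩ := hKs (h + Q * w)
    rw [← h2] at hw₁
    refine ⟨w₁, hw₁.congr (fun _ _ => rfl) (fun _ _ => rfl) fun x hx => ?_⟩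
    have e1 : extend (h + Q * w) x = extend h x + extend Q x * extend w x := rfl
    have e2 : extend Q x = κ ^ 2 - V x := extend_restr _ hx
    simp only [e1, e2]
    ring

/-- Solvability of `-w'' + V w = f` with Neumann conditions. -/
theorem exists_neumann_solution {V f : ℝ → ℝ} (hV : ContinuousOn V I01)
    (hVpos : ∀ x ∈ I01, 0 < V x) (hf : ContinuousOn f I01) :
    ∃ w w₁, NeumannC2 w w₁ (fun x => V x * w x - f x) := by
  obtain ⟨T, -, hT⟩ := exists_compact_resolvent hV hVpos
  obtain ⟨w₁, hw⟩ := hT (restr f hf)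
  exact ⟨_, w₁, hw.congr (fun _ _ => rfl) (fun _ _ => rfl) fun x hx => by
    simp only [extend_restr hf hx]⟩

end HeatFlow

namespace HeatFlow

/-! ### Complete systems of eigenfunctions -/

/-- Completeness of a family of functions in `L²([0,1])`. -/
def IsCompleteFamily {ι : Type*} (e : ι → ℝ → ℝ) : Prop :=
  ∀ f : ℝ → ℝ, MemLp f 2 vol01 → (∀ n, ∫ x in (0 : ℝ)..1, e n x * f x = 0) → f =ᵐ[vol01] 0

/-! ### Passage between functions on the line and the Hilbert space; Parseval's identity. -/

theorem vol01_eq_map : vol01 = Measure.map ((↑) : unitInterval → ℝ) volume :=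
  unitInterval.measurePreserving_coe.map_eq.symm

theorem memLp_vol01_iff {f : ℝ → ℝ} :
    MemLp f 2 vol01 ↔ MemLp (fun x : unitInterval => f x) 2 volume := by
  rw [vol01_eq_map]
  exact unitInterval.measurableEmbedding_coe.memLp_map_measure_iff

theorem ae_vol01_iff {p : ℝ → Prop} :
    (∀ᵐ x ∂vol01, p x) ↔ ∀ᵐ x : unitInterval, p x := by
  rw [vol01_eq_map]
  exact unitInterval.measurableEmbedding_coe.ae_map_iff

theorem memLp_of_continuousOn {f : ℝ → ℝ} (hf : ContinuousOn f I01) : MemLp f 2 vol01 :=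
  memLp_vol01_iff.2 (ContinuousMap.memLp volume ℝ (restr f hf))

theorem inner_toL2_left (h : C(unitInterval, ℝ)) (F : L2I) :
    inner ℝ (toL2 h) F = ∫ x : unitInterval, h x * F x := by
  rw [L2.inner_def]
  refine integral_congr_ae ?_
  filter_upwards [ContinuousMap.coeFn_toLp (p := 2) (𝕜 := ℝ) volume h] with x hx
  rw [toL2, hx]
  simp [mul_comm]

theorem eq_zero_of_toL2_eq_zero {h : C(unitInterval, ℝ)} (h0 : toL2 h = 0) : h = 0 := by
  have h1 := inner_toL2 h h
  rw [h0, inner_zero_left] at h1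
  have hc := continuous_extend h
  have h2 := eqOn_zero_of_integral_eq_zero (by fun_prop) (fun x _ => mul_self_nonneg _) h1.symm
  ext x
  rw [← extend_coe]
  exact mul_self_eq_zero.1 (h2 x x.2)

/-- Completeness expressed in the Hilbert space `L²([0,1])`. -/
theorem isCompleteFamily_iff {ι : Type*} {e : ι → ℝ → ℝ} (he : ∀ n, ContinuousOn (e n) I01) :
    IsCompleteFamily e ↔
      ∀ F : L2I, (∀ n, inner ℝ (toL2 (restr (e n) (he n))) F = 0) → F = 0 := by
  constructor
  · intro h F hF
    have hcoe : ∀ x : unitInterval, F (projIcc 0 1 zero_le_one (x : ℝ)) = F x := fun x => by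
      rw [projIcc_val]
    have h0 := h (fun x => F (projIcc 0 1 zero_le_one x)) ?_ fun n => ?_
    · rw [Lp.eq_zero_iff_ae_eq_zero]
      have := ae_vol01_iff.1 h0
      filter_upwards [this] with x hx
      rw [← hcoe x]
      exact hx
    · rw [memLp_vol01_iff]
      simp_rw [hcoe]
      exact Lp.memLp F
    · rw [← integral_unitInterval]
      simp_rw [hcoe]
      exact (inner_toL2_left _ F).symm.trans (hF n)
  · intro h f hf hfe
    have hm := memLp_vol01_iff.1 hf
    have h0 := h (hm.toLp _) fun n => ?_
    · have h1 : (fun x : unitInterval => f x) =ᵐ[volume] 0 := by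
        refine hm.coeFn_toLp.symm.trans ?_
        rw [h0]
        exact Lp.coeFn_zero _ _ _
      exact ae_vol01_iff.2 h1
    · rw [inner_toL2_left, ← hfe n, ← integral_unitInterval]
      refine integral_congr_ae ?_
      filter_upwards [hm.coeFn_toLp] with x hx
      rw [hx]
      rfl

theorem coeff_eq_inner {e f : ℝ → ℝ} (he : ContinuousOn e I01) (hf : ContinuousOn f I01) :
    coeff e f = inner ℝ (toL2 (restr e he)) (toL2 (restr f hf)) := by
  rw [inner_toL2, coeff]
  exact integral_congr_I01 fun x hx => by simp only [extend_restr he hx, extend_restr hf hx]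

/-- Parseval's identity. -/
theorem hasSum_coeff_mul_coeff {e : ℕ → ℝ → ℝ} (he : ∀ n, ContinuousOn (e n) I01)
    (ho : ∀ m n, ∫ x in (0 : ℝ)..1, e m x * e n x = if m = n then 1 else 0)
    (hc : IsCompleteFamily e) {f g : ℝ → ℝ} (hf : ContinuousOn f I01) (hg : ContinuousOn g I01) :
    HasSum (fun n => coeff (e n) f * coeff (e n) g) (∫ x in (0 : ℝ)..1, f x * g x) := by
  set v : ℕ → L2I := fun n => toL2 (restr (e n) (he n)) with hv
  have hon : Orthonormal ℝ v := by
    rw [orthonormal_iff_ite]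
    intro m n
    rw [← ho m n]
    exact (coeff_eq_inner (he m) (he n)).symm
  have hsp : (Submodule.span ℝ (range v))ᗮ = ⊥ := by
    rw [Submodule.eq_bot_iff]
    intro F hF
    refine (isCompleteFamily_iff he).1 hc F fun n => ?_
    exact (Submodule.mem_orthogonal _ _).1 hF _ (Submodule.subset_span ⟨n, rfl⟩)
  have := (HilbertBasis.mkOfOrthogonalEqBot hon hsp).hasSum_inner_mul_inner
    (toL2 (restr f hf)) (toL2 (restr g hg))
  rw [HilbertBasis.coe_mkOfOrthogonalEqBot] at this
  have e1 : ∫ x in (0 : ℝ)..1, f x * g x = coeff f g := rfl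
  rw [e1, coeff_eq_inner hf hg]
  convert! this using 2 with n
  rw [coeff_eq_inner (he n) hf, coeff_eq_inner (he n) hg, real_inner_comm]

/-- Continuous functions are determined by their coefficients in a complete system. -/
theorem eqOn_of_coeff_eq {e : ℕ → ℝ → ℝ} (he : ∀ n, ContinuousOn (e n) I01)
    (ho : ∀ m n, ∫ x in (0 : ℝ)..1, e m x * e n x = if m = n then 1 else 0)
    (hc : IsCompleteFamily e) {f g : ℝ → ℝ} (hf : ContinuousOn f I01) (hg : ContinuousOn g I01)
    (h : ∀ n, coeff (e n) f = coeff (e n) g) : EqOn f g I01 := by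
  have hd : ContinuousOn (fun x => f x - g x) I01 := hf.sub hg
  have h0 : ∀ n, coeff (e n) (fun x => f x - g x) = 0 := by
    intro n
    have := he n
    have e1 : coeff (e n) (fun x => f x - g x) = coeff (e n) f - coeff (e n) g := by
      unfold coeff
      rw [← integral_sub_I01 (by fun_prop) (by fun_prop)]
      simp_rw [mul_sub]
    rw [e1, h n, sub_self]
  have hs := hasSum_coeff_mul_coeff he ho hc hd hd
  simp only [h0, mul_zero] at hs
  have hz : ∫ x in (0 : ℝ)..1, (f x - g x) * (f x - g x) = 0 := hs.unique hasSum_zero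
  intro x hx
  have := eqOn_zero_of_integral_eq_zero (by fun_prop) (fun x _ => mul_self_nonneg _) hz x hx
  exact sub_eq_zero.1 (mul_self_eq_zero.1 this)

/-- A nonzero eigenfunction, normalised in `L²` and positive at the left end point. -/
def IsNormalizedEigenfunction (V : ℝ → ℝ) (μ : ℝ) (e : ℝ → ℝ) : Prop :=
  NeumannC2 e (D e) (fun x => (V x - μ) * e x) ∧ ∫ x in (0 : ℝ)..1, e x * e x = 1 ∧ 0 < e 0

/-- A nonzero eigenfunction cannot vanish at `0`, where its slope is already zero; its sign can thus
be fixed there. -/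
theorem exists_normalizedEigenfunction {V f f₁ : ℝ → ℝ} {μ : ℝ} (hV : ContinuousOn V I01)
    (hf : NeumannC2 f f₁ (fun x => (V x - μ) * f x)) (hne : ∃ x ∈ I01, f x ≠ 0) :
    ∃ e, IsNormalizedEigenfunction V μ e := by
  obtain ⟨x, hx, hfx⟩ := hne
  have hq : ContinuousOn (fun x => V x - μ) I01 := by fun_prop
  have h0 : f 0 ≠ 0 := fun h => hfx (hf.eq_zero_of_left hq h x hx)
  have hfc := hf.cont
  have hI : 0 < ∫ x in (0 : ℝ)..1, f x * f x := by
    refine lt_of_le_of_ne (integral_nonneg_I01 fun x _ => mul_self_nonneg _) fun h => ?_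
    exact h0 (mul_self_eq_zero.1 (eqOn_zero_of_integral_eq_zero (by fun_prop)
      (fun x _ => mul_self_nonneg _) h.symm 0 zero_mem_I01))
  obtain ⟨a, ha2, ha0⟩ : ∃ a : ℝ, a * a * (∫ x in (0 : ℝ)..1, f x * f x) = 1 ∧ 0 < a * f 0 := by
    set s := (Real.sqrt (∫ x in (0 : ℝ)..1, f x * f x))⁻¹ with hs
    have hsp : 0 < s := inv_pos.2 (Real.sqrt_pos.2 hI)
    have hs2 : s * s * (∫ x in (0 : ℝ)..1, f x * f x) = 1 := by
      rw [hs, ← mul_inv, Real.mul_self_sqrt hI.le, inv_mul_cancel₀ hI.ne']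
    rcases lt_or_gt_of_ne h0 with h | h
    · exact ⟨-s, by linarith, by nlinarith⟩
    · exact ⟨s, hs2, by positivity⟩
  have hN := hf.const_mul a
  refine ⟨fun x => a * f x, hN.congr (fun _ _ => rfl) hN.D_eq fun x _ => by ring, ?_, ha0⟩
  refine Eq.trans ?_ ha2
  rw [← intervalIntegral.integral_const_mul]
  exact integral_congr_I01 fun x _ => by ring

/-- The set of the Neumann eigenvalues of `-∂ₓₓ + V`. -/
def eigenvalueSet (V : ℝ → ℝ) : Set ℝ := {μ | ∃ e, IsNormalizedEigenfunction V μ e}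

/-- The normalised eigenfunction of an eigenvalue. -/
noncomputable def eigenfunction {V : ℝ → ℝ} (μ : eigenvalueSet V) : ℝ → ℝ := μ.2.choose

theorem eigenfunction_spec {V : ℝ → ℝ} (μ : eigenvalueSet V) :
    IsNormalizedEigenfunction V μ (eigenfunction μ) := μ.2.choose_spec

/-- Eigenvalues are simple, so the family may be indexed by the eigenvalues themselves.
Orthogonality follows from Green's identity. -/
theorem isEigenFamily_eigenfunction {V : ℝ → ℝ} (hV : ContinuousOn V I01) :
    IsEigenFamily V (fun μ : eigenvalueSet V => (μ : ℝ)) eigenfunction where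
  neumann μ := (eigenfunction_spec μ).1
  orthonormal μ ν := by
    split_ifs with h
    · rw [← h]; exact (eigenfunction_spec μ).2.1
    · have hμ := (eigenfunction_spec μ).1
      have hν := (eigenfunction_spec ν).1
      have hcμ := hμ.cont
      have hcν := hν.cont
      have hg := hμ.green hν
      have e1 : ∀ x, eigenfunction μ x * ((V x - ν) * eigenfunction ν x)
          = V x * (eigenfunction μ x * eigenfunction ν x)
            - ν * (eigenfunction μ x * eigenfunction ν x) := fun x => by ring
      have e2 : ∀ x, eigenfunction ν x * ((V x - μ) * eigenfunction μ x)
          = V x * (eigenfunction μ x * eigenfunction ν x)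
            - μ * (eigenfunction μ x * eigenfunction ν x) := fun x => by ring
      simp_rw [e1, e2] at hg
      rw [integral_sub_I01 (by fun_prop) (by fun_prop), integral_sub_I01 (by fun_prop)
        (by fun_prop), intervalIntegral.integral_const_mul,
        intervalIntegral.integral_const_mul] at hg
      have hne : (μ : ℝ) - ν ≠ 0 := sub_ne_zero.2 fun h' => h (Subtype.ext h')
      refine (mul_eq_zero.1 (?_ : ((μ : ℝ) - ν) * _ = 0)).resolve_left hne
      linarith

/-- Each eigenvalue below `R` contributes at least `1/R` to the sum of inverses, which is at most
`2/δ + 1`. -/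
theorem finite_eigenvalueSet_inter_Iic {V : ℝ → ℝ} (hV : ContinuousOn V I01)
    (hVpos : ∀ x ∈ I01, 0 < V x) (R : ℝ) : {μ : eigenvalueSet V | (μ : ℝ) ≤ R}.Finite := by
  obtain ⟨δ, hδ0, hδ⟩ := exists_pos_le_of_pos hV hVpos
  by_contra hinf
  have hinf : {μ : eigenvalueSet V | (μ : ℝ) ≤ R}.Infinite := hinf
  have hfam := isEigenFamily_eigenfunction hV
  obtain ⟨n, hn⟩ := exists_nat_gt ((2 / δ + 1) * R)
  obtain ⟨F, hF, hFn⟩ := hinf.exists_subset_card_eq n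
  have hle := hfam.sum_inv_le hV hδ0 hδ F
  have hR : F.Nonempty → 0 < R := fun ⟨μ, hμ⟩ =>
    hδ0.trans_le ((hfam.le_eigenvalue hV hδ μ).trans (hF hμ))
  have hcard : ∑ μ ∈ F, R⁻¹ ≤ ∑ μ ∈ F, (μ : ℝ)⁻¹ :=
    Finset.sum_le_sum fun μ hμ =>
      inv_anti₀ (hδ0.trans_le (hfam.le_eigenvalue hV hδ μ)) (hF hμ)
  rw [Finset.sum_const, hFn, nsmul_eq_mul] at hcard
  obtain ⟨μ, -⟩ := hinf.nonempty
  rcases F.eq_empty_or_nonempty with h0 | h0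
  · obtain ⟨ν, hν⟩ := hinf.nonempty
    have hRp : 0 < R := hδ0.trans_le ((hfam.le_eigenvalue hV hδ ν).trans hν)
    rw [h0, Finset.card_empty] at hFn
    rw [← hFn, Nat.cast_zero] at hn
    have : 0 < (2 / δ + 1) * R := by positivity
    linarith
  · have hRp := hR h0
    have : (n : ℝ) ≤ (2 / δ + 1) * R := by
      rw [← div_le_iff₀ hRp]
      exact hcard.trans hle
    linarith

/-- A compact self-adjoint inverse of `-∂ₓₓ + V`. -/
theorem exists_symmetric_resolvent {V : ℝ → ℝ} (hV : ContinuousOn V I01)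
    (hVpos : ∀ x ∈ I01, 0 < V x) :
    ∃ T : L2I →L[ℝ] C(unitInterval, ℝ), IsCompactOperator (toL2 ∘L T) ∧
      (toL2 ∘L T).IsSymmetric ∧ (∀ f, T f = 0 → f = 0) ∧ ∀ h : C(unitInterval, ℝ),
      ∃ w₁, NeumannC2 (extend (T (toL2 h))) w₁
        (fun x => V x * extend (T (toL2 h)) x - extend h x) := by
  obtain ⟨T, hTc, hT⟩ := exists_compact_resolvent hV hVpos
  have hsymm : ∀ f g : L2I, inner ℝ (toL2 (T f)) g = inner ℝ f (toL2 (T g)) := by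
    intro f g
    have hd : DenseRange toL2 := ContinuousMap.toLp_denseRange ℝ volume ℝ (by norm_num)
    -- By density of the continuous functions, symmetry reduces to Green's identity for two
    -- classical solutions.
    refine hd.induction_on₂ (p := fun f g => inner ℝ (toL2 (T f)) g = inner ℝ f (toL2 (T g)))
      (isClosed_eq (by fun_prop) (by fun_prop)) (fun h k => ?_) f g
    obtain ⟨w₁, hw⟩ := hT h
    obtain ⟨z₁, hz⟩ := hT k
    rw [inner_toL2, inner_toL2]
    have hg := hw.green hz
    have hwc := hw.cont
    have hzc := hz.cont
    have hhc := (continuous_extend h).continuousOn (s := I01)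
    have hkc := (continuous_extend k).continuousOn (s := I01)
    simp_rw [mul_sub] at hg
    rw [integral_sub_I01 (by fun_prop) (by fun_prop), integral_sub_I01 (by fun_prop)
      (by fun_prop)] at hg
    have e1 : ∀ x, extend (T (toL2 h)) x * (V x * extend (T (toL2 k)) x)
        = extend (T (toL2 k)) x * (V x * extend (T (toL2 h)) x) := fun x => by ring
    simp_rw [e1] at hg
    simp_rw [mul_comm (extend h _)]
    linarith
  refine ⟨T, hTc.clm_comp toL2, hsymm, fun f hf => ?_, hT⟩
  -- Injectivity: a test function `φ` is the image under `T` of `V φ - φ''`. By symmetry, `T f = 0`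
  -- makes `f` orthogonal to every test function, hence zero almost everywhere.
  have hzero : ∀ φ : ℝ → ℝ, ContDiff ℝ ∞ φ → HasCompactSupport φ → tsupport φ ⊆ Ioo (0 : ℝ) 1 →
      ∫ x : unitInterval, φ x * f x = 0 := by
    intro φ hφ _ hsupp
    have hφ1 : ContDiff ℝ ∞ (deriv φ) := contDiff_infty_iff_deriv.1 hφ |>.2
    have hφ2 : ContDiff ℝ ∞ (deriv (deriv φ)) := contDiff_infty_iff_deriv.1 hφ1 |>.2
    have hN : NeumannC2 φ (deriv φ) (deriv (deriv φ)) := by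
      refine ⟨fun x _ => ?_, fun x _ => ?_, hφ2.continuous.continuousOn, ?_, ?_⟩
      · exact (hφ.differentiable (by simp) x).hasDerivAt.hasDerivWithinAt
      · exact (hφ1.differentiable (by simp) x).hasDerivAt.hasDerivWithinAt
      · exact deriv_of_notMem_tsupport fun h => lt_irrefl _ (hsupp h).1
      · exact deriv_of_notMem_tsupport fun h => lt_irrefl _ (hsupp h).2
    have hφc : ContinuousOn φ I01 := hN.cont
    have hφ2c : ContinuousOn (deriv (deriv φ)) I01 := hN.cont2
    have hgc : ContinuousOn (fun x => V x * φ x - deriv (deriv φ) x) I01 := by fun_prop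
    obtain ⟨w₁, hw⟩ := hT (restr _ hgc)
    set w := T (toL2 (restr _ hgc)) with hwd
    -- Both functions solve the same Neumann problem; comparison in each direction identifies them.
    have hwφ : EqOn (extend w) φ I01 := by
      have h1 := (hw.sub hN).nonneg hV hVpos fun x hx => by
        simp only [extend_restr hgc hx]; linarith
      have h2 := (hN.sub hw).nonneg hV hVpos fun x hx => by
        simp only [extend_restr hgc hx]; linarith
      exact fun x hx => le_antisymm (by linarith [h2 x hx]) (by linarith [h1 x hx])
    have h3 := hsymm (toL2 (restr _ hgc)) f
    rw [hf, map_zero, inner_zero_right, ← hwd, inner_toL2_left] at h3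
    rw [← h3]
    refine integral_congr_ae (Eventually.of_forall fun x => ?_)
    simp only
    rw [← hwφ x.2, extend_coe]
  set g : ℝ → ℝ := fun x => f (projIcc 0 1 zero_le_one x) with hg
  have hcoe : ∀ x : unitInterval, g x = f x := fun x => by rw [hg]; simp only [projIcc_val]
  have hgm : MemLp g 2 vol01 := by
    rw [memLp_vol01_iff]
    simp_rw [hcoe]
    exact Lp.memLp f
  have hgi : IntegrableOn g I01 := by
    have : IsFiniteMeasure vol01 := by
      unfold vol01 I01; infer_instance
    exact hgm.integrable (by norm_num)
  have hae : ∀ᵐ x ∂volume, x ∈ Ioo (0 : ℝ) 1 → g x = 0 := by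
    refine isOpen_Ioo.ae_eq_zero_of_integral_contDiff_smul_eq_zero
      (hgi.mono_set Ioo_subset_Icc_self).locallyIntegrableOn fun φ hφ hc hs => ?_
    rw [← hzero φ hφ hc hs]
    simp_rw [← hcoe]
    rw [integral_unitInterval (fun x => φ x * g x), intervalIntegral.integral_of_le zero_le_one,
      ← integral_Icc_eq_integral_Ioc, setIntegral_eq_integral_of_forall_compl_eq_zero]
    · rfl
    · intro x hx
      rw [image_eq_zero_of_notMem_tsupport fun h => hx (Ioo_subset_Icc_self (hs h)), zero_mul]
  rw [Lp.eq_zero_iff_ae_eq_zero]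
  have h4 : ∀ᵐ x ∂vol01, g x = 0 := by
    have : vol01 = volume.restrict (Ioo (0 : ℝ) 1) := restrict_Ioo_eq_restrict_Icc.symm
    rw [this, ae_restrict_iff' measurableSet_Ioo]
    exact hae
  filter_upwards [ae_vol01_iff.1 h4] with x hx
  rw [← hcoe x]
  exact hx

/-- The spectral theorem applies to the compact symmetric inverse. Zero is not an eigenvalue of it,
by injectivity, and an eigenvector for `ν ≠ 0` is a multiple of the chosen eigenfunction of
eigenvalue `ν⁻¹`, by simplicity. -/
theorem isCompleteFamily_eigenfunction {V : ℝ → ℝ} (hV : ContinuousOn V I01)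
    (hVpos : ∀ x ∈ I01, 0 < V x) :
    IsCompleteFamily (fun μ : eigenvalueSet V => eigenfunction μ) := by
  have hec : ∀ μ : eigenvalueSet V, ContinuousOn (eigenfunction μ) I01 :=
    fun μ => (eigenfunction_spec μ).1.cont
  rw [isCompleteFamily_iff hec]
  obtain ⟨T, hTc, hTs, hTi, hT⟩ := exists_symmetric_resolvent hV hVpos
  intro F hF
  have hbot := ContinuousLinearMap.orthogonalComplement_iSup_eigenspaces_eq_bot hTc hTs
  rw [Submodule.eq_bot_iff] at hbot
  refine hbot F ?_
  rw [← Submodule.iInf_orthogonal, Submodule.mem_iInf]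
  intro ν
  rw [Submodule.mem_orthogonal]
  intro f hf
  rw [Module.End.mem_eigenspace_iff] at hf
  replace hf : toL2 (T f) = ν • f := hf
  rcases eq_or_ne ν 0 with rfl | hν
  · rw [zero_smul] at hf
    have : T f = 0 := eq_zero_of_toL2_eq_zero hf
    rw [hTi f this, inner_zero_left]
  -- Since `toL2 (T f) = ν • f`, this is a continuous representative of `f`.
  · set h : C(unitInterval, ℝ) := ν⁻¹ • T f with hh
    have hfh : toL2 h = f := by
      rw [hh, map_smul, hf, smul_smul, inv_mul_cancel₀ hν, one_smul]
    obtain ⟨w₁, hw⟩ := hT h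
    rw [hfh] at hw
    have hTf : T f = ν • h := by rw [hh, smul_smul, mul_inv_cancel₀ hν, one_smul]
    have hN : NeumannC2 (extend h) (fun x => ν⁻¹ * w₁ x)
        (fun x => (V x - ν⁻¹) * extend h x) := by
      refine (hw.const_mul ν⁻¹).congr (fun x _ => ?_) (fun _ _ => rfl) fun x _ => ?_
      · rfl
      · have : extend (T f) x = ν * extend h x := by rw [hTf]; rfl
        simp only [this]
        field_simp
    by_cases hne : ∃ x ∈ I01, extend h x ≠ 0
    · have hmem : ν⁻¹ ∈ eigenvalueSet V := exists_normalizedEigenfunction hV hN hne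
      set e := eigenfunction ⟨ν⁻¹, hmem⟩ with he
      have hes := eigenfunction_spec ⟨ν⁻¹, hmem⟩
      have hp := hes.1.proportional (q := fun x => V x - ν⁻¹) (by fun_prop) hN
      have hfe : h = (extend h 0 / e 0) • restr e (hec _) := by
        ext x
        have h1 := hp x x.2
        have h2 : 0 < e 0 := hes.2.2
        rw [extend_coe] at h1
        have h3 : ((extend h 0 / e 0) • restr e (hec _)) x = extend h 0 / e 0 * e x := rfl
        rw [h3, div_mul_eq_mul_div, eq_div_iff h2.ne', mul_comm]
        exact h1
      rw [← hfh, hfe, map_smul, inner_smul_left, hF ⟨ν⁻¹, hmem⟩, mul_zero]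
    · push Not at hne
      have : h = 0 := by
        ext x
        rw [← extend_coe, hne x x.2]
        rfl
      rw [← hfh, this, map_zero, inner_zero_left]

/-- With finitely many eigenvalues, completeness would make the coefficient map an injection of the
polynomials into a finite-dimensional space. -/
theorem infinite_eigenvalueSet {V : ℝ → ℝ} (hV : ContinuousOn V I01)
    (hVpos : ∀ x ∈ I01, 0 < V x) : Infinite (eigenvalueSet V) := by
  by_contra hfin
  rw [not_infinite_iff_finite] at hfin
  have hec : ∀ μ : eigenvalueSet V, ContinuousOn (eigenfunction μ) I01 :=
    fun μ => (eigenfunction_spec μ).1.cont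
  have hcomp := (isCompleteFamily_iff hec).1 (isCompleteFamily_eigenfunction hV hVpos)
  let P : Polynomial ℝ →ₗ[ℝ] C(unitInterval, ℝ) :=
    (Polynomial.toContinuousMapOnAlgHom unitInterval).toLinearMap
  let L : Polynomial ℝ →ₗ[ℝ] (eigenvalueSet V → ℝ) :=
    LinearMap.pi fun μ => (innerSL ℝ (toL2 (restr (eigenfunction μ) (hec μ)))).toLinearMap ∘ₗ
      toL2.toLinearMap ∘ₗ P
  have hinj : Function.Injective L := by
    rw [← LinearMap.ker_eq_bot, LinearMap.ker_eq_bot']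
    intro p hp
    have h1 : toL2 (P p) = 0 := hcomp _ fun μ => congrFun hp μ
    have h2 : P p = 0 := eq_zero_of_toL2_eq_zero h1
    refine Polynomial.eq_zero_of_infinite_isRoot p
      ((Icc_infinite (zero_lt_one (α := ℝ))).mono fun x hx => ?_)
    exact DFunLike.congr_fun h2 ⟨x, hx⟩
  exact Polynomial.not_finite (R := ℝ) (Module.Finite.of_injective L hinj)

/-- An infinite set of reals with finitely many elements below each bound can be listed in
increasing order. -/
theorem exists_strictMono_enumeration {S : Set ℝ} [hinf : Infinite S]
    (hfin : ∀ R : ℝ, {x : S | (x : ℝ) ≤ R}.Finite) :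
    ∃ σ : ℕ → S, StrictMono σ ∧ Function.Surjective σ := by
  classical
  have : LocallyFiniteOrder S := LocallyFiniteOrder.ofFiniteIcc fun a b =>
    (hfin b).subset fun x hx => hx.2
  obtain ⟨a⟩ : Nonempty S := inferInstance
  obtain ⟨b, -, hmin⟩ : ∃ b ∈ {x : S | (x : ℝ) ≤ a}, ∀ y ∈ {x : S | (x : ℝ) ≤ a}, b ≤ y :=
    exists_min_image _ id (hfin a) ⟨a, le_refl (a : ℝ)⟩
  let : OrderBot S :=
    { bot := b
      bot_le := fun x => by
        rcases le_total (x : ℝ) a with h | h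
        · exact hmin x h
        · exact (hmin a (le_refl (a : ℝ))).trans h }
  have : NoMaxOrder S := ⟨fun x => by
    by_contra hc
    push Not at hc
    exact infinite_univ ((hfin x).subset fun y _ => hc y)⟩
  let := LinearLocallyFiniteOrder.succOrder S
  let := LinearLocallyFiniteOrder.predOrder S
  -- A locally finite linear order with a least element and no greatest one is isomorphic to `ℕ`.
  let σ : S ≃o ℕ := orderIsoNatOfLinearSuccPredArch
  exact ⟨σ.symm, σ.symm.strictMono, σ.symm.surjective⟩

end HeatFlow

namespace HeatFlow

/-! ### The Neumann spectrum -/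

theorem coeff_sub {e f g : ℝ → ℝ} (he : ContinuousOn e I01) (hf : ContinuousOn f I01)
    (hg : ContinuousOn g I01) : coeff e (fun x => f x - g x) = coeff e f - coeff e g := by
  unfold coeff
  rw [← integral_sub_I01 (by fun_prop) (by fun_prop)]
  simp_rw [mul_sub]

theorem coeff_add {e f g : ℝ → ℝ} (he : ContinuousOn e I01) (hf : ContinuousOn f I01)
    (hg : ContinuousOn g I01) : coeff e (fun x => f x + g x) = coeff e f + coeff e g := by
  unfold coeff
  rw [← integral_add_I01 (by fun_prop) (by fun_prop)]
  simp_rw [mul_add]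

theorem coeff_const_mul (e f : ℝ → ℝ) (a : ℝ) : coeff e (fun x => a * f x) = a * coeff e f := by
  unfold coeff
  rw [← intervalIntegral.integral_const_mul]
  congr 1
  ext x
  ring

theorem coeff_congr {e f g : ℝ → ℝ} (h : EqOn f g I01) : coeff e f = coeff e g :=
  integral_congr_I01 fun x hx => by simp only [h hx]

/-- Coefficients of the image under `-∂ₓₓ + V`. -/
theorem coeff_operator {V e e₁ f f₁ f₂ : ℝ → ℝ} {μ : ℝ} (hV : ContinuousOn V I01)
    (he : NeumannC2 e e₁ (fun x => (V x - μ) * e x)) (hf : NeumannC2 f f₁ f₂) :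
    coeff e (fun x => V x * f x - f₂ x) = μ * coeff e f := by
  have hec := he.cont
  have hfc := hf.cont
  have hf2 := hf.cont2
  have hg := he.green hf
  have e1 : ∀ x, f x * ((V x - μ) * e x) = e x * (V x * f x) - μ * (e x * f x) :=
    fun x => by ring
  simp_rw [e1] at hg
  rw [integral_sub_I01 (by fun_prop) (by fun_prop), intervalIntegral.integral_const_mul] at hg
  rw [coeff_sub hec (by fun_prop) hf2]
  unfold coeff
  linarith

/-- The eigenfunction of the lowest eigenvalue has a sign. -/
theorem ground_state_nonneg {V : ℝ → ℝ} {μ : ℕ → ℝ} {e : ℕ → ℝ → ℝ} (hV : ContinuousOn V I01)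
    (hVpos : ∀ x ∈ I01, 0 < V x) (h : IsEigenFamily V μ e) (hc : IsCompleteFamily e)
    (hμ : StrictMono μ) (h0 : 0 < e 0 0) : ∀ x ∈ I01, 0 ≤ e 0 x := by
  obtain ⟨δ, hδ0, hδ⟩ := exists_pos_le_of_pos hV hVpos
  have hμp : ∀ n, 0 < μ n := fun n => hδ0.trans_le (h.le_eigenvalue hV hδ n)
  have hec := h.cont
  have he0 := hec 0
  set a : ℝ → ℝ := fun x => |e 0 x| with ha
  have hac : ContinuousOn a I01 := he0.abs
  -- `w` is the image of `|e 0|` under the inverse operator. Comparison with `± e 0 / μ 0` gives `w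
  -- ≥ |e 0| / μ 0`, whereas `1 / μ 0` is the largest eigenvalue of the inverse: `|e 0|` must itself
  -- be a ground state.
  obtain ⟨w, w₁, hw⟩ := exists_neumann_solution hV hVpos hac
  have hwc := hw.cont
  have hcoef : ∀ n, coeff (e n) w = coeff (e n) a / μ n := by
    intro n
    rw [eq_div_iff (hμp n).ne', mul_comm, ← coeff_operator hV (h.neumann n) hw]
    exact coeff_congr fun x _ => by ring
  have hbelow : ∀ x ∈ I01, a x / μ 0 ≤ w x := by
    have h1 := (hw.sub ((h.neumann 0).const_mul (μ 0)⁻¹)).nonneg hV hVpos fun x _ => by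
      have : V x * (w x - (μ 0)⁻¹ * e 0 x)
          - (V x * w x - a x - (μ 0)⁻¹ * ((V x - μ 0) * e 0 x)) = a x - e 0 x := by
        field_simp [(hμp 0).ne']; ring
      rw [this]
      exact sub_nonneg.2 (le_abs_self _)
    have h2 := (hw.add ((h.neumann 0).const_mul (μ 0)⁻¹)).nonneg hV hVpos fun x _ => by
      have : V x * (w x + (μ 0)⁻¹ * e 0 x)
          - (V x * w x - a x + (μ 0)⁻¹ * ((V x - μ 0) * e 0 x)) = a x + e 0 x := by
        field_simp [(hμp 0).ne']; ring
      rw [this]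
      have : -e 0 x ≤ a x := neg_le_abs _
      linarith
    intro x hx
    have h3 := h1 x hx
    have h4 := h2 x hx
    rw [div_eq_inv_mul]
    rcases abs_cases (e 0 x) with ⟨hh, -⟩ | ⟨hh, -⟩ <;> simp only [ha, hh] <;> linarith
  have hs1 := hasSum_coeff_mul_coeff hec h.orthonormal hc hwc hac
  have hs2 := hasSum_coeff_mul_coeff hec h.orthonormal hc hac hac
  have hle : ∫ x in (0 : ℝ)..1, (μ 0)⁻¹ * (a x * a x) ≤ ∫ x in (0 : ℝ)..1, w x * a x :=
    integral_mono_I01 (by fun_prop) (by fun_prop) fun x hx => by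
      have := mul_le_mul_of_nonneg_right (hbelow x hx) (abs_nonneg (e 0 x))
      rw [div_eq_inv_mul, mul_assoc] at this
      exact this
  rw [intervalIntegral.integral_const_mul] at hle
  -- The terms `(1/μ 0 - 1/μ n) c_n²` are nonnegative and their sum is at most zero, so only the
  -- mode `n = 0` occurs in `|e 0|`.
  have hs3 := (hs2.mul_left (μ 0)⁻¹).sub hs1
  have hterm : ∀ n, (μ 0)⁻¹ * (coeff (e n) a * coeff (e n) a) - coeff (e n) w * coeff (e n) a
      = ((μ 0)⁻¹ - (μ n)⁻¹) * coeff (e n) a ^ 2 := fun n => by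
    rw [hcoef n, div_eq_mul_inv]; ring
  simp_rw [hterm] at hs3
  have hnn : ∀ n, 0 ≤ ((μ 0)⁻¹ - (μ n)⁻¹) * coeff (e n) a ^ 2 := fun n =>
    mul_nonneg (sub_nonneg.2 (inv_anti₀ (hμp 0) (hμ.monotone (Nat.zero_le n)))) (sq_nonneg _)
  have hz : ∀ n, n ≠ 0 → coeff (e n) a = 0 := by
    intro n hn
    have h1 := le_hasSum hs3 n fun m _ => hnn m
    have h2 : 0 < (μ 0)⁻¹ - (μ n)⁻¹ :=
      sub_pos.2 (inv_strictAnti₀ (hμp 0) (hμ (Nat.pos_of_ne_zero hn)))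
    have h3 : coeff (e n) a ^ 2 = 0 := by
      by_contra hne
      have : 0 < coeff (e n) a ^ 2 := lt_of_le_of_ne (sq_nonneg _) (Ne.symm hne)
      nlinarith
    exact pow_eq_zero_iff two_ne_zero |>.1 h3
  have heq : EqOn a (fun x => coeff (e 0) a * e 0 x) I01 := by
    refine eqOn_of_coeff_eq hec h.orthonormal hc hac (by fun_prop) fun n => ?_
    rw [coeff_const_mul]
    have : coeff (e n) (e 0) = if n = 0 then 1 else 0 := h.orthonormal n 0
    rw [this]
    split_ifs with hn
    · rw [hn, mul_one]
    · rw [hz n hn, mul_zero]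
  -- Evaluation at `0`, where `e 0` is positive, fixes the proportionality factor.
  have hone : coeff (e 0) a = 1 := by
    have h1 := heq zero_mem_I01
    simp only [ha] at h1
    rw [abs_of_pos h0] at h1
    nlinarith
  intro x hx
  have h1 := heq hx
  rw [hone] at h1
  simp only [one_mul] at h1
  rw [← h1]
  exact abs_nonneg _

/-- A zero would be a minimum, with zero slope in the interior and, by the Neumann condition, also
at an end point. The Cauchy data would vanish there. -/
theorem NeumannC2.ne_zero_of_nonneg {f f₁ q : ℝ → ℝ} (hq : ContinuousOn q I01)
    (hf : NeumannC2 f f₁ (fun x => q x * f x)) (hnn : ∀ x ∈ I01, 0 ≤ f x)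
    (hne : ∃ x ∈ I01, f x ≠ 0) : ∀ x ∈ I01, 0 < f x := by
  intro x hx
  refine lt_of_le_of_ne (hnn x hx) fun h0 => ?_
  have h1 : f₁ x = 0 := by
    rcases eq_or_lt_of_le hx.1 with h | hl
    · rw [← h, hf.left]
    rcases eq_or_lt_of_le hx.2 with h | hr
    · rw [h, hf.right]
    have hn : I01 ∈ 𝓝 x := Icc_mem_nhds hl hr
    have hmin : IsLocalMin f x := by
      filter_upwards [hn] with y hy
      rw [← h0]
      exact hnn y hy
    exact hmin.hasDerivAt_eq_zero ((hf.d1 x hx).hasDerivAt hn)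
  obtain ⟨y, hy, hfy⟩ := hne
  exact hfy (hf.eq_zero_of_cauchy hq (fun _ _ => rfl) hx h0.symm h1 y hy)

theorem exists_neumannSpectrum {V : ℝ → ℝ} (hV : ContinuousOn V I01)
    (hVpos : ∀ x ∈ I01, 0 < V x) :
    ∃ (μ : ℕ → ℝ) (e : ℕ → ℝ → ℝ), IsNeumannSpectrum V μ e := by
  have := infinite_eigenvalueSet hV hVpos
  obtain ⟨σ, hσ, hsurj⟩ := exists_strictMono_enumeration (finite_eigenvalueSet_inter_Iic hV hVpos)
  have hfam0 := isEigenFamily_eigenfunction hV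
  have hμ : StrictMono fun n => (σ n : ℝ) := fun m n hmn => hσ hmn
  have hfam : IsEigenFamily V (fun n => (σ n : ℝ)) (fun n => eigenfunction (σ n)) :=
    ⟨fun n => hfam0.neumann (σ n), fun m n => by
      rw [hfam0.orthonormal]
      simp [hσ.injective.eq_iff]⟩
  have hcomp : IsCompleteFamily fun n => eigenfunction (σ n) := fun f hf h =>
    isCompleteFamily_eigenfunction hV hVpos f hf fun ν => by
      obtain ⟨n, rfl⟩ := hsurj ν
      exact h n
  have hpos : 0 < eigenfunction (σ 0) 0 := (eigenfunction_spec (σ 0)).2.2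
  have hnn := ground_state_nonneg hV hVpos hfam hcomp hμ hpos
  have hpos' := (hfam.neumann 0).ne_zero_of_nonneg (q := fun x => V x - σ 0) (by fun_prop) hnn
    ⟨0, zero_mem_I01, hpos.ne'⟩
  refine ⟨_, _, hμ.monotone, fun n => (hfam.neumann n).contDiffOn, fun n x hx => ?_,
    fun n => ⟨(hfam.neumann n).left, (hfam.neumann n).right⟩, hfam.orthonormal, hcomp,
    fun x hx => hpos' x (Ioo_subset_Icc_self hx)⟩
  rw [(hfam.neumann n).DD_eq hx]
  ring

namespace IsNeumannSpectrum

variable {V : ℝ → ℝ} {μ : ℕ → ℝ} {e : ℕ → ℝ → ℝ}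

theorem isEigenFamily (h : IsNeumannSpectrum V μ e) : IsEigenFamily V μ e where
  neumann n := (NeumannC2.of_contDiffOn (h.smooth n) (h.neumann n).1 (h.neumann n).2).congr
    (fun _ _ => rfl) (fun _ _ => rfl) fun x hx => by
      have := h.eigen n x hx
      linarith
  orthonormal := h.orthonormal

theorem cont (h : IsNeumannSpectrum V μ e) (n : ℕ) : ContinuousOn (e n) I01 :=
  (h.smooth n).continuousOn

theorem isCompleteFamily (h : IsNeumannSpectrum V μ e) : IsCompleteFamily e := h.complete

theorem hasSum_coeff (h : IsNeumannSpectrum V μ e) {f g : ℝ → ℝ} (hf : ContinuousOn f I01)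
    (hg : ContinuousOn g I01) :
    HasSum (fun n => coeff (e n) f * coeff (e n) g) (∫ x in (0 : ℝ)..1, f x * g x) :=
  hasSum_coeff_mul_coeff h.cont h.orthonormal h.isCompleteFamily hf hg

theorem eqOn_of_coeff (h : IsNeumannSpectrum V μ e) {f g : ℝ → ℝ} (hf : ContinuousOn f I01)
    (hg : ContinuousOn g I01) (hfg : ∀ n, coeff (e n) f = coeff (e n) g) : EqOn f g I01 :=
  eqOn_of_coeff_eq h.cont h.orthonormal h.isCompleteFamily hf hg hfg

theorem ground_pos_I01 (h : IsNeumannSpectrum V μ e) (hV : ContinuousOn V I01) :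
    ∀ x ∈ I01, 0 < e 0 x := by
  refine (h.isEigenFamily.neumann 0).ne_zero_of_nonneg (q := fun x => V x - μ 0) (by fun_prop) ?_
    ⟨1 / 2, ⟨by norm_num, by norm_num⟩, (h.ground_pos (1 / 2) ⟨by norm_num, by norm_num⟩).ne'⟩
  have hcl : I01 = closure (Ioo (0 : ℝ) 1) := (closure_Ioo zero_ne_one).symm
  have hc := h.cont 0
  rw [hcl] at hc ⊢
  exact fun x hx => le_on_closure (f := fun _ => (0 : ℝ)) (fun y hy => (h.ground_pos y hy).le)
    continuousOn_const hc hx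

theorem eigenvalue_pos (h : IsNeumannSpectrum V μ e) (hV : ContinuousOn V I01)
    (hVpos : ∀ x ∈ I01, 0 < V x) (n : ℕ) : 0 < μ n := by
  obtain ⟨δ, hδ0, hδ⟩ := exists_pos_le_of_pos hV hVpos
  exact hδ0.trans_le (h.isEigenFamily.le_eigenvalue hV hδ n)

/-- The spectral gap: monotonicity only gives `≤`, but equality would make `e n` proportional to `e
0`, against orthogonality. -/
theorem lt_eigenvalue (h : IsNeumannSpectrum V μ e) (hV : ContinuousOn V I01) {n : ℕ}
    (hn : n ≠ 0) : μ 0 < μ n := by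
  refine lt_of_le_of_ne (h.mono (Nat.zero_le n)) fun heq => ?_
  have hN := h.isEigenFamily.neumann n
  rw [← heq] at hN
  have hp := (h.isEigenFamily.neumann 0).proportional (q := fun x => V x - μ 0) (by fun_prop) hN
  have h0 := h.ground_pos_I01 hV 0 zero_mem_I01
  have h1 := h.orthonormal n n
  have h2 := h.orthonormal n 0
  rw [if_pos rfl] at h1
  rw [if_neg hn] at h2
  have h3 : ∫ x in (0 : ℝ)..1, e 0 0 * (e n x * e n x)
      = ∫ x in (0 : ℝ)..1, e n 0 * (e n x * e 0 x) :=
    integral_congr_I01 fun x hx => by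
      have := hp x hx
      linear_combination e n x * this
  rw [intervalIntegral.integral_const_mul, intervalIntegral.integral_const_mul, h1, h2] at h3
  linarith

theorem summable_inv (h : IsNeumannSpectrum V μ e) (hV : ContinuousOn V I01)
    (hVpos : ∀ x ∈ I01, 0 < V x) : Summable fun n => (μ n)⁻¹ := by
  obtain ⟨δ, hδ0, hδ⟩ := exists_pos_le_of_pos hV hVpos
  exact summable_of_sum_le (fun n => (inv_pos.2 (h.eigenvalue_pos hV hVpos n)).le)
    (h.isEigenFamily.sum_inv_le hV hδ0 hδ)

/-- The bound `(μ n t)^(k+1) / (k+1)! ≤ exp (μ n t)` leaves one spare factor `1 / μ n`, which is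
summable. -/
theorem summable_pow_mul_exp (h : IsNeumannSpectrum V μ e) (hV : ContinuousOn V I01)
    (hVpos : ∀ x ∈ I01, 0 < V x) (k : ℕ) {t : ℝ} (ht : 0 < t) :
    Summable fun n => μ n ^ k * Real.exp (-μ n * t) := by
  have hμ := h.eigenvalue_pos hV hVpos
  refine Summable.of_nonneg_of_le (fun n => ?_) (fun n => ?_)
    ((h.summable_inv hV hVpos).mul_left ((k + 1).factorial / t ^ (k + 1)))
  · have := hμ n; positivity
  · have h1 : (μ n * t) ^ (k + 1) / (k + 1).factorial ≤ Real.exp (μ n * t) :=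
      Real.pow_div_factorial_le_exp _ (mul_pos (hμ n) ht).le _
    have hp := hμ n
    rw [neg_mul, Real.exp_neg, ← div_eq_mul_inv, ← div_eq_mul_inv, div_le_iff₀ (Real.exp_pos _)]
    rw [div_le_iff₀ (by positivity)] at h1
    have h2 : μ n ^ k = (μ n * t) ^ (k + 1) / (t ^ (k + 1) * μ n) := by
      field_simp
      ring
    have h3 : (k + 1).factorial / t ^ (k + 1) / μ n * Real.exp (μ n * t)
        = (Real.exp (μ n * t) * (k + 1).factorial) / (t ^ (k + 1) * μ n) := by
      field_simp
    rw [h2, h3]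
    gcongr

end IsNeumannSpectrum

end HeatFlow

namespace HeatFlow

/-! ### Rapidly convergent eigenfunction expansions -/

/-- The function with coefficients `a` in the system `e`. -/
noncomputable def expansion (e : ℕ → ℝ → ℝ) (a : ℕ → ℝ) (x : ℝ) : ℝ := ∑' n, a n * e n x

/-- Rapid decrease of a sequence with respect to the eigenvalues. -/
def RapidDecay (μ a : ℕ → ℝ) : Prop := ∀ k : ℕ, Summable fun n => |a n| * μ n ^ k

theorem RapidDecay.mul_eigenvalue {μ a : ℕ → ℝ} (hμ : ∀ n, 0 < μ n) (h : RapidDecay μ a) :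
    RapidDecay μ (fun n => μ n * a n) := fun k => by
  refine (h (k + 1)).congr fun n => ?_
  rw [abs_mul, abs_of_pos (hμ n)]
  ring

theorem RapidDecay.sub {μ a b : ℕ → ℝ} (hμ : ∀ n, 0 < μ n) (ha : RapidDecay μ a)
    (hb : RapidDecay μ b) : RapidDecay μ (fun n => a n - b n) := fun k => by
  refine Summable.of_nonneg_of_le (fun n => ?_) (fun n => ?_) ((ha k).add (hb k))
  · have := hμ n; positivity
  · rw [← add_mul]
    have := hμ n
    exact mul_le_mul_of_nonneg_right (abs_sub _ _) (by positivity)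

namespace IsNeumannSpectrum

variable {V : ℝ → ℝ} {μ : ℕ → ℝ} {e : ℕ → ℝ → ℝ}

theorem exists_bounds (h : IsNeumannSpectrum V μ e) (hV : ContinuousOn V I01)
    (hVpos : ∀ x ∈ I01, 0 < V x) :
    ∃ B, 0 < B ∧ ∀ n, ∀ x ∈ I01, |e n x| ≤ B * μ n ^ 2 ∧ |D (e n) x| ≤ B * μ n ^ 2 ∧
      |(V x - μ n) * e n x| ≤ B * μ n ^ 2 := h.isEigenFamily.exists_bounds hV hVpos

/-- The eigenfunctions and their first two derivatives grow at most like `μ n ^ 2`, so rapid decay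
permits two termwise differentiations. The second derivative is written as an expansion again in
order to be iterated. -/
theorem expansion_neumann (h : IsNeumannSpectrum V μ e) (hV : ContinuousOn V I01)
    (hVpos : ∀ x ∈ I01, 0 < V x) {a : ℕ → ℝ} (ha : RapidDecay μ a) :
    NeumannC2 (expansion e a) (fun x => ∑' n, a n * D (e n) x)
      (fun x => V x * expansion e a x - expansion e (fun n => μ n * a n) x) := by
  obtain ⟨B, hB, hb⟩ := h.exists_bounds hV hVpos
  have hμ := h.eigenvalue_pos hV hVpos
  have hN := h.isEigenFamily.neumann
  have hu : Summable fun n => B * (|a n| * μ n ^ 2) := (ha 2).mul_left B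
  have hle : ∀ n y, |y| ≤ B * μ n ^ 2 → |a n * y| ≤ B * (|a n| * μ n ^ 2) := by
    intro n y hy
    rw [abs_mul, mul_left_comm B]
    exact mul_le_mul_of_nonneg_left hy (abs_nonneg _)
  have hs : ∀ {b : ℕ → ℝ}, RapidDecay μ b → ∀ x ∈ I01, Summable fun n => b n * e n x := by
    intro b hb' x hx
    refine Summable.of_norm_bounded ((hb' 2).mul_left B) fun n => ?_
    rw [Real.norm_eq_abs, abs_mul, mul_left_comm B]
    exact mul_le_mul_of_nonneg_left (hb n x hx).1 (abs_nonneg _)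
  have e2 : ∀ x ∈ I01, V x * expansion e a x - expansion e (fun n => μ n * a n) x
      = ∑' n, a n * ((V x - μ n) * e n x) := by
    intro x hx
    unfold expansion
    rw [← tsum_mul_left, ← ((hs ha x hx).mul_left (V x)).tsum_sub
      (hs (ha.mul_eigenvalue hμ) x hx)]
    exact tsum_congr fun n => by ring
  refine ⟨?_, ?_, ?_, ?_, ?_⟩
  · exact hasDerivWithinAt_tsum_I01 hu (fun n x hx => ((hN n).d1 x hx).const_mul _)
      (fun n => continuousOn_const.mul (hN n).cont1) (fun n x hx => hle n _ (hb n x hx).2.1)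
      (hs ha 0 zero_mem_I01)
  · intro x hx
    rw [e2 x hx]
    refine hasDerivWithinAt_tsum_I01 hu (fun n x hx => ((hN n).d2 x hx).const_mul _)
      (fun n => continuousOn_const.mul (hN n).cont2) (fun n x hx => hle n _ (hb n x hx).2.2)
      ?_ x hx
    simp only [(hN _).left, mul_zero]
    exact summable_zero
  · refine ContinuousOn.congr ?_ e2
    exact continuousOn_tsum (fun n => continuousOn_const.mul (hN n).cont2) hu
      fun n x hx => hle n _ (hb n x hx).2.2
  · simp only [(hN _).left, mul_zero, tsum_zero]
  · simp only [(hN _).right, mul_zero, tsum_zero]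

/-- Bootstrap: the second derivative is `V` times the expansion minus another rapidly convergent
expansion. -/
theorem expansion_contDiffOn (h : IsNeumannSpectrum V μ e) (hV : ContDiffOn ℝ ∞ V I01)
    (hVpos : ∀ x ∈ I01, 0 < V x) {a : ℕ → ℝ} (ha : RapidDecay μ a) :
    ContDiffOn ℝ ∞ (expansion e a) I01 := by
  have hVc := hV.continuousOn
  have hμ := h.eigenvalue_pos hVc hVpos
  -- The induction carries the function and its derivative together, since each step gains one order
  -- through the second derivative.
  have key : ∀ (m : ℕ) (a : ℕ → ℝ), RapidDecay μ a → ContDiffOn ℝ m (expansion e a) I01 ∧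
      ContDiffOn ℝ m (fun x => ∑' n, a n * D (e n) x) I01 := by
    intro m
    induction m with
    | zero =>
      intro a ha
      have hN := h.expansion_neumann hVc hVpos ha
      exact ⟨by simpa using! hN.cont, by simpa using! hN.cont1⟩
    | succ m ih =>
      intro a ha
      have hN := h.expansion_neumann hVc hVpos ha
      refine ⟨contDiffOn_succ_of_hasDerivWithinAt hN.d1 (ih a ha).2,
        contDiffOn_succ_of_hasDerivWithinAt hN.d2 ?_⟩
      exact ((hV.of_le (by exact_mod_cast le_top)).mul (ih a ha).1).sub
        (ih _ (ha.mul_eigenvalue hμ)).1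
  exact contDiffOn_infty.2 fun m => (key m a ha).1

/-- The expansion is controlled in the `C¹` norm by its coefficients. -/
theorem exists_expansion_bound (h : IsNeumannSpectrum V μ e) (hV : ContinuousOn V I01)
    (hVpos : ∀ x ∈ I01, 0 < V x) :
    ∃ B, 0 < B ∧ ∀ a, RapidDecay μ a → ∀ x ∈ I01,
      |expansion e a x| ≤ B * ∑' n, |a n| * μ n ^ 2 ∧
      |∑' n, a n * D (e n) x| ≤ B * ∑' n, |a n| * μ n ^ 2 := by
  obtain ⟨B, hB, hb⟩ := h.exists_bounds hV hVpos
  refine ⟨B, hB, fun a ha x hx => ?_⟩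
  have hu := (ha 2).mul_left B
  have hle : ∀ n y, |y| ≤ B * μ n ^ 2 → ‖a n * y‖ ≤ B * (|a n| * μ n ^ 2) := by
    intro n y hy
    rw [Real.norm_eq_abs, abs_mul, mul_left_comm B]
    exact mul_le_mul_of_nonneg_left hy (abs_nonneg _)
  rw [← tsum_mul_left]
  exact ⟨tsum_of_norm_bounded hu.hasSum fun n => hle n _ (hb n x hx).1,
    tsum_of_norm_bounded hu.hasSum fun n => hle n _ (hb n x hx).2.1⟩

theorem coeff_expansion (h : IsNeumannSpectrum V μ e) (hV : ContinuousOn V I01)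
    (hVpos : ∀ x ∈ I01, 0 < V x) {a : ℕ → ℝ} (ha : RapidDecay μ a) (m : ℕ) :
    coeff (e m) (expansion e a) = a m := by
  obtain ⟨B, hB, hb⟩ := h.exists_bounds hV hVpos
  have hμ := h.eigenvalue_pos hV hVpos
  have hs : ∀ x ∈ I01, Summable fun n => a n * e n x := by
    intro x hx
    refine Summable.of_norm_bounded ((ha 2).mul_left B) fun n => ?_
    rw [Real.norm_eq_abs, abs_mul, mul_left_comm B]
    exact mul_le_mul_of_nonneg_left (hb n x hx).1 (abs_nonneg _)
  have hIoc : ∀ {x : ℝ}, x ∈ uIoc (0 : ℝ) 1 → x ∈ I01 := fun hx => by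
    rw [uIoc_of_le zero_le_one] at hx; exact Ioc_subset_Icc_self hx
  have hc := h.cont
  have hsum := intervalIntegral.hasSum_integral_of_dominated_convergence (μ := volume)
    (a := (0 : ℝ)) (b := 1) (F := fun n x => a n * (e m x * e n x))
    (f := fun x => e m x * expansion e a x)
    (bound := fun n _ => B * μ m ^ 2 * (B * (|a n| * μ n ^ 2)))
    (fun n => ?_) (fun n => Eventually.of_forall fun x hx => ?_)
    (Eventually.of_forall fun x _ => ((ha 2).mul_left B).mul_left _) ?_
    (Eventually.of_forall fun x hx => ?_)
  · have e1 : ∀ n, ∫ x in (0 : ℝ)..1, a n * (e m x * e n x) = if n = m then a n else 0 := by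
      intro n
      rw [intervalIntegral.integral_const_mul, h.orthonormal]
      simp [eq_comm]
    simp_rw [e1] at hsum
    have e2 : (fun n => if n = m then a n else 0) = fun n => if n = m then a m else 0 := by
      ext n
      split_ifs with hn
      · rw [hn]
      · rfl
    rw [e2] at hsum
    exact hsum.unique (hasSum_ite_eq m (a m))
  · have : ContinuousOn (fun x => a n * (e m x * e n x)) I01 :=
      continuousOn_const.mul ((hc m).mul (hc n))
    rw [uIoc_of_le zero_le_one]
    exact (this.mono Ioc_subset_Icc_self).aestronglyMeasurable measurableSet_Ioc
  · rw [Real.norm_eq_abs, abs_mul, abs_mul]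
    have h1 := (hb m x (hIoc hx)).1
    have h2 := (hb n x (hIoc hx)).1
    have := hμ m
    calc |a n| * (|e m x| * |e n x|) ≤ |a n| * ((B * μ m ^ 2) * (B * μ n ^ 2)) := by gcongr
      _ = _ := by ring
  · exact intervalIntegrable_const
  · have := (hs x (hIoc hx)).hasSum.mul_left (e m x)
    convert! this using 2
    ring

end IsNeumannSpectrum

/-! ### The linear heat semigroup -/

/-- The solution at time `t` of the linear heat equation with Cauchy data `f`. -/
noncomputable def heat (μ : ℕ → ℝ) (e : ℕ → ℝ → ℝ) (t : ℝ) (f : ℝ → ℝ) : ℝ → ℝ :=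
  -- At time zero the series is only known to represent the datum in `L²`; taking the datum itself
  -- keeps a continuous profile.
  if t ≤ 0 then f else expansion e (fun n => Real.exp (-μ n * t) * coeff (e n) f)

theorem heat_of_pos {μ : ℕ → ℝ} {e : ℕ → ℝ → ℝ} {t : ℝ} (ht : 0 < t) (f : ℝ → ℝ) :
    heat μ e t f = expansion e (fun n => Real.exp (-μ n * t) * coeff (e n) f) :=
  if_neg ht.not_ge

theorem heat_zero {μ : ℕ → ℝ} {e : ℕ → ℝ → ℝ} (f : ℝ → ℝ) : heat μ e 0 f = f := if_pos le_rfl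

theorem l2norm_sq {f : ℝ → ℝ} : l2norm f ^ 2 = ∫ x in (0 : ℝ)..1, f x ^ 2 :=
  Real.sq_sqrt (integral_nonneg_I01 fun _ _ => sq_nonneg _)

theorem l2norm_nonneg (f : ℝ → ℝ) : 0 ≤ l2norm f := Real.sqrt_nonneg _

namespace IsNeumannSpectrum

variable {V : ℝ → ℝ} {μ : ℕ → ℝ} {e : ℕ → ℝ → ℝ}

theorem hasSum_coeff_sq (h : IsNeumannSpectrum V μ e) {f : ℝ → ℝ} (hf : ContinuousOn f I01) :
    HasSum (fun n => coeff (e n) f ^ 2) (l2norm f ^ 2) := by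
  have := h.hasSum_coeff hf hf
  rw [l2norm_sq]
  simpa only [← pow_two] using this

theorem abs_coeff_le (h : IsNeumannSpectrum V μ e) {f : ℝ → ℝ} (hf : ContinuousOn f I01) (n : ℕ) :
    |coeff (e n) f| ≤ l2norm f :=
  abs_le_of_sq_le_sq (le_hasSum (h.hasSum_coeff_sq hf) n fun _ _ => sq_nonneg _)
    (l2norm_nonneg f)

theorem rapidDecay (h : IsNeumannSpectrum V μ e) (hV : ContinuousOn V I01)
    (hVpos : ∀ x ∈ I01, 0 < V x) {f : ℝ → ℝ} (hf : ContinuousOn f I01) {t : ℝ} (ht : 0 < t) :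
    RapidDecay μ (fun n => Real.exp (-μ n * t) * coeff (e n) f) := fun k => by
  have hμ := h.eigenvalue_pos hV hVpos
  refine Summable.of_nonneg_of_le (fun n => ?_) (fun n => ?_)
    ((h.summable_pow_mul_exp hV hVpos k ht).mul_left (l2norm f))
  · have := hμ n; positivity
  · rw [abs_mul, abs_of_pos (Real.exp_pos _)]
    have := hμ n
    calc Real.exp (-μ n * t) * |coeff (e n) f| * μ n ^ k
        ≤ Real.exp (-μ n * t) * l2norm f * μ n ^ k := by
          gcongr; exact h.abs_coeff_le hf n
      _ = _ := by ring

theorem heat_neumann (h : IsNeumannSpectrum V μ e) (hV : ContinuousOn V I01)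
    (hVpos : ∀ x ∈ I01, 0 < V x) {f : ℝ → ℝ} (hf : ContinuousOn f I01) {t : ℝ} (ht : 0 < t) :
    NeumannC2 (heat μ e t f)
      (fun x => ∑' n, Real.exp (-μ n * t) * coeff (e n) f * D (e n) x)
      (fun x => V x * heat μ e t f x
        - expansion e (fun n => μ n * (Real.exp (-μ n * t) * coeff (e n) f)) x) := by
  rw [heat_of_pos ht]
  exact h.expansion_neumann hV hVpos (h.rapidDecay hV hVpos hf ht)

theorem heat_cont (h : IsNeumannSpectrum V μ e) (hV : ContinuousOn V I01)
    (hVpos : ∀ x ∈ I01, 0 < V x) {f : ℝ → ℝ} (hf : ContinuousOn f I01) (t : ℝ) :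
    ContinuousOn (heat μ e t f) I01 := by
  by_cases ht : t ≤ 0
  · rw [heat, if_pos ht]; exact hf
  · exact (h.heat_neumann hV hVpos hf (not_le.1 ht)).cont

theorem coeff_heat (h : IsNeumannSpectrum V μ e) (hV : ContinuousOn V I01)
    (hVpos : ∀ x ∈ I01, 0 < V x) {f : ℝ → ℝ} (hf : ContinuousOn f I01) {t : ℝ} (ht : 0 ≤ t)
    (n : ℕ) : coeff (e n) (heat μ e t f) = Real.exp (-μ n * t) * coeff (e n) f := by
  rcases eq_or_lt_of_le ht with rfl | ht
  · rw [heat_zero]; simp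
  · rw [heat_of_pos ht, h.coeff_expansion hV hVpos (h.rapidDecay hV hVpos hf ht)]

theorem hasDerivAt_heat (h : IsNeumannSpectrum V μ e) (hV : ContinuousOn V I01)
    (hVpos : ∀ x ∈ I01, 0 < V x) {f : ℝ → ℝ} (hf : ContinuousOn f I01) {t : ℝ} (ht : 0 < t) :
    ∀ x ∈ I01, HasDerivAt (fun s => heat μ e s f x)
      (D (D (heat μ e t f)) x - V x * heat μ e t f x) t := by
  obtain ⟨B, hB, hb⟩ := h.exists_bounds hV hVpos
  have hμ := h.eigenvalue_pos hV hVpos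
  intro x hx
  -- On `]t/2, ∞[` the differentiated series is dominated by its bound at time `t/2`.
  have ht2 : 0 < t / 2 := by positivity
  have hd : HasDerivAt (fun s => ∑' n, Real.exp (-μ n * s) * coeff (e n) f * e n x)
      (∑' n, Real.exp (-μ n * t) * (-μ n) * coeff (e n) f * e n x) t := by
    refine hasDerivAt_tsum_of_isPreconnected (𝕜 := ℝ) (F := ℝ) (t := Ioi (t / 2)) (y₀ := t)
      (g := fun n s => Real.exp (-μ n * s) * coeff (e n) f * e n x)
      (g' := fun n s => Real.exp (-μ n * s) * (-μ n) * coeff (e n) f * e n x)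
      (u := fun n => B * (|Real.exp (-μ n * (t / 2)) * coeff (e n) f| * μ n ^ 3))
      ((h.rapidDecay hV hVpos hf ht2 3).mul_left B) isOpen_Ioi isPreconnected_Ioi
      (fun n s _ => ?_) (fun n s hs => ?_) (half_lt_self ht) ?_ (half_lt_self ht)
    · have := (((hasDerivAt_id s).const_mul (-μ n)).exp.mul_const (coeff (e n) f)).mul_const (e n x)
      simpa using! this
    · have h1 : Real.exp (-μ n * s) ≤ Real.exp (-μ n * (t / 2)) :=
        Real.exp_le_exp.2 (by have := hμ n; have : t / 2 < s := hs; nlinarith)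
      have := hμ n
      rw [Real.norm_eq_abs, abs_mul, abs_mul, abs_mul, abs_neg, abs_of_pos (Real.exp_pos _),
        abs_of_pos this, abs_mul, abs_of_pos (Real.exp_pos _)]
      calc Real.exp (-μ n * s) * μ n * |coeff (e n) f| * |e n x|
          ≤ Real.exp (-μ n * (t / 2)) * μ n * |coeff (e n) f| * (B * μ n ^ 2) := by
            gcongr; exact (hb n x hx).1
        _ = _ := by ring
    · refine Summable.of_norm_bounded ((h.rapidDecay hV hVpos hf ht 2).mul_left B) fun n => ?_
      rw [Real.norm_eq_abs, abs_mul, mul_left_comm B]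
      exact mul_le_mul_of_nonneg_left (hb n x hx).1 (abs_nonneg _)
  have hev : (fun s => heat μ e s f x)
      =ᶠ[𝓝 t] fun s => ∑' n, Real.exp (-μ n * s) * coeff (e n) f * e n x := by
    filter_upwards [lt_mem_nhds ht] with s hs
    rw [heat_of_pos hs]
    rfl
  refine (hd.congr_of_eventuallyEq hev).congr_deriv ?_
  rw [(h.heat_neumann hV hVpos hf ht).DD_eq hx, sub_sub_cancel_left, expansion, ← tsum_neg]
  exact tsum_congr fun n => by ring

/-- The weak form of the linear heat equation. -/
theorem hasDerivWithinAt_integral_heat (h : IsNeumannSpectrum V μ e) (hV : ContinuousOn V I01)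
    (hVpos : ∀ x ∈ I01, 0 < V x) {f : ℝ → ℝ} (hf : ContinuousOn f I01) {φ φ₁ φ₂ : ℝ → ℝ}
    (hφ : NeumannC2 φ φ₁ φ₂) {t : ℝ} (ht : 0 ≤ t) :
    HasDerivWithinAt (fun s => ∫ x in (0 : ℝ)..1, heat μ e s f x * φ x)
      (∫ x in (0 : ℝ)..1, heat μ e t f x * (φ₂ x - V x * φ x)) (Ici 0) t := by
  have hμ := h.eigenvalue_pos hV hVpos
  have hφc := hφ.cont
  have hφ2 := hφ.cont2
  have hlc : ContinuousOn (fun x => V x * φ x - φ₂ x) I01 := by fun_prop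
  -- The operator is moved onto the test function. The differentiated series is then dominated by
  -- products of square summable coefficients, uniformly up to time `0`, although the datum is
  -- merely continuous.
  have hl : ∀ n, coeff (e n) (fun x => V x * φ x - φ₂ x) = μ n * coeff (e n) φ := fun n =>
    coeff_operator hV (h.isEigenFamily.neumann n) hφ
  have hsum : ∀ s, 0 ≤ s → ∫ x in (0 : ℝ)..1, heat μ e s f x * φ x
      = ∑' n, Real.exp (-μ n * s) * (coeff (e n) f * coeff (e n) φ) := by
    intro s hs
    rw [← (h.hasSum_coeff (h.heat_cont hV hVpos hf s) hφc).tsum_eq]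
    exact tsum_congr fun n => by rw [h.coeff_heat hV hVpos hf hs]; ring
  have hd := hasDerivWithinAt_tsum_Ici
    (f := fun n s => Real.exp (-μ n * s) * (coeff (e n) f * coeff (e n) φ))
    (f₁ := fun n s => -(Real.exp (-μ n * s)
      * (coeff (e n) f * coeff (e n) (fun x => V x * φ x - φ₂ x))))
    (h.hasSum_coeff hf hlc).summable.abs (fun n s _ => ?_) (fun n => by fun_prop)
    (fun n s hs => ?_) ?_ t ht
  · refine (hd.congr (fun s hs => hsum s hs) (hsum t ht)).congr_deriv ?_
    rw [tsum_neg]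
    have e1 : ∀ x, heat μ e t f x * (φ₂ x - V x * φ x)
        = -(heat μ e t f x * (V x * φ x - φ₂ x)) := fun x => by ring
    simp_rw [e1]
    rw [intervalIntegral.integral_neg,
      ← (h.hasSum_coeff (h.heat_cont hV hVpos hf t) hlc).tsum_eq]
    congr 1
    exact tsum_congr fun n => by rw [h.coeff_heat hV hVpos hf ht]; ring
  · have := (((hasDerivAt_id s).const_mul (-μ n)).exp.mul_const
      (coeff (e n) f * coeff (e n) φ)).hasDerivWithinAt (s := Ici 0)
    rw [hl n]
    convert! this using 1
    simp
    ring
  · rw [abs_neg, abs_mul, abs_of_pos (Real.exp_pos _)]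
    refine mul_le_of_le_one_left (abs_nonneg _) (Real.exp_le_one_iff.2 ?_)
    have := hμ n
    have : 0 ≤ s := hs
    nlinarith
  · simpa using (h.hasSum_coeff hf hφc).summable

theorem l2norm_heat_le (h : IsNeumannSpectrum V μ e) (hV : ContinuousOn V I01)
    (hVpos : ∀ x ∈ I01, 0 < V x) {f : ℝ → ℝ} (hf : ContinuousOn f I01) {t : ℝ} (ht : 0 ≤ t) :
    l2norm (heat μ e t f) ≤ Real.exp (-μ 0 * t) * l2norm f := by
  refine abs_le_of_sq_le_sq' ?_ (mul_nonneg (Real.exp_pos _).le (l2norm_nonneg f)) |>.2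
  rw [mul_pow]
  refine hasSum_le (fun n => ?_) (h.hasSum_coeff_sq (h.heat_cont hV hVpos hf t))
    ((h.hasSum_coeff_sq hf).mul_left _)
  rw [h.coeff_heat hV hVpos hf ht, mul_pow]
  have h1 : Real.exp (-μ n * t) ≤ Real.exp (-μ 0 * t) :=
    Real.exp_le_exp.2 (by have := h.mono (Nat.zero_le n); nlinarith)
  gcongr

/-- Continuity in time of a multiple of the heat flow. -/
theorem tendsto_l2norm_heat (h : IsNeumannSpectrum V μ e) (hV : ContinuousOn V I01)
    (hVpos : ∀ x ∈ I01, 0 < V x) {f : ℝ → ℝ} (hf : ContinuousOn f I01) {r : ℝ → ℝ} {S : Set ℝ}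
    (hS : ∀ s ∈ S, 0 ≤ s) {t : ℝ} (ht : t ∈ S) (hr : ContinuousWithinAt r S t) :
    Tendsto (fun s => l2norm ((fun x => r s * heat μ e s f x) - fun x => r t * heat μ e t f x))
      (𝓝[S] t) (𝓝 0) := by
  have hμ := h.eigenvalue_pos hV hVpos
  set q : ℝ → ℕ → ℝ := fun s n =>
    (r s * Real.exp (-μ n * s) - r t * Real.exp (-μ n * t)) ^ 2 * coeff (e n) f ^ 2 with hq
  have hsq : ∀ s ∈ S,
      l2norm ((fun x => r s * heat μ e s f x) - fun x => r t * heat μ e t f x) ^ 2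
        = ∑' n, q s n := by
    intro s hs
    have c1 := h.heat_cont hV hVpos hf s
    have c2 := h.heat_cont hV hVpos hf t
    have hc : ContinuousOn ((fun x => r s * heat μ e s f x) - fun x => r t * heat μ e t f x) I01 :=
      (continuousOn_const.mul c1).sub (continuousOn_const.mul c2)
    rw [← (h.hasSum_coeff_sq hc).tsum_eq]
    refine tsum_congr fun n => ?_
    have : coeff (e n) ((fun x => r s * heat μ e s f x) - fun x => r t * heat μ e t f x)
        = r s * (Real.exp (-μ n * s) * coeff (e n) f)
          - r t * (Real.exp (-μ n * t) * coeff (e n) f) := by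
      rw [← h.coeff_heat hV hVpos hf (hS s hs), ← h.coeff_heat hV hVpos hf (hS t ht),
        ← coeff_const_mul, ← coeff_const_mul]
      exact coeff_sub (h.cont n) (by fun_prop) (by fun_prop)
    rw [this]
    ring
  have hexp : ∀ n s, s ∈ S → |Real.exp (-μ n * s)| ≤ 1 := by
    intro n s hs
    rw [abs_of_pos (Real.exp_pos _)]
    have := hμ n
    have := hS s hs
    exact Real.exp_le_one_iff.2 (by nlinarith)
  -- By Parseval the squared distance is a series. Its terms tend to zero and are dominated once `|r
  -- s| < |r t| + 1`.
  have hlim : Tendsto (fun s => ∑' n, q s n) (𝓝[S] t) (𝓝 (∑' _ : ℕ, (0 : ℝ))) := by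
    refine tendsto_tsum_of_dominated_convergence
      (bound := fun n => (2 * |r t| + 1) ^ 2 * coeff (e n) f ^ 2)
      ((h.hasSum_coeff_sq hf).summable.mul_left _) (fun n => ?_) ?_
    · have hc : ContinuousWithinAt (fun s => q s n) S t := by
        have : ContinuousWithinAt (fun s => Real.exp (-μ n * s)) S t :=
          (by fun_prop : Continuous fun s => Real.exp (-μ n * s)).continuousWithinAt
        exact (((hr.mul this).sub continuousWithinAt_const).pow 2).mul continuousWithinAt_const
      have := hc.tendsto
      simpa [hq] using this
    · have hev : ∀ᶠ s in 𝓝[S] t, |r s| < |r t| + 1 :=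
        hr.abs.tendsto.eventually_lt_const (by linarith)
      filter_upwards [hev, self_mem_nhdsWithin] with s hs hsS n
      have hab : |r s * Real.exp (-μ n * s) - r t * Real.exp (-μ n * t)| ≤ 2 * |r t| + 1 := by
        refine (abs_sub _ _).trans ?_
        rw [abs_mul, abs_mul]
        have h1 := mul_le_of_le_one_right (abs_nonneg (r s)) (hexp n s hsS)
        have h2 := mul_le_of_le_one_right (abs_nonneg (r t)) (hexp n t ht)
        linarith
      rw [Real.norm_eq_abs, abs_of_nonneg (by positivity)]
      refine mul_le_mul_of_nonneg_right ?_ (sq_nonneg _)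
      rw [← sq_abs]
      gcongr
  rw [tsum_zero] at hlim
  have h1 := (Real.continuous_sqrt.tendsto 0).comp hlim
  rw [Real.sqrt_zero] at h1
  refine h1.congr' ?_
  filter_upwards [self_mem_nhdsWithin] with s hs
  rw [Function.comp_apply, ← hsq s hs, Real.sqrt_sq (l2norm_nonneg _)]

end IsNeumannSpectrum

end HeatFlow

namespace HeatFlow

/-! ### Positivity and mean of the linear flow -/

/-- Scalar form of the resolvent approximation of the semigroup: the power equals `(1 + x t /
j)^(-j)`. It is used with `x = μ n` for the coefficients and with `x = M` for the lower bound. -/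
theorem tendsto_div_add_pow {t : ℝ} (ht : 0 < t) (x : ℝ) :
    Tendsto (fun j : ℕ => ((j / t) / (x + j / t)) ^ j) atTop (𝓝 (Real.exp (-x * t))) := by
  have h1 := (Real.tendsto_one_add_div_pow_exp (x * t)).inv₀ (Real.exp_pos _).ne'
  rw [← Real.exp_neg, ← neg_mul] at h1
  refine h1.congr' ?_
  filter_upwards [eventually_gt_atTop 0] with j hj
  have hj' : (0 : ℝ) < j := by exact_mod_cast hj
  rw [← inv_pow]
  congr 1
  have : x + j / t = (j / t) * (1 + x * t / j) := by field_simp; ring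
  rw [this, div_mul_cancel_left₀ (by positivity)]

theorem abs_integral_mul_le {f g : ℝ → ℝ} (hf : ContinuousOn f I01) (hg : ContinuousOn g I01) :
    |∫ x in (0 : ℝ)..1, f x * g x| ≤ l2norm f * l2norm g := by
  refine abs_le_of_sq_le_sq ?_ (mul_nonneg (l2norm_nonneg f) (l2norm_nonneg g))
  rw [mul_pow, l2norm_sq, l2norm_sq]
  exact sq_integral_mul_le hf hg

theorem mean_eq_integral_mul_one (f : ℝ → ℝ) : mean f = ∫ x in (0 : ℝ)..1, f x * 1 := by
  simp [mean]

namespace IsNeumannSpectrum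

variable {V : ℝ → ℝ} {μ : ℕ → ℝ} {e : ℕ → ℝ → ℝ}

/-- Iterated resolvents preserve lower bounds. -/
theorem exists_iterated_resolvent (h : IsNeumannSpectrum V μ e) (hV : ContinuousOn V I01)
    (hVpos : ∀ x ∈ I01, 0 < V x) {M : ℝ} (hM : ∀ x ∈ I01, V x ≤ M) {f : ℝ → ℝ}
    (hf : ContinuousOn f I01) {m : ℝ} (hm : 0 ≤ m) (hfm : ∀ x ∈ I01, m ≤ f x) {N : ℝ}
    (hN : 0 < N) (k : ℕ) :
    ∃ w, ContinuousOn w I01 ∧ (∀ x ∈ I01, (N / (M + N)) ^ k * m ≤ w x) ∧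
      ∀ n, coeff (e n) w = (N / (μ n + N)) ^ k * coeff (e n) f := by
  have hμ := h.eigenvalue_pos hV hVpos
  have hM0 : 0 < M := (hVpos 0 zero_mem_I01).trans_le (hM 0 zero_mem_I01)
  induction k with
  | zero => exact ⟨f, hf, by simpa using hfm, by simp⟩
  | succ k ih =>
    obtain ⟨g, hg, hgm, hgc⟩ := ih
    obtain ⟨w, w₁, hw⟩ := exists_neumann_solution (V := fun x => V x + N)
      (f := fun x => N * g x) (by fun_prop) (fun x hx => add_pos (hVpos x hx) hN) (by fun_prop)
    have hwc := hw.cont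
    refine ⟨w, hwc, fun x hx => ?_, fun n => ?_⟩
    · have := hw.lower_bound (W := fun x => V x + N) (f := fun x => N * g x)
        (m := N * ((N / (M + N)) ^ k * m)) (M := M + N) (by positivity)
        (fun x hx => add_pos (hVpos x hx) hN) (fun x hx => by linarith [hM x hx])
        (fun x _ => by simp) (fun x hx => mul_le_mul_of_nonneg_left (hgm x hx) hN.le) x hx
      refine le_trans (le_of_eq ?_) this
      rw [pow_succ]
      ring
    · have h1 := coeff_operator hV (h.isEigenFamily.neumann n) hw
      have e1 : ∀ x, V x * w x - ((V x + N) * w x - N * g x) = N * g x - N * w x :=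
        fun x => by ring
      simp_rw [e1] at h1
      rw [coeff_sub (h.cont n) (by fun_prop) (by fun_prop), coeff_const_mul, coeff_const_mul,
        hgc n] at h1
      have h2 : 0 < μ n + N := add_pos (hμ n) hN
      rw [pow_succ]
      field_simp
      linear_combination -h1

/-- The resolvent powers `(N / (L + N))^j` with `N = j / t` keep lower bounds by the maximum
principle, and they converge weakly to the heat flow. Weak convergence suffices, because the bound
is tested against the function that measures its failure. -/
theorem heat_lower_bound (h : IsNeumannSpectrum V μ e) (hV : ContinuousOn V I01)
    (hVpos : ∀ x ∈ I01, 0 < V x) {M : ℝ} (hM : ∀ x ∈ I01, V x ≤ M) {f : ℝ → ℝ}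
    (hf : ContinuousOn f I01) {m : ℝ} (hm : 0 ≤ m) (hfm : ∀ x ∈ I01, m ≤ f x) {t : ℝ}
    (ht : 0 ≤ t) : ∀ x ∈ I01, Real.exp (-M * t) * m ≤ heat μ e t f x := by
  rcases eq_or_lt_of_le ht with rfl | ht
  · simpa [heat_zero] using hfm
  have hμ := h.eigenvalue_pos hV hVpos
  have huc := h.heat_cont hV hVpos hf t
  set a := Real.exp (-M * t) * m with ha
  -- The deficit `(a - u)⁺`; the limit inequality below yields `∫ p² ≤ 0`.
  set p : ℝ → ℝ := fun x => max (a - heat μ e t f x) 0 with hp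
  have hpc : ContinuousOn p I01 := (continuousOn_const.sub huc).sup continuousOn_const
  have hp0 : ∀ x, 0 ≤ p x := fun x => le_max_right _ _
  -- For `j = 0` the parameter `j / t` is not positive; a dummy value is used there.
  have hres : ∀ j : ℕ, ∃ w, ContinuousOn w I01 ∧ (0 < j →
      (∀ x ∈ I01, ((j / t) / (M + j / t)) ^ j * m ≤ w x) ∧
      ∀ n, coeff (e n) w = ((j / t) / (μ n + j / t)) ^ j * coeff (e n) f) := by
    intro j
    by_cases hj : 0 < j
    · have hj' : (0 : ℝ) < j := by exact_mod_cast hj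
      obtain ⟨w, h1, h2, h3⟩ := h.exists_iterated_resolvent hV hVpos hM hf hm hfm
        (N := j / t) (by positivity) j
      exact ⟨w, h1, fun _ => ⟨h2, h3⟩⟩
    · exact ⟨f, hf, fun h => absurd h hj⟩
  choose w hwc hw using hres
  have hlim1 : Tendsto (fun j => ∫ x in (0 : ℝ)..1, w j x * p x) atTop
      (𝓝 (∫ x in (0 : ℝ)..1, heat μ e t f x * p x)) := by
    rw [← (h.hasSum_coeff huc hpc).tsum_eq]
    have e1 : ∀ j, ∫ x in (0 : ℝ)..1, w j x * p x = ∑' n, coeff (e n) (w j) * coeff (e n) p :=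
      fun j => (h.hasSum_coeff (hwc j) hpc).tsum_eq.symm
    simp_rw [e1]
    refine tendsto_tsum_of_dominated_convergence (h.hasSum_coeff hf hpc).summable.abs
      (fun n => ?_) ?_
    · rw [h.coeff_heat hV hVpos hf ht.le]
      refine (((tendsto_div_add_pow ht (μ n)).mul_const (coeff (e n) f)).congr' ?_).mul_const _
      filter_upwards [eventually_gt_atTop 0] with j hj
      rw [(hw j hj).2 n]
    · filter_upwards [eventually_gt_atTop 0] with j hj n
      have hj' : (0 : ℝ) < j := by exact_mod_cast hj
      rw [(hw j hj).2 n, mul_assoc, Real.norm_eq_abs, abs_mul, abs_pow]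
      refine mul_le_of_le_one_left (abs_nonneg _) (pow_le_one₀ (abs_nonneg _) ?_)
      have := hμ n
      rw [abs_of_pos (by positivity), div_le_one (by positivity)]
      linarith
  have hlim2 : Tendsto (fun j : ℕ => ((j / t) / (M + j / t)) ^ j * m * ∫ x in (0 : ℝ)..1, p x)
      atTop (𝓝 (a * ∫ x in (0 : ℝ)..1, p x)) :=
    ((tendsto_div_add_pow ht M).mul_const m).mul_const _
  have hle : a * ∫ x in (0 : ℝ)..1, p x ≤ ∫ x in (0 : ℝ)..1, heat μ e t f x * p x := by
    refine le_of_tendsto_of_tendsto hlim2 hlim1 ?_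
    filter_upwards [eventually_gt_atTop 0] with j hj
    rw [← intervalIntegral.integral_const_mul]
    have := hwc j
    exact integral_mono_I01 (by fun_prop) (by fun_prop)
      fun x hx => mul_le_mul_of_nonneg_right ((hw j hj).1 x hx) (hp0 x)
  have hpp : ∫ x in (0 : ℝ)..1, p x * p x
      = a * (∫ x in (0 : ℝ)..1, p x) - ∫ x in (0 : ℝ)..1, heat μ e t f x * p x := by
    rw [← intervalIntegral.integral_const_mul, ← integral_sub_I01 (by fun_prop) (by fun_prop)]
    refine integral_congr_I01 fun x _ => ?_
    simp only [hp]
    rcases le_total (a - heat μ e t f x) 0 with h1 | h1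
    · rw [max_eq_right h1]; ring
    · rw [max_eq_left h1]; ring
  have hz : ∫ x in (0 : ℝ)..1, p x * p x = 0 :=
    le_antisymm (by linarith) (integral_nonneg_I01 fun x _ => mul_self_nonneg _)
  intro x hx
  have h1 := mul_self_eq_zero.1
    (eqOn_zero_of_integral_eq_zero (by fun_prop) (fun x _ => mul_self_nonneg _) hz x hx)
  have h2 : a - heat μ e t f x ≤ p x := le_max_left _ _
  linarith

theorem heat_pos (h : IsNeumannSpectrum V μ e) (hV : ContinuousOn V I01)
    (hVpos : ∀ x ∈ I01, 0 < V x) {f : ℝ → ℝ} (hf : ContinuousOn f I01)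
    (hfpos : ∀ x ∈ I01, 0 < f x) {t : ℝ} (ht : 0 ≤ t) : ∀ x ∈ I01, 0 < heat μ e t f x := by
  obtain ⟨m, hm0, hm⟩ := exists_pos_le_of_pos hf hfpos
  obtain ⟨C, -, hC⟩ := exists_bound_I01 hV
  intro x hx
  exact (mul_pos (Real.exp_pos _) hm0).trans_le (h.heat_lower_bound hV hVpos
    (fun x hx => (le_abs_self _).trans (hC x hx)) hf hm0.le hm ht x hx)

theorem mean_heat_pos (h : IsNeumannSpectrum V μ e) (hV : ContinuousOn V I01)
    (hVpos : ∀ x ∈ I01, 0 < V x) {f : ℝ → ℝ} (hf : ContinuousOn f I01)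
    (hfpos : ∀ x ∈ I01, 0 < f x) {t : ℝ} (ht : 0 ≤ t) : 0 < mean (heat μ e t f) :=
  integral_pos_I01 (h.heat_cont hV hVpos hf t)
    fun x hx => h.heat_pos hV hVpos hf hfpos ht x (Ioo_subset_Icc_self hx)

/-- The constant `1` satisfies the Neumann conditions and serves as a test function. This identity
is what makes the factor of the nonlinear flow explicit. -/
theorem hasDerivWithinAt_mean_heat (h : IsNeumannSpectrum V μ e) (hV : ContinuousOn V I01)
    (hVpos : ∀ x ∈ I01, 0 < V x) {f : ℝ → ℝ} (hf : ContinuousOn f I01) {t : ℝ} (ht : 0 ≤ t) :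
    HasDerivWithinAt (fun s => mean (heat μ e s f)) (-nonlocal V (heat μ e t f)) (Ici 0) t := by
  have := h.hasDerivWithinAt_integral_heat hV hVpos hf (NeumannC2.const 1) ht
  simp_rw [mean_eq_integral_mul_one]
  refine this.congr_deriv ?_
  rw [nonlocal, ← intervalIntegral.integral_neg]
  congr 1
  ext x
  ring

theorem nonlocal_heat_pos (h : IsNeumannSpectrum V μ e) (hV : ContinuousOn V I01)
    (hVpos : ∀ x ∈ I01, 0 < V x) {f : ℝ → ℝ} (hf : ContinuousOn f I01)
    (hfpos : ∀ x ∈ I01, 0 < f x) {t : ℝ} (ht : 0 ≤ t) : 0 < nonlocal V (heat μ e t f) :=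
  integral_pos_I01 (hV.mul (h.heat_cont hV hVpos hf t))
    fun x hx => mul_pos (hVpos x (Ioo_subset_Icc_self hx))
      (h.heat_pos hV hVpos hf hfpos ht x (Ioo_subset_Icc_self hx))

theorem strictAntiOn_mean_heat (h : IsNeumannSpectrum V μ e) (hV : ContinuousOn V I01)
    (hVpos : ∀ x ∈ I01, 0 < V x) {f : ℝ → ℝ} (hf : ContinuousOn f I01)
    (hfpos : ∀ x ∈ I01, 0 < f x) : StrictAntiOn (fun s => mean (heat μ e s f)) (Ici 0) := by
  have hd := fun t (ht : 0 ≤ t) => h.hasDerivWithinAt_mean_heat hV hVpos hf ht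
  refine strictAntiOn_of_deriv_neg (convex_Ici 0) (fun t ht => (hd t ht).continuousWithinAt)
    fun t ht => ?_
  rw [interior_Ici] at ht
  rw [((hd t ht.le).hasDerivAt (Ici_mem_nhds ht)).deriv]
  exact neg_neg_of_pos (h.nonlocal_heat_pos hV hVpos hf hfpos ht.le)

/-- The derivative of `exp (M t) * ∫ u` is `exp (M t) * ∫ (M - V) u ≥ 0`. -/
theorem mean_heat_lower_bound (h : IsNeumannSpectrum V μ e) (hV : ContinuousOn V I01)
    (hVpos : ∀ x ∈ I01, 0 < V x) {M : ℝ} (hM : ∀ x ∈ I01, V x ≤ M) {f : ℝ → ℝ}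
    (hf : ContinuousOn f I01) (hfpos : ∀ x ∈ I01, 0 < f x) {t : ℝ} (ht : 0 ≤ t) :
    mean f * Real.exp (-t * M) ≤ mean (heat μ e t f) := by
  have hd : ∀ t, 0 ≤ t → HasDerivWithinAt (fun s => Real.exp (M * s) * mean (heat μ e s f))
      (Real.exp (M * t) * (M * mean (heat μ e t f) - nonlocal V (heat μ e t f))) (Ici 0) t := by
    intro t ht
    have h1 : HasDerivWithinAt (fun s => Real.exp (M * s)) (Real.exp (M * t) * M) (Ici 0) t := by
      simpa using! ((hasDerivAt_id t).const_mul M).exp.hasDerivWithinAt (s := Ici 0)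
    refine (h1.mul (h.hasDerivWithinAt_mean_heat hV hVpos hf ht)).congr_deriv ?_
    ring
  have hmono : MonotoneOn (fun s => Real.exp (M * s) * mean (heat μ e s f)) (Ici 0) := by
    refine monotoneOn_of_deriv_nonneg (convex_Ici 0)
      (fun t ht => (hd t ht).continuousWithinAt) (fun t ht => ?_) fun t ht => ?_ <;>
      rw [interior_Ici] at ht
    · exact ((hd t ht.le).hasDerivAt (Ici_mem_nhds ht)).differentiableAt.differentiableWithinAt
    · rw [((hd t ht.le).hasDerivAt (Ici_mem_nhds ht)).deriv]
      refine mul_nonneg (Real.exp_pos _).le (sub_nonneg.2 ?_)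
      have hu := h.heat_cont hV hVpos hf t
      rw [mean, ← intervalIntegral.integral_const_mul]
      exact integral_mono_I01 (by fun_prop) (by fun_prop) fun x hx =>
        mul_le_mul_of_nonneg_right (hM x hx) (h.heat_pos hV hVpos hf hfpos ht.le x hx).le
  have h1 := hmono self_mem_Ici (mem_Ici.2 ht) ht
  simp only [mul_zero, Real.exp_zero, one_mul, heat_zero] at h1
  have h2 : Real.exp (-t * M) * Real.exp (M * t) = 1 := by
    rw [← Real.exp_add]; simp; ring
  calc mean f * Real.exp (-t * M)
      ≤ (Real.exp (M * t) * mean (heat μ e t f)) * Real.exp (-t * M) :=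
        mul_le_mul_of_nonneg_right h1 (Real.exp_pos _).le
    _ = mean (heat μ e t f) := by linear_combination mean (heat μ e t f) * h2

theorem tendsto_mean_heat (h : IsNeumannSpectrum V μ e) (hV : ContinuousOn V I01)
    (hVpos : ∀ x ∈ I01, 0 < V x) {f : ℝ → ℝ} (hf : ContinuousOn f I01) :
    Tendsto (fun t => mean (heat μ e t f)) atTop (𝓝 0) := by
  have hlim : Tendsto (fun t => Real.exp (-μ 0 * t) * l2norm f * l2norm fun _ => (1 : ℝ))
      atTop (𝓝 0) := by
    have : Tendsto (fun t => Real.exp (-μ 0 * t)) atTop (𝓝 0) :=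
      Real.tendsto_exp_atBot.comp
        (tendsto_id.const_mul_atTop_of_neg (neg_neg_of_pos (h.eigenvalue_pos hV hVpos 0)))
    simpa using (this.mul_const (l2norm f)).mul_const (l2norm fun _ => (1 : ℝ))
  refine squeeze_zero_norm' ?_ hlim
  filter_upwards [eventually_ge_atTop 0] with t ht
  rw [Real.norm_eq_abs, mean_eq_integral_mul_one]
  exact (abs_integral_mul_le (h.heat_cont hV hVpos hf t) continuousOn_const).trans
    (mul_le_mul_of_nonneg_right (h.l2norm_heat_le hV hVpos hf ht) (l2norm_nonneg _))

end IsNeumannSpectrum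

end HeatFlow

namespace HeatFlow

/-! ### Weak solutions -/

theorem timeSpan_subset_Ici (T : EReal) : timeSpan T ⊆ Ici 0 := fun _ ht => ht.1

theorem zero_mem_timeSpan {T : EReal} (hT : 0 < T) : (0 : ℝ) ∈ timeSpan T :=
  ⟨le_rfl, by simpa using hT⟩

theorem Icc_subset_timeSpan {T : EReal} {t : ℝ} (ht : t ∈ timeSpan T) : Icc 0 t ⊆ timeSpan T :=
  fun _ hs => ⟨hs.1, (EReal.coe_le_coe_iff.2 hs.2).trans_lt ht.2⟩

theorem timeSpan_mem_nhds {T : EReal} {t : ℝ} (ht : t ∈ timeSpan T) (h0 : 0 < t) :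
    timeSpan T ∈ 𝓝 t := by
  have h1 : ∀ᶠ s : ℝ in 𝓝 t, (s : EReal) < T :=
    (continuous_coe_real_ereal.tendsto t).eventually_lt_const ht.2
  filter_upwards [h1, lt_mem_nhds h0] with s hs hs0
  exact ⟨hs0.le, hs⟩

theorem timeSpan_top : timeSpan ⊤ = Ici 0 := by
  ext t
  simp [timeSpan, EReal.coe_lt_top]

theorem IsSolution.congr {V : ℝ → ℝ} {N : (ℝ → ℝ) → ℝ} {v₀ : ℝ → ℝ} {T : EReal}
    {v w : ℝ → ℝ → ℝ} (h : IsSolution V N v₀ T v) (hN : ∀ f g, EqOn f g I01 → N f = N g)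
    (hw : ∀ t ∈ timeSpan T, EqOn (w t) (v t) I01) : IsSolution V N v₀ T w where
  pos := h.pos
  init := (hw 0 (zero_mem_timeSpan h.pos)).trans h.init
  cont_space t ht := (h.cont_space t ht).congr (hw t ht)
  cont_time t ht := by
    refine (h.cont_time t ht).congr' ?_
    filter_upwards [self_mem_nhdsWithin] with s hs
    unfold l2norm
    congr 1
    exact integral_congr_I01 fun x hx => by
      simp only [Pi.sub_apply, hw s hs hx, hw t ht hx]
  weak φ hφ h0 h1 t ht := by
    have hi : ∀ s ∈ timeSpan T, ∀ ψ : ℝ → ℝ,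
        ∫ x in (0 : ℝ)..1, w s x * ψ x = ∫ x in (0 : ℝ)..1, v s x * ψ x :=
      fun s hs ψ => integral_congr_I01 fun x hx => by simp only [hw s hs hx]
    rw [hi t ht, hi t ht φ, hN _ _ (hw t ht)]
    exact (h.weak φ hφ h0 h1 t ht).congr (fun s hs => hi s hs φ) (hi t ht φ)

theorem nonlocal_congr {V f g : ℝ → ℝ} (h : EqOn f g I01) : nonlocal V f = nonlocal V g :=
  integral_congr_I01 fun x hx => by simp only [h hx]

theorem nonlocal_const_mul (V f : ℝ → ℝ) (a : ℝ) :
    nonlocal V (fun x => a * f x) = a * nonlocal V f := coeff_const_mul V f a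

theorem mean_congr {f g : ℝ → ℝ} (h : EqOn f g I01) : mean f = mean g := integral_congr_I01 h

theorem mean_const_mul (f : ℝ → ℝ) (a : ℝ) : mean (fun x => a * f x) = a * mean f :=
  intervalIntegral.integral_const_mul a f

theorem eq_of_hasDerivWithinAt_zero {f : ℝ → ℝ} {b : ℝ}
    (h : ∀ x ∈ Icc 0 b, HasDerivWithinAt f 0 (Icc 0 b) x) : ∀ x ∈ Icc 0 b, f x = f 0 :=
  constant_of_has_deriv_right_zero (fun x hx => (h x hx).continuousWithinAt) fun x hx =>
    (h x (Ico_subset_Icc_self hx)).mono_of_mem_nhdsWithin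
      (mem_of_superset (Icc_mem_nhdsGE hx.2) (Icc_subset_Icc_left hx.1))

namespace IsNeumannSpectrum

variable {V : ℝ → ℝ} {μ : ℕ → ℝ} {e : ℕ → ℝ → ℝ}

/-- Multiples of the linear flow solve equations with a scalar coefficient. -/
theorem isSolution_mul_heat (h : IsNeumannSpectrum V μ e) (hV : ContinuousOn V I01)
    (hVpos : ∀ x ∈ I01, 0 < V x) {f : ℝ → ℝ} (hf : ContinuousOn f I01) {N : (ℝ → ℝ) → ℝ}
    {T : EReal} (hT : 0 < T) {r : ℝ → ℝ} (hr0 : r 0 = 1)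
    (hr : ∀ t ∈ timeSpan T,
      HasDerivWithinAt r (r t * N (fun x => r t * heat μ e t f x)) (timeSpan T) t) :
    IsSolution V N f T (fun t x => r t * heat μ e t f x) where
  pos := hT
  init x _ := by simp [hr0, heat_zero]
  cont_space t _ := continuousOn_const.mul (h.heat_cont hV hVpos hf t)
  cont_time t ht := h.tendsto_l2norm_heat hV hVpos hf (timeSpan_subset_Ici T) ht
    (hr t ht).continuousWithinAt
  weak φ hφ h0 h1 t ht := by
    have hN := NeumannC2.of_contDiffOn hφ h0 h1
    have hd := (h.hasDerivWithinAt_integral_heat hV hVpos hf hN ht.1).mono (timeSpan_subset_Ici T)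
    have hm := (hr t ht).mul hd
    have e1 : ∀ s, ∀ ψ : ℝ → ℝ, ∫ x in (0 : ℝ)..1, r s * heat μ e s f x * ψ x
        = r s * ∫ x in (0 : ℝ)..1, heat μ e s f x * ψ x := fun s ψ => by
      rw [← intervalIntegral.integral_const_mul]
      congr 1
      ext x
      ring
    simp_rw [e1 _ φ]
    refine hm.congr_deriv ?_
    rw [e1 t (fun x => D (D φ) x - V x * φ x)]
    ring

/-- Solutions of equations with a scalar coefficient are multiples of the linear flow. -/
theorem exists_eq_mul_heat (h : IsNeumannSpectrum V μ e) (hV : ContinuousOn V I01)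
    (hVpos : ∀ x ∈ I01, 0 < V x) {f : ℝ → ℝ} (hf : ContinuousOn f I01) {N : (ℝ → ℝ) → ℝ}
    {T : EReal} {v : ℝ → ℝ → ℝ} (hv : IsSolution V N f T v)
    (hN : ContinuousOn (fun t => N (v t)) (timeSpan T)) {b : ℝ} (hb : b ∈ timeSpan T) :
    ∃ G : ℝ → ℝ, G 0 = 1 ∧ (∀ t, 0 < G t) ∧
      (∀ t ∈ Icc 0 b, HasDerivAt G (G t * N (v t)) t) ∧
      ∀ t ∈ Icc 0 b, EqOn (v t) (fun x => G t * heat μ e t f x) I01 := by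
  have hb0 : 0 ≤ b := hb.1
  have hsub := Icc_subset_timeSpan hb
  -- The coefficient is frozen outside `[0, b]`, which makes it continuous on the line and its
  -- primitive differentiable everywhere.
  set n : ℝ → ℝ := fun t => N (v (projIcc 0 b hb0 t)) with hn
  have hnc : Continuous n := by
    have h1 : ContinuousOn (fun t => N (v t)) (Icc 0 b) := hN.mono hsub
    exact h1.comp_continuous (continuous_subtype_val.comp continuous_projIcc)
      fun t => (projIcc 0 b hb0 t).2
  have hne : ∀ t ∈ Icc 0 b, n t = N (v t) := fun t ht => by
    simp only [hn, projIcc_of_mem hb0 ht]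
  set G : ℝ → ℝ := fun t => Real.exp (∫ s in (0 : ℝ)..t, n s) with hG
  have hGd : ∀ t, HasDerivAt G (G t * n t) t := fun t =>
    (hnc.integral_hasStrictDerivAt 0 t).hasDerivAt.exp
  have hGpos : ∀ t, 0 < G t := fun t => Real.exp_pos _
  have hG0 : G 0 = 1 := by simp [hG]
  refine ⟨G, hG0, hGpos, fun t ht => by rw [← hne t ht]; exact hGd t, fun t ht => ?_⟩
  have hvc : ∀ s ∈ Icc 0 b, ContinuousOn (v s) I01 := fun s hs => hv.cont_space s (hsub hs)
  refine h.eqOn_of_coeff (hvc t ht) (continuousOn_const.mul (h.heat_cont hV hVpos hf t))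
    fun k => ?_
  rw [coeff_const_mul, h.coeff_heat hV hVpos hf ht.1]
  -- Testing against the eigenfunction `e k` closes the equation: `a' = (-μ k + n) a`, so `a(s) exp
  -- (μ k s) / G(s)` is constant.
  set a : ℝ → ℝ := fun s => ∫ x in (0 : ℝ)..1, v s x * e k x with ha
  have hac : ∀ s, coeff (e k) (v s) = a s := fun s => by
    simp only [coeff, ha]
    simp_rw [mul_comm]
  have had : ∀ s ∈ Icc 0 b, HasDerivWithinAt a ((-μ k + n s) * a s) (Icc 0 b) s := by
    intro s hs
    have h1 := (hv.weak (e k) (h.smooth k) (h.neumann k).1 (h.neumann k).2 s (hsub hs)).mono hsub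
    refine h1.congr_deriv ?_
    rw [hne s hs]
    have h2 : ∫ x in (0 : ℝ)..1, v s x * (D (D (e k)) x - V x * e k x) = -μ k * a s := by
      rw [ha, ← intervalIntegral.integral_const_mul]
      refine integral_congr_I01 fun x hx => ?_
      simp only [h.eigen k x hx]
      ring
    rw [h2]
    ring
  have hq : ∀ s ∈ Icc 0 b, HasDerivWithinAt (fun s => a s * Real.exp (μ k * s) / G s) 0
      (Icc 0 b) s := by
    intro s hs
    have h1 : HasDerivWithinAt (fun s => Real.exp (μ k * s)) (Real.exp (μ k * s) * μ k)
        (Icc 0 b) s := by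
      simpa using! ((hasDerivAt_id s).const_mul (μ k)).exp.hasDerivWithinAt (s := Icc 0 b)
    refine (((had s hs).mul h1).div (hGd s).hasDerivWithinAt (hGpos s).ne').congr_deriv ?_
    have := (hGpos s).ne'
    simp only [Pi.mul_apply]
    field_simp
    ring
  have hconst := eq_of_hasDerivWithinAt_zero hq t ht
  simp only [mul_zero, Real.exp_zero, mul_one, hG0, div_one] at hconst
  have h0 : a 0 = coeff (e k) f := by
    rw [← hac 0]
    exact coeff_congr hv.init
  rw [hac, ← h0, ← hconst]
  have h1 := (hGpos t).ne'
  have h2 : Real.exp (-μ k * t) * Real.exp (μ k * t) = 1 := by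
    rw [← Real.exp_add]; simp
  rw [neg_mul] at h2 ⊢
  field_simp
  linear_combination -(a t) * h2

theorem isLinearSolution_heat (h : IsNeumannSpectrum V μ e) (hV : ContinuousOn V I01)
    (hVpos : ∀ x ∈ I01, 0 < V x) {f : ℝ → ℝ} (hf : ContinuousOn f I01) :
    IsLinearSolution V f ⊤ (fun t => heat μ e t f) := by
  refine (h.isSolution_mul_heat (N := fun _ => 0) (r := fun _ => 1) hV hVpos hf
    EReal.zero_lt_top rfl fun t _ => ?_).congr (fun _ _ _ => rfl) fun t _ x _ => by simp
  rw [mul_zero]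
  exact hasDerivWithinAt_const _ _ _

theorem eqOn_heat_of_isLinearSolution (h : IsNeumannSpectrum V μ e) (hV : ContinuousOn V I01)
    (hVpos : ∀ x ∈ I01, 0 < V x) {f : ℝ → ℝ} (hf : ContinuousOn f I01) {u : ℝ → ℝ → ℝ}
    (hu : IsLinearSolution V f ⊤ u) {t : ℝ} (ht : 0 ≤ t) : EqOn (u t) (heat μ e t f) I01 := by
  obtain ⟨G, hG0, -, hGd, hGe⟩ := h.exists_eq_mul_heat hV hVpos hf hu continuousOn_const
    (b := t) ⟨ht, EReal.coe_lt_top t⟩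
  have hG : G t = 1 := by
    rw [← hG0]
    refine eq_of_hasDerivWithinAt_zero (fun s hs => ?_) t (right_mem_Icc.2 ht)
    simpa using (hGd s hs).hasDerivWithinAt
  intro x hx
  rw [hGe t (right_mem_Icc.2 ht) hx, hG]
  exact one_mul _

end IsNeumannSpectrum

theorem IsSolution.continuousOn_nonlocal {V : ℝ → ℝ} {N : (ℝ → ℝ) → ℝ} {v₀ : ℝ → ℝ} {T : EReal}
    {v : ℝ → ℝ → ℝ} (hV : ContinuousOn V I01) (h : IsSolution V N v₀ T v) :
    ContinuousOn (fun t => nonlocal V (v t)) (timeSpan T) := by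
  intro t ht
  rw [ContinuousWithinAt, tendsto_iff_norm_sub_tendsto_zero]
  have hlim : Tendsto (fun s => l2norm V * l2norm (v s - v t)) (𝓝[timeSpan T] t) (𝓝 0) := by
    simpa using (h.cont_time t ht).const_mul (l2norm V)
  refine squeeze_zero' (Eventually.of_forall fun _ => norm_nonneg _) ?_ hlim
  filter_upwards [self_mem_nhdsWithin] with s hs
  have h1 := h.cont_space s hs
  have h2 := h.cont_space t ht
  have e1 : nonlocal V (v s) - nonlocal V (v t) = ∫ x in (0 : ℝ)..1, V x * (v s - v t) x := by
    rw [nonlocal, nonlocal, ← integral_sub_I01 (by fun_prop) (by fun_prop)]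
    congr 1
    ext x
    simp only [Pi.sub_apply]
    ring
  rw [e1]
  exact abs_integral_mul_le hV (h1.sub h2)

/-! ### The nonlinear flow -/

/-- The reciprocal of the factor between the nonlinear and the linear flow. -/
noncomputable def flowDenom (μ : ℕ → ℝ) (e : ℕ → ℝ → ℝ) (f : ℝ → ℝ) (t : ℝ) : ℝ :=
  1 + mean (heat μ e t f) - mean f

theorem flowDenom_zero (μ : ℕ → ℝ) (e : ℕ → ℝ → ℝ) (f : ℝ → ℝ) : flowDenom μ e f 0 = 1 := by
  simp [flowDenom, heat_zero]

namespace IsNeumannSpectrum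

variable {V : ℝ → ℝ} {μ : ℕ → ℝ} {e : ℕ → ℝ → ℝ}

theorem hasDerivWithinAt_flowDenom (h : IsNeumannSpectrum V μ e) (hV : ContinuousOn V I01)
    (hVpos : ∀ x ∈ I01, 0 < V x) {f : ℝ → ℝ} (hf : ContinuousOn f I01) {t : ℝ} (ht : 0 ≤ t) :
    HasDerivWithinAt (flowDenom μ e f) (-nonlocal V (heat μ e t f)) (Ici 0) t :=
  ((h.hasDerivWithinAt_mean_heat hV hVpos hf ht).const_add 1).sub_const _

/-- With `r` the reciprocal of `flowDenom` and `u` the heat flow, `r' = r² ∫ V u = r ∫ V (r u)`. -/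
theorem isNonlinearSolution (h : IsNeumannSpectrum V μ e) (hV : ContinuousOn V I01)
    (hVpos : ∀ x ∈ I01, 0 < V x) {f : ℝ → ℝ} (hf : ContinuousOn f I01) {T : EReal} (hT : 0 < T)
    (hden : ∀ t ∈ timeSpan T, 0 < flowDenom μ e f t) :
    IsNonlinearSolution V f T (fun t x => (flowDenom μ e f t)⁻¹ * heat μ e t f x) := by
  refine h.isSolution_mul_heat hV hVpos hf hT (by rw [flowDenom_zero, inv_one]) fun t ht => ?_
  refine (((h.hasDerivWithinAt_flowDenom hV hVpos hf ht.1).mono (timeSpan_subset_Ici T)).inv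
    (hden t ht).ne').congr_deriv ?_
  rw [nonlocal_const_mul]
  have := (hden t ht).ne'
  field_simp

/-- A solution is `G u` with `G` an exponential; `1/G` and `flowDenom` have the same derivative `-∫
V u` and both start at `1`. Positivity of `G` shows that no solution lives past a zero of the
denominator. -/
theorem eqOn_of_isNonlinearSolution (h : IsNeumannSpectrum V μ e) (hV : ContinuousOn V I01)
    (hVpos : ∀ x ∈ I01, 0 < V x) {f : ℝ → ℝ} (hf : ContinuousOn f I01) {T : EReal}
    {v : ℝ → ℝ → ℝ} (hv : IsNonlinearSolution V f T v) {t : ℝ} (ht : t ∈ timeSpan T) :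
    0 < flowDenom μ e f t ∧ EqOn (v t) (fun x => (flowDenom μ e f t)⁻¹ * heat μ e t f x) I01 := by
  obtain ⟨G, hG0, hGpos, hGd, hGe⟩ := h.exists_eq_mul_heat hV hVpos hf hv
    (hv.continuousOn_nonlocal hV) ht
  have hconst := eq_of_hasDerivWithinAt_zero (f := fun s => (G s)⁻¹ - flowDenom μ e f s) (b := t)
    (fun s hs => by
      refine ((hGd s hs).hasDerivWithinAt.inv (hGpos s).ne').sub
        ((h.hasDerivWithinAt_flowDenom hV hVpos hf hs.1).mono Icc_subset_Ici_self)
        |>.congr_deriv ?_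
      rw [nonlocal_congr (hGe s hs), nonlocal_const_mul]
      have := (hGpos s).ne'
      field_simp
      ring) t (right_mem_Icc.2 ht.1)
  simp only [hG0, flowDenom_zero, inv_one, sub_self] at hconst
  have h1 : flowDenom μ e f t = (G t)⁻¹ := by linarith
  refine ⟨by rw [h1]; exact inv_pos.2 (hGpos t), ?_⟩
  rw [h1, inv_inv]
  exact hGe t (right_mem_Icc.2 ht.1)

theorem lifespan_eq (h : IsNeumannSpectrum V μ e) (hV : ContinuousOn V I01)
    (hVpos : ∀ x ∈ I01, 0 < V x) {f : ℝ → ℝ} (hf : ContinuousOn f I01) :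
    lifespan V f = sSup {T : EReal | 0 < T ∧ ∀ t ∈ timeSpan T, 0 < flowDenom μ e f t} := by
  unfold lifespan
  congr 1
  ext T
  exact ⟨fun ⟨v, hv⟩ => ⟨hv.pos, fun t ht => (h.eqOn_of_isNonlinearSolution hV hVpos hf hv ht).1⟩,
    fun ⟨hT, hd⟩ => ⟨_, h.isNonlinearSolution hV hVpos hf hT hd⟩⟩

theorem flowDenom_pos_of_mem (h : IsNeumannSpectrum V μ e) (hV : ContinuousOn V I01)
    (hVpos : ∀ x ∈ I01, 0 < V x) {f : ℝ → ℝ} (hf : ContinuousOn f I01) {t : ℝ}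
    (ht : t ∈ timeSpan (lifespan V f)) : 0 < flowDenom μ e f t := by
  have h2 := ht.2
  rw [h.lifespan_eq hV hVpos hf] at h2
  obtain ⟨T, hT, htT⟩ := lt_sSup_iff.1 h2
  exact hT.2 t ⟨ht.1, htT⟩

theorem lifespan_pos (h : IsNeumannSpectrum V μ e) (hV : ContinuousOn V I01)
    (hVpos : ∀ x ∈ I01, 0 < V x) {f : ℝ → ℝ} (hf : ContinuousOn f I01) : 0 < lifespan V f := by
  have hc : ContinuousWithinAt (flowDenom μ e f) (Ici 0) 0 :=
    (h.hasDerivWithinAt_flowDenom hV hVpos hf le_rfl).continuousWithinAt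
  have hev : ∀ᶠ t in 𝓝[≥] (0 : ℝ), 0 < flowDenom μ e f t :=
    hc.tendsto.eventually_const_lt (by rw [flowDenom_zero]; exact one_pos)
  obtain ⟨b, hb, hbs⟩ := mem_nhdsGE_iff_exists_Ico_subset.1 hev
  have hb0 : (0 : EReal) < b := by exact_mod_cast hb
  rw [h.lifespan_eq hV hVpos hf]
  refine lt_of_lt_of_le hb0 (le_sSup ⟨hb0, fun t ht => hbs ⟨ht.1, ?_⟩⟩)
  exact EReal.coe_lt_coe_iff.1 ht.2

theorem isNonlinearSolution_lifespan (h : IsNeumannSpectrum V μ e) (hV : ContinuousOn V I01)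
    (hVpos : ∀ x ∈ I01, 0 < V x) {f : ℝ → ℝ} (hf : ContinuousOn f I01) :
    IsNonlinearSolution V f (lifespan V f)
      (fun t x => (flowDenom μ e f t)⁻¹ * heat μ e t f x) :=
  h.isNonlinearSolution hV hVpos hf (h.lifespan_pos hV hVpos hf)
    fun _ ht => h.flowDenom_pos_of_mem hV hVpos hf ht

/-- The nonlinear flow is a multiple of the linear flow. -/
theorem eqOn_flow (h : IsNeumannSpectrum V μ e) (hV : ContinuousOn V I01)
    (hVpos : ∀ x ∈ I01, 0 < V x) {f : ℝ → ℝ} (hf : ContinuousOn f I01) {t : ℝ}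
    (ht : t ∈ timeSpan (lifespan V f)) :
    EqOn (flow V t f) (fun x => (flowDenom μ e f t)⁻¹ * heat μ e t f x) I01 := by
  have hex : ∃ (v : ℝ → ℝ → ℝ) (T : EReal), (t : EReal) < T ∧ IsNonlinearSolution V f T v :=
    ⟨_, _, ht.2, h.isNonlinearSolution_lifespan hV hVpos hf⟩
  -- The definition of `flow` picks an arbitrary solution; uniqueness makes the choice irrelevant on
  -- `[0,1]`.
  obtain ⟨T, htT, hs⟩ := hex.choose_spec
  rw [flow, dif_pos hex]
  exact (h.eqOn_of_isNonlinearSolution hV hVpos hf hs ⟨ht.1, htT⟩).2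

theorem mean_flow (h : IsNeumannSpectrum V μ e) (hV : ContinuousOn V I01)
    (hVpos : ∀ x ∈ I01, 0 < V x) {f : ℝ → ℝ} (hf : ContinuousOn f I01) {t : ℝ}
    (ht : t ∈ timeSpan (lifespan V f)) :
    mean (flow V t f) = (flowDenom μ e f t)⁻¹ * mean (heat μ e t f) := by
  rw [mean_congr (h.eqOn_flow hV hVpos hf ht), mean_const_mul]

/-- The flow solves the nonlinear equation up to the maximal life span. -/
theorem isNonlinearSolution_flow (h : IsNeumannSpectrum V μ e) (hV : ContinuousOn V I01)
    (hVpos : ∀ x ∈ I01, 0 < V x) {f : ℝ → ℝ} (hf : ContinuousOn f I01) :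
    IsNonlinearSolution V f (lifespan V f) (fun t => flow V t f) :=
  (h.isNonlinearSolution_lifespan hV hVpos hf).congr (fun _ _ => nonlocal_congr)
    fun _ ht => h.eqOn_flow hV hVpos hf ht

end IsNeumannSpectrum

end HeatFlow

namespace HeatFlow

/-! ### Weak derivatives -/

theorem isWeakDeriv_of_hasDerivWithinAt {f f₁ : ℝ → ℝ}
    (h : ∀ x ∈ I01, HasDerivWithinAt f (f₁ x) I01 x) (hc : ContinuousOn f₁ I01) :
    IsWeakDeriv f f₁ := by
  intro φ hφ _ hs
  have hφ1 : ContDiff ℝ ∞ (deriv φ) := contDiff_infty_iff_deriv.1 hφ |>.2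
  have h0 : φ 0 = 0 := image_eq_zero_of_notMem_tsupport fun h => lt_irrefl _ (hs h).1
  have h1 : φ 1 = 0 := image_eq_zero_of_notMem_tsupport fun h => lt_irrefl _ (hs h).2
  rw [intervalIntegral.integral_mul_deriv_eq_deriv_mul_of_hasDerivWithinAt (u' := f₁)
    (by rw [uIcc_eq_I01]; exact h)
    (fun x _ => (hφ.differentiable (by simp) x).hasDerivAt.hasDerivWithinAt)
    (intervalIntegrable_of_continuousOn hc) (hφ1.continuous.intervalIntegrable _ _), h0, h1]
  ring

theorem memH1_of_hasDerivWithinAt {f f₁ : ℝ → ℝ}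
    (h : ∀ x ∈ I01, HasDerivWithinAt f (f₁ x) I01 x) (hc : ContinuousOn f₁ I01) : MemH1 f :=
  ⟨memLp_of_continuousOn fun x hx => (h x hx).continuousWithinAt, f₁, memLp_of_continuousOn hc,
    isWeakDeriv_of_hasDerivWithinAt h hc⟩

theorem IsWeakDeriv.congr_left {f f' g : ℝ → ℝ} (h : IsWeakDeriv f g) (hf : EqOn f' f I01) :
    IsWeakDeriv f' g := fun φ hφ hc hs => by
  rw [← h φ hφ hc hs]
  exact integral_congr_I01 fun x hx => by simp only [hf hx]

theorem MemH1.congr {f f' : ℝ → ℝ} (h : MemH1 f) (hf : EqOn f' f I01) : MemH1 f' := by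
  obtain ⟨hm, g, hg, hw⟩ := h
  refine ⟨hm.ae_eq ?_, g, hg, hw.congr_left hf⟩
  exact (ae_restrict_iff' measurableSet_Icc).2 (Eventually.of_forall fun x hx => (hf hx).symm)

theorem PPlus_congr {f f' : ℝ → ℝ} (h : f ∈ PPlus) (hf : EqOn f' f I01) : f' ∈ PPlus :=
  ⟨h.1.congr hf, h.2.1.congr hf, fun x hx => by rw [hf hx]; exact h.2.2 x hx⟩

theorem integrable_vol01_of_memLp {g : ℝ → ℝ} (hg : MemLp g 2 vol01) :
    IntegrableOn g I01 := by
  have : IsFiniteMeasure vol01 := by unfold vol01 I01; infer_instance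
  exact hg.integrable (by norm_num)

/-- By the fundamental lemma of the calculus of variations the arbitrary choice in `weakDeriv` does
not affect norms. -/
theorem IsWeakDeriv.ae_eq {f g g' : ℝ → ℝ} (h : IsWeakDeriv f g) (h' : IsWeakDeriv f g')
    (hg : MemLp g 2 vol01) (hg' : MemLp g' 2 vol01) : g =ᵐ[vol01] g' := by
  have hi := integrable_vol01_of_memLp hg
  have hi' := integrable_vol01_of_memLp hg'
  have hint : ∀ {q : ℝ → ℝ}, IntegrableOn q I01 → ∀ φ : ℝ → ℝ, Continuous φ →
      IntervalIntegrable (fun x => q x * φ x) volume 0 1 := fun {q} hq φ hφ =>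
    ((intervalIntegrable_iff_integrableOn_Icc_of_le zero_le_one).2 hq).mul_continuousOn
      hφ.continuousOn
  have hae : ∀ᵐ x ∂volume, x ∈ Ioo (0 : ℝ) 1 → (g x - g' x) = 0 := by
    refine isOpen_Ioo.ae_eq_zero_of_integral_contDiff_smul_eq_zero
      ((hi.sub hi').mono_set Ioo_subset_Icc_self).locallyIntegrableOn fun φ hφ hc hs => ?_
    have h1 : ∫ x, φ x • (g x - g' x) = ∫ x in (0 : ℝ)..1, (g x * φ x - g' x * φ x) := by
      rw [intervalIntegral.integral_of_le zero_le_one, ← integral_Icc_eq_integral_Ioc,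
        setIntegral_eq_integral_of_forall_compl_eq_zero]
      · congr 1
        ext x
        rw [smul_eq_mul]
        ring
      · intro x hx
        rw [image_eq_zero_of_notMem_tsupport fun h => hx (Ioo_subset_Icc_self (hs h))]
        ring
    rw [h1, intervalIntegral.integral_sub (hint hi φ hφ.continuous) (hint hi' φ hφ.continuous)]
    have h2 := h φ hφ hc hs
    have h3 := h' φ hφ hc hs
    linarith
  have : vol01 = volume.restrict (Ioo (0 : ℝ) 1) := restrict_Ioo_eq_restrict_Icc.symm
  rw [this, EventuallyEq, ae_restrict_iff' measurableSet_Ioo]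
  filter_upwards [hae] with x hx h0
  exact sub_eq_zero.1 (hx h0)

theorem l2norm_congr_ae {f g : ℝ → ℝ} (h : f =ᵐ[vol01] g) : l2norm f = l2norm g := by
  unfold l2norm
  congr 1
  rw [intervalIntegral.integral_of_le zero_le_one, intervalIntegral.integral_of_le zero_le_one,
    ← integral_Icc_eq_integral_Ioc, ← integral_Icc_eq_integral_Ioc]
  refine integral_congr_ae ?_
  filter_upwards [h] with x hx
  rw [hx]

theorem l2norm_congr {f g : ℝ → ℝ} (h : EqOn f g I01) : l2norm f = l2norm g := by
  unfold l2norm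
  congr 1
  exact integral_congr_I01 fun x hx => by simp only [h hx]

/-- The `H¹` norm of a continuously differentiable function. -/
theorem h1norm_of_hasDerivWithinAt {f f₁ : ℝ → ℝ}
    (h : ∀ x ∈ I01, HasDerivWithinAt f (f₁ x) I01 x) (hc : ContinuousOn f₁ I01) :
    h1norm f = Real.sqrt (l2norm f ^ 2 + l2norm f₁ ^ 2) := by
  have hex : ∃ g : ℝ → ℝ, MemLp g 2 vol01 ∧ IsWeakDeriv f g :=
    ⟨f₁, memLp_of_continuousOn hc, isWeakDeriv_of_hasDerivWithinAt h hc⟩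
  have hw : weakDeriv f = hex.choose := dif_pos hex
  have := hex.choose_spec
  rw [h1norm, hw, l2norm_congr_ae (this.2.ae_eq (isWeakDeriv_of_hasDerivWithinAt h hc) this.1
    (memLp_of_continuousOn hc))]

open Classical in
theorem h1norm_congr {f g : ℝ → ℝ} (h : EqOn f g I01) : h1norm f = h1norm g := by
  have hw : IsWeakDeriv f = IsWeakDeriv g := by
    ext q
    exact ⟨fun hq => hq.congr_left h.symm, fun hq => hq.congr_left h⟩
  have hwd : weakDeriv f = weakDeriv g := by
    -- The selected derivative depends only on the predicate, so equal predicates give the same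
    -- selection.
    have key : ∀ W W' : (ℝ → ℝ) → Prop, W = W' →
        (if h : ∃ q : ℝ → ℝ, MemLp q 2 vol01 ∧ W q then h.choose else 0)
          = if h : ∃ q : ℝ → ℝ, MemLp q 2 vol01 ∧ W' q then h.choose else 0 := by
      rintro W _ rfl
      rfl
    exact key _ _ hw
  rw [h1norm, h1norm, hwd, l2norm_congr h]

theorem l2norm_le_h1norm (f : ℝ → ℝ) : l2norm f ≤ h1norm f :=
  Real.le_sqrt_of_sq_le (le_add_of_nonneg_right (sq_nonneg _))

theorem l2norm_le_of_abs_le {f : ℝ → ℝ} (hf : ContinuousOn f I01) {b : ℝ} (hb : 0 ≤ b)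
    (h : ∀ x ∈ I01, |f x| ≤ b) : l2norm f ≤ b := by
  refine Real.sqrt_le_iff.2 ⟨hb, ?_⟩
  have := integral_mono_I01 (f := fun x => f x ^ 2) (g := fun _ => b ^ 2) (hf.pow 2)
    continuousOn_const fun x hx => by
    rw [← sq_abs]
    exact pow_le_pow_left₀ (abs_nonneg _) (h x hx) 2
  simpa using this

/-- The `H¹` norm is controlled by the `C¹` norm. -/
theorem h1norm_le_of_abs_le {f f₁ : ℝ → ℝ} (h : ∀ x ∈ I01, HasDerivWithinAt f (f₁ x) I01 x)
    (hc : ContinuousOn f₁ I01) {b : ℝ} (hb : 0 ≤ b) (hf : ∀ x ∈ I01, |f x| ≤ b)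
    (hf₁ : ∀ x ∈ I01, |f₁ x| ≤ b) : h1norm f ≤ 2 * b := by
  rw [h1norm_of_hasDerivWithinAt h hc]
  have h1 := l2norm_le_of_abs_le (fun x hx => (h x hx).continuousWithinAt) hb hf
  have h2 := l2norm_le_of_abs_le hc hb hf₁
  refine Real.sqrt_le_iff.2 ⟨by positivity, ?_⟩
  have h3 := pow_le_pow_left₀ (l2norm_nonneg _) h1 2
  have h4 := pow_le_pow_left₀ (l2norm_nonneg _) h2 2
  nlinarith

/-! ### Properties of the nonlinear flow -/

theorem le_sSup_image {V : ℝ → ℝ} (hV : ContinuousOn V I01) :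
    ∀ x ∈ I01, V x ≤ sSup (V '' I01) := fun x hx =>
  le_csSup (isCompact_I01.image_of_continuousOn hV).bddAbove ⟨x, hx, rfl⟩

theorem sInf_image_le {f : ℝ → ℝ} (hf : ContinuousOn f I01) :
    ∀ x ∈ I01, sInf (f '' I01) ≤ f x := fun x hx =>
  csInf_le (isCompact_I01.image_of_continuousOn hf).bddBelow ⟨x, hx, rfl⟩

namespace IsNeumannSpectrum

variable {V : ℝ → ℝ} {μ : ℕ → ℝ} {e : ℕ → ℝ → ℝ}

theorem flowDenom_le_one (h : IsNeumannSpectrum V μ e) (hV : ContinuousOn V I01)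
    (hVpos : ∀ x ∈ I01, 0 < V x) {f : ℝ → ℝ} (hf : f ∈ PPlus) {t : ℝ} (ht : 0 ≤ t) :
    flowDenom μ e f t ≤ 1 := by
  have := (h.strictAntiOn_mean_heat hV hVpos hf.2.1 hf.2.2).antitoneOn self_mem_Ici
    (mem_Ici.2 ht) ht
  simp only [heat_zero] at this
  unfold flowDenom
  linarith

theorem strictAntiOn_flowDenom (h : IsNeumannSpectrum V μ e) (hV : ContinuousOn V I01)
    (hVpos : ∀ x ∈ I01, 0 < V x) {f : ℝ → ℝ} (hf : f ∈ PPlus) :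
    StrictAntiOn (flowDenom μ e f) (Ici 0) := fun s hs t ht hst => by
  have := h.strictAntiOn_mean_heat hV hVpos hf.2.1 hf.2.2 hs ht hst
  simp only at this
  unfold flowDenom
  linarith

theorem flow_classical (h : IsNeumannSpectrum V μ e) (hV : ContDiffOn ℝ ∞ V I01)
    (hVpos : ∀ x ∈ I01, 0 < V x) {f : ℝ → ℝ} (hf : f ∈ PPlus) {t : ℝ}
    (ht : t ∈ timeSpan (lifespan V f)) (h0 : 0 < t) :
    ContDiffOn ℝ ∞ (flow V t f) I01 ∧ D (flow V t f) 0 = 0 ∧ D (flow V t f) 1 = 0 ∧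
      ∀ x ∈ I01, HasDerivAt (fun s => flow V s f x)
        (D (D (flow V t f)) x - V x * flow V t f x
          + (∫ y in (0 : ℝ)..1, V y * flow V t f y) * flow V t f x) t := by
  have hVc := hV.continuousOn
  have hfc := hf.2.1
  have heq := h.eqOn_flow hVc hVpos hfc ht
  have hN0 := h.heat_neumann hVc hVpos hfc h0
  have hN := (hN0.const_mul (flowDenom μ e f t)⁻¹).congr heq (fun _ _ => rfl) (fun _ _ => rfl)
  refine ⟨?_, ?_, ?_, fun x hx => ?_⟩
  · refine ContDiffOn.congr ?_ heq
    rw [heat_of_pos h0]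
    exact contDiffOn_const.mul (h.expansion_contDiffOn hV hVpos (h.rapidDecay hVc hVpos hfc h0))
  · rw [hN.D_eq zero_mem_I01]; exact hN.left
  · rw [hN.D_eq one_mem_I01]; exact hN.right
  · have hden := h.flowDenom_pos_of_mem hVc hVpos hfc ht
    have hd1 := ((h.hasDerivWithinAt_flowDenom hVc hVpos hfc ht.1).hasDerivAt
      (Ici_mem_nhds h0)).inv hden.ne'
    have hd2 := hd1.mul (h.hasDerivAt_heat hVc hVpos hfc h0 x hx)
    have hev : (fun s => flow V s f x)
        =ᶠ[𝓝 t] fun s => (flowDenom μ e f s)⁻¹ * heat μ e s f x := by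
      filter_upwards [timeSpan_mem_nhds ht h0] with s hs
      exact h.eqOn_flow hVc hVpos hfc hs hx
    refine (hd2.congr_of_eventuallyEq hev).congr_deriv ?_
    have e1 : ∫ y in (0 : ℝ)..1, V y * flow V t f y
        = (flowDenom μ e f t)⁻¹ * nonlocal V (heat μ e t f) := by
      rw [← nonlocal_const_mul]
      exact nonlocal_congr heq
    rw [e1, hN.DD_eq hx, hN0.DD_eq hx, heq hx]
    simp only [Pi.inv_apply]
    generalize expansion e (fun n => μ n * (Real.exp (-μ n * t) * coeff (e n) f)) x = E
    have := hden.ne'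
    field_simp
    ring

theorem flow_mem_PPlus (h : IsNeumannSpectrum V μ e) (hV : ContinuousOn V I01)
    (hVpos : ∀ x ∈ I01, 0 < V x) {f : ℝ → ℝ} (hf : f ∈ PPlus) {t : ℝ}
    (ht : t ∈ timeSpan (lifespan V f)) : flow V t f ∈ PPlus := by
  have hfc := hf.2.1
  have heq := h.eqOn_flow hV hVpos hfc ht
  have hden := h.flowDenom_pos_of_mem hV hVpos hfc ht
  rcases eq_or_lt_of_le ht.1 with rfl | h0
  · refine PPlus_congr hf fun x hx => ?_
    simp only [heq hx, flowDenom_zero, heat_zero, inv_one, one_mul]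
  · have hN := (h.heat_neumann hV hVpos hfc h0).const_mul (flowDenom μ e f t)⁻¹
    refine PPlus_congr ⟨memH1_of_hasDerivWithinAt hN.d1 hN.cont1, hN.cont, fun x hx => ?_⟩ heq
    exact mul_pos (inv_pos.2 hden) (h.heat_pos hV hVpos hfc hf.2.2 ht.1 x hx)

/-- The denominator is at most one, so the nonlinear flow lies above the linear one. -/
theorem flow_lower_bound (h : IsNeumannSpectrum V μ e) (hV : ContinuousOn V I01)
    (hVpos : ∀ x ∈ I01, 0 < V x) {f : ℝ → ℝ} (hf : f ∈ PPlus) {t : ℝ}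
    (ht : t ∈ timeSpan (lifespan V f)) :
    ∀ x ∈ I01, Real.exp (-t * sSup (V '' I01)) * sInf (f '' I01) ≤ flow V t f x := by
  intro x hx
  have hfc := hf.2.1
  have hden := h.flowDenom_pos_of_mem hV hVpos hfc ht
  have hm : 0 ≤ sInf (f '' I01) := Real.sInf_nonneg fun y ⟨x, hx, hxy⟩ => by
    rw [← hxy]; exact (hf.2.2 x hx).le
  have h1 := h.heat_lower_bound hV hVpos (le_sSup_image hV) hfc hm (sInf_image_le hfc) ht.1 x hx
  have h2 : 1 ≤ (flowDenom μ e f t)⁻¹ :=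
    (one_le_inv₀ hden).2 (h.flowDenom_le_one hV hVpos hf ht.1)
  have e1 : -t * sSup (V '' I01) = -sSup (V '' I01) * t := by ring
  rw [h.eqOn_flow hV hVpos hfc ht hx, e1]
  exact h1.trans (le_mul_of_one_le_left (h.heat_pos hV hVpos hfc hf.2.2 ht.1 x hx).le h2)

/-! ### The spatial mean, global existence and the growth bound. -/

theorem hasDerivWithinAt_mean_flow (h : IsNeumannSpectrum V μ e) (hV : ContinuousOn V I01)
    (hVpos : ∀ x ∈ I01, 0 < V x) {f : ℝ → ℝ} (hf : f ∈ PPlus) {t : ℝ}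
    (ht : t ∈ timeSpan (lifespan V f)) :
    HasDerivWithinAt (fun s => mean (flow V s f) - 1)
      ((∫ x in (0 : ℝ)..1, V x * flow V t f x) * (mean (flow V t f) - 1))
      (timeSpan (lifespan V f)) t := by
  have hs := h.isNonlinearSolution_flow hV hVpos hf.2.1
  have hN := NeumannC2.const 1
  have h1 := hs.weak (fun _ => 1) hN.contDiffOn (by rw [hN.D_eq zero_mem_I01])
    (by rw [hN.D_eq one_mem_I01]) t ht
  simp_rw [← mean_eq_integral_mul_one] at h1
  refine (h1.sub_const 1).congr_deriv ?_
  have e1 : ∫ x in (0 : ℝ)..1, flow V t f x * (D (D fun _ => 1) x - V x * 1)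
      = -nonlocal V (flow V t f) := by
    rw [nonlocal, ← intervalIntegral.integral_neg]
    refine integral_congr_I01 fun x hx => ?_
    simp only [hN.DD_eq hx]
    ring
  rw [e1]
  unfold nonlocal
  ring

/-- The linear mean equals the denominator plus `mean f - 1`. The sign and monotonicity of the mean
minus one are thus read off from a decreasing positive denominator. -/
theorem mean_flow_sub_one (h : IsNeumannSpectrum V μ e) (hV : ContinuousOn V I01)
    (hVpos : ∀ x ∈ I01, 0 < V x) {f : ℝ → ℝ} (hf : f ∈ PPlus) {t : ℝ}
    (ht : t ∈ timeSpan (lifespan V f)) :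
    mean (flow V t f) = 1 + (mean f - 1) * (flowDenom μ e f t)⁻¹ := by
  have hden := h.flowDenom_pos_of_mem hV hVpos hf.2.1 ht
  rw [h.mean_flow hV hVpos hf.2.1 ht]
  have e1 : mean (heat μ e t f) = flowDenom μ e f t + (mean f - 1) := by
    unfold flowDenom; ring
  rw [e1]
  have := hden.ne'
  field_simp

theorem strictMonoOn_inv_flowDenom (h : IsNeumannSpectrum V μ e) (hV : ContinuousOn V I01)
    (hVpos : ∀ x ∈ I01, 0 < V x) {f : ℝ → ℝ} (hf : f ∈ PPlus) :
    StrictMonoOn (fun t => (flowDenom μ e f t)⁻¹) (timeSpan (lifespan V f)) :=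
  fun _ hs _ ht hst => inv_strictAnti₀ (h.flowDenom_pos_of_mem hV hVpos hf.2.1 ht)
    (h.strictAntiOn_flowDenom hV hVpos hf hs.1 ht.1 hst)

theorem mean_flow_of_one_lt (h : IsNeumannSpectrum V μ e) (hV : ContinuousOn V I01)
    (hVpos : ∀ x ∈ I01, 0 < V x) {f : ℝ → ℝ} (hf : f ∈ PPlus) (h1 : 1 < mean f) :
    (∀ t ∈ timeSpan (lifespan V f), 1 < mean (flow V t f)) ∧
      StrictMonoOn (fun t => mean (flow V t f)) (timeSpan (lifespan V f)) := by
  refine ⟨fun t ht => ?_, fun s hs t ht hst => ?_⟩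
  · have hden := h.flowDenom_pos_of_mem hV hVpos hf.2.1 ht
    rw [h.mean_flow_sub_one hV hVpos hf ht]
    linarith [mul_pos (sub_pos.2 h1) (inv_pos.2 hden)]
  · simp only [h.mean_flow_sub_one hV hVpos hf hs, h.mean_flow_sub_one hV hVpos hf ht]
    have := mul_lt_mul_of_pos_left (h.strictMonoOn_inv_flowDenom hV hVpos hf hs ht hst)
      (sub_pos.2 h1)
    simpa using this

theorem mean_flow_of_lt_one (h : IsNeumannSpectrum V μ e) (hV : ContinuousOn V I01)
    (hVpos : ∀ x ∈ I01, 0 < V x) {f : ℝ → ℝ} (hf : f ∈ PPlus) (h1 : mean f < 1) :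
    (∀ t ∈ timeSpan (lifespan V f),
      mean f * Real.exp (-t * sSup (V '' I01)) ≤ mean (flow V t f) ∧ mean (flow V t f) < 1) ∧
      StrictAntiOn (fun t => mean (flow V t f)) (timeSpan (lifespan V f)) := by
  refine ⟨fun t ht => ⟨?_, ?_⟩, fun s hs t ht hst => ?_⟩
  · have hden := h.flowDenom_pos_of_mem hV hVpos hf.2.1 ht
    have h2 : 1 ≤ (flowDenom μ e f t)⁻¹ :=
      (one_le_inv₀ hden).2 (h.flowDenom_le_one hV hVpos hf ht.1)
    rw [h.mean_flow hV hVpos hf.2.1 ht]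
    exact (h.mean_heat_lower_bound hV hVpos (le_sSup_image hV) hf.2.1 hf.2.2 ht.1).trans
      (le_mul_of_one_le_left (h.mean_heat_pos hV hVpos hf.2.1 hf.2.2 ht.1).le h2)
  · have hden := h.flowDenom_pos_of_mem hV hVpos hf.2.1 ht
    rw [h.mean_flow_sub_one hV hVpos hf ht]
    linarith [mul_neg_of_neg_of_pos (sub_neg.2 h1) (inv_pos.2 hden)]
  · simp only [h.mean_flow_sub_one hV hVpos hf hs, h.mean_flow_sub_one hV hVpos hf ht]
    have := mul_lt_mul_of_neg_left (h.strictMonoOn_inv_flowDenom hV hVpos hf hs ht hst)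
      (sub_neg.2 h1)
    simpa using this

theorem lifespan_eq_top (h : IsNeumannSpectrum V μ e) (hV : ContinuousOn V I01)
    (hVpos : ∀ x ∈ I01, 0 < V x) {f : ℝ → ℝ} (hf : f ∈ PPlus) (h1 : mean f ≤ 1) :
    lifespan V f = ⊤ := by
  rw [h.lifespan_eq hV hVpos hf.2.1, eq_top_iff]
  refine le_sSup ⟨EReal.zero_lt_top, fun t ht => ?_⟩
  have := h.mean_heat_pos hV hVpos hf.2.1 hf.2.2 ht.1
  unfold flowDenom
  linarith

theorem l2norm_flow_le (h : IsNeumannSpectrum V μ e) (hV : ContinuousOn V I01)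
    (hVpos : ∀ x ∈ I01, 0 < V x) {f : ℝ → ℝ} (hf : f ∈ PPlus) (h1 : mean f ≤ 1) {t : ℝ}
    (ht : 0 ≤ t) : l2norm (flow V t f) ≤ Real.exp (t * sSup (V '' I01)) * l2norm f := by
  have hmem : t ∈ timeSpan (lifespan V f) := by
    rw [h.lifespan_eq_top hV hVpos hf h1, timeSpan_top]; exact ht
  have hden := h.flowDenom_pos_of_mem hV hVpos hf.2.1 hmem
  set M := sSup (V '' I01) with hM
  have hM0 : 0 ≤ M := (hVpos 0 zero_mem_I01).le.trans (le_sSup_image hV 0 zero_mem_I01)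
  have hlow := h.mean_heat_lower_bound hV hVpos (le_sSup_image hV) hf.2.1 hf.2.2 ht
  rw [← hM] at hlow
  have hexp : Real.exp (-t * M) ≤ 1 := Real.exp_le_one_iff.2 (by nlinarith)
  -- With `m = mean f ≤ 1`, the denominator is at least `(1 - m) + m exp (-t M)`, a convex
  -- combination of `1` and `exp (-t M)`.
  have hd : Real.exp (-t * M) ≤ flowDenom μ e f t := by
    unfold flowDenom
    nlinarith
  have hinv : (flowDenom μ e f t)⁻¹ ≤ Real.exp (t * M) := by
    have := inv_anti₀ (Real.exp_pos _) hd
    rwa [← Real.exp_neg, neg_mul, neg_neg] at this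
  have hl : l2norm (flow V t f) = (flowDenom μ e f t)⁻¹ * l2norm (heat μ e t f) := by
    rw [l2norm_congr (h.eqOn_flow hV hVpos hf.2.1 hmem), l2norm, l2norm]
    simp_rw [mul_pow]
    rw [intervalIntegral.integral_const_mul, Real.sqrt_mul (sq_nonneg _),
      Real.sqrt_sq (inv_pos.2 hden).le]
  rw [hl]
  refine mul_le_mul hinv ?_ (l2norm_nonneg _) (Real.exp_pos _).le
  refine (h.l2norm_heat_le hV hVpos hf.2.1 ht).trans
    (mul_le_of_le_one_left (l2norm_nonneg _) (Real.exp_le_one_iff.2 ?_))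
  have := h.eigenvalue_pos hV hVpos 0
  nlinarith

/-! ### The flow on `P₁`, reduction to it, and blow-up. -/

theorem mem_timeSpan_of_POne (h : IsNeumannSpectrum V μ e) (hV : ContinuousOn V I01)
    (hVpos : ∀ x ∈ I01, 0 < V x) {f : ℝ → ℝ} (hf : f ∈ POne) {t : ℝ} (ht : 0 ≤ t) :
    t ∈ timeSpan (lifespan V f) := by
  rw [h.lifespan_eq_top hV hVpos hf.1 hf.2.le, timeSpan_top]; exact ht

/-- On `P₁` the nonlinear flow is the normalised linear flow. -/
theorem eqOn_flow_of_POne (h : IsNeumannSpectrum V μ e) (hV : ContinuousOn V I01)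
    (hVpos : ∀ x ∈ I01, 0 < V x) {f : ℝ → ℝ} (hf : f ∈ POne) {t : ℝ} (ht : 0 ≤ t) :
    EqOn (flow V t f) (fun x => heat μ e t f x / mean (heat μ e t f)) I01 := by
  intro x hx
  have e1 : flowDenom μ e f t = mean (heat μ e t f) := by
    rw [flowDenom, hf.2]; ring
  rw [h.eqOn_flow hV hVpos hf.1.2.1 (h.mem_timeSpan_of_POne hV hVpos hf ht) hx, e1]
  simp only
  rw [div_eq_inv_mul]

theorem mean_flow_of_POne (h : IsNeumannSpectrum V μ e) (hV : ContinuousOn V I01)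
    (hVpos : ∀ x ∈ I01, 0 < V x) {f : ℝ → ℝ} (hf : f ∈ PPlus) (h1 : mean f = 1) {t : ℝ}
    (ht : t ∈ timeSpan (lifespan V f)) : mean (flow V t f) = 1 := by
  rw [h.mean_flow_sub_one hV hVpos hf ht, h1]; ring

theorem flow_mem_POne (h : IsNeumannSpectrum V μ e) (hV : ContinuousOn V I01)
    (hVpos : ∀ x ∈ I01, 0 < V x) {f : ℝ → ℝ} (hf : f ∈ POne) {t : ℝ} (ht : 0 ≤ t) :
    flow V t f ∈ POne :=
  have hm := h.mem_timeSpan_of_POne hV hVpos hf ht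
  ⟨h.flow_mem_PPlus hV hVpos hf.1 hm, h.mean_flow_of_POne hV hVpos hf.1 hf.2 hm⟩

theorem coeff_flow (h : IsNeumannSpectrum V μ e) (hV : ContinuousOn V I01)
    (hVpos : ∀ x ∈ I01, 0 < V x) {f : ℝ → ℝ} (hf : f ∈ POne) {t : ℝ} (ht : 0 ≤ t) (n : ℕ) :
    coeff (e n) (flow V t f)
      = Real.exp (-μ n * t) * coeff (e n) f / mean (heat μ e t f) := by
  rw [coeff_congr (h.eqOn_flow_of_POne hV hVpos hf ht)]
  simp_rw [div_eq_inv_mul]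
  rw [coeff_const_mul, h.coeff_heat hV hVpos hf.1.2.1 ht]

/-- The linear semigroup law, read on coefficients, up to the normalising factor at time `s`; that
factor cancels in the next normalisation. -/
theorem heat_flow (h : IsNeumannSpectrum V μ e) (hV : ContinuousOn V I01)
    (hVpos : ∀ x ∈ I01, 0 < V x) {f : ℝ → ℝ} (hf : f ∈ POne) {s t : ℝ} (hs : 0 ≤ s)
    (ht : 0 ≤ t) :
    EqOn (heat μ e t (flow V s f))
      (fun x => (mean (heat μ e s f))⁻¹ * heat μ e (s + t) f x) I01 := by
  have hc := (h.flow_mem_POne hV hVpos hf hs).1.2.1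
  refine h.eqOn_of_coeff (h.heat_cont hV hVpos hc t)
    (continuousOn_const.mul (h.heat_cont hV hVpos hf.1.2.1 (s + t))) fun n => ?_
  rw [coeff_const_mul, h.coeff_heat hV hVpos hc ht, h.coeff_flow hV hVpos hf hs,
    h.coeff_heat hV hVpos hf.1.2.1 (add_nonneg hs ht), mul_add, Real.exp_add]
  ring

theorem flow_add (h : IsNeumannSpectrum V μ e) (hV : ContinuousOn V I01)
    (hVpos : ∀ x ∈ I01, 0 < V x) {f : ℝ → ℝ} (hf : f ∈ POne) {s t : ℝ} (hs : 0 ≤ s)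
    (ht : 0 ≤ t) : EqOn (flow V (s + t) f) (flow V t (flow V s f)) I01 := by
  have hst := h.heat_flow hV hVpos hf hs ht
  intro x hx
  rw [h.eqOn_flow_of_POne hV hVpos hf (add_nonneg hs ht) hx,
    h.eqOn_flow_of_POne hV hVpos (h.flow_mem_POne hV hVpos hf hs) ht hx]
  simp only
  rw [mean_congr hst, hst hx, mean_const_mul]
  have h1 := (h.mean_heat_pos hV hVpos hf.1.2.1 hf.1.2.2 hs).ne'
  have h2 := (h.mean_heat_pos hV hVpos hf.1.2.1 hf.1.2.2 (add_nonneg hs ht)).ne'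
  field_simp

theorem mean_pos_of_PPlus {f : ℝ → ℝ} (hf : f ∈ PPlus) : 0 < mean f :=
  integral_pos_I01 hf.2.1 fun x hx => hf.2.2 x (Ioo_subset_Icc_self hx)

end IsNeumannSpectrum

theorem MemH1.const_mul {f : ℝ → ℝ} (h : MemH1 f) (a : ℝ) : MemH1 (fun x => a * f x) := by
  obtain ⟨hm, g, hg, hw⟩ := h
  refine ⟨hm.const_mul a, fun x => a * g x, hg.const_mul a, fun φ hφ hc hs => ?_⟩
  have := hw φ hφ hc hs
  simp_rw [mul_assoc]
  rw [intervalIntegral.integral_const_mul, intervalIntegral.integral_const_mul, this]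
  ring

theorem div_mean_mem_POne {f : ℝ → ℝ} (hf : f ∈ PPlus) : (fun y => f y / mean f) ∈ POne := by
  have hm := IsNeumannSpectrum.mean_pos_of_PPlus hf
  simp_rw [div_eq_inv_mul]
  refine ⟨⟨hf.1.const_mul _, continuousOn_const.mul hf.2.1, fun x hx =>
    mul_pos (inv_pos.2 hm) (hf.2.2 x hx)⟩, ?_⟩
  rw [mean_const_mul, inv_mul_cancel₀ hm.ne']

namespace IsNeumannSpectrum

variable {V : ℝ → ℝ} {μ : ℕ → ℝ} {e : ℕ → ℝ → ℝ}

/-- Both flows have the shape of the linear flow, which is homogeneous in the datum; dividing by the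
mean removes the scale. -/
theorem flow_eq_mean_mul_flow (h : IsNeumannSpectrum V μ e) (hV : ContinuousOn V I01)
    (hVpos : ∀ x ∈ I01, 0 < V x) {f : ℝ → ℝ} (hf : f ∈ PPlus) {t : ℝ}
    (ht : t ∈ timeSpan (lifespan V f)) :
    ∀ x ∈ I01, flow V t f x = mean (flow V t f) * flow V t (fun y => f y / mean f) x := by
  intro x hx
  have hm := mean_pos_of_PPlus hf
  have h1 := div_mean_mem_POne hf
  have heq : EqOn (heat μ e t fun y => f y / mean f) (fun x => (mean f)⁻¹ * heat μ e t f x)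
      I01 := by
    refine h.eqOn_of_coeff (h.heat_cont hV hVpos h1.1.2.1 t)
      (continuousOn_const.mul (h.heat_cont hV hVpos hf.2.1 t)) fun n => ?_
    rw [coeff_const_mul, h.coeff_heat hV hVpos h1.1.2.1 ht.1, h.coeff_heat hV hVpos hf.2.1 ht.1]
    simp_rw [div_eq_inv_mul]
    rw [coeff_const_mul]
    ring
  rw [h.eqOn_flow_of_POne hV hVpos h1 ht.1 hx, h.mean_flow hV hVpos hf.2.1 ht,
    h.eqOn_flow hV hVpos hf.2.1 ht hx]
  simp only
  rw [mean_congr heq, heq hx, mean_const_mul]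
  have h2 := (h.mean_heat_pos hV hVpos hf.2.1 hf.2.2 ht.1).ne'
  have h3 := hm.ne'
  field_simp

/-- The denominator decreases strictly from `1` and is eventually negative, as the linear mean
decays to zero. Its zero is the life span. The linear flow is positive and continuous in time there,
so every point blows up together. -/
theorem blow_up (h : IsNeumannSpectrum V μ e) (hV : ContinuousOn V I01)
    (hVpos : ∀ x ∈ I01, 0 < V x) {f : ℝ → ℝ} (hf : f ∈ PPlus) (h1 : 1 < mean f) :
    ∃ T : ℝ, 0 < T ∧ lifespan V f = (T : EReal) ∧
      Tendsto (fun t => mean (flow V t f)) (𝓝[<] T) atTop ∧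
      ∀ x ∈ I01, Tendsto (fun t => flow V t f x) (𝓝[<] T) atTop := by
  have hfc := hf.2.1
  have hc : ContinuousOn (flowDenom μ e f) (Ici 0) := fun t ht =>
    (h.hasDerivWithinAt_flowDenom hV hVpos hfc ht).continuousWithinAt
  have hanti := h.strictAntiOn_flowDenom hV hVpos hf
  obtain ⟨b, hb0, hb⟩ : ∃ b, 0 ≤ b ∧ flowDenom μ e f b < 0 := by
    have hlim := h.tendsto_mean_heat hV hVpos hfc
    obtain ⟨b, hb, hb0⟩ := ((hlim.eventually_lt_const (sub_pos.2 h1)).and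
      (eventually_ge_atTop 0)).exists
    exact ⟨b, hb0, by unfold flowDenom; linarith⟩
  obtain ⟨T, hT, hTz⟩ := intermediate_value_Icc' hb0 (hc.mono Icc_subset_Ici_self)
    ⟨hb.le, by rw [flowDenom_zero]; exact zero_le_one⟩
  have hT0 : 0 < T := by
    refine lt_of_le_of_ne hT.1 fun h0 => ?_
    rw [← h0, flowDenom_zero] at hTz
    exact one_ne_zero hTz
  have hlife : lifespan V f = (T : EReal) := by
    refine le_antisymm ?_ ?_
    · by_contra hlt
      have hlt : (T : EReal) < lifespan V f := not_le.1 hlt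
      have := h.flowDenom_pos_of_mem hV hVpos hfc ⟨hT0.le, hlt⟩
      rw [hTz] at this
      exact lt_irrefl _ this
    · rw [h.lifespan_eq hV hVpos hfc]
      refine le_sSup ⟨by exact_mod_cast hT0, fun t ht => ?_⟩
      rw [← hTz]
      exact hanti ht.1 hT0.le (EReal.coe_lt_coe_iff.1 ht.2)
  have hev : ∀ᶠ t in 𝓝[<] T, t ∈ timeSpan (lifespan V f) := by
    filter_upwards [Ico_mem_nhdsLT hT0] with t ht
    rw [hlife]
    exact ⟨ht.1, EReal.coe_lt_coe_iff.2 ht.2⟩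
  -- Convergence from above zero is what makes the reciprocal tend to `+∞`.
  have hdlim : Tendsto (flowDenom μ e f) (𝓝[<] T) (𝓝[>] 0) := by
    rw [tendsto_nhdsWithin_iff]
    refine ⟨?_, ?_⟩
    · rw [← hTz]
      exact ((hc T hT0.le).continuousAt (Ici_mem_nhds hT0)).tendsto.mono_left nhdsWithin_le_nhds
    · filter_upwards [hev] with t ht
      exact h.flowDenom_pos_of_mem hV hVpos hfc ht
  have hinv : Tendsto (fun t => (flowDenom μ e f t)⁻¹) (𝓝[<] T) atTop :=
    tendsto_inv_nhdsGT_zero.comp hdlim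
  refine ⟨T, hT0, hlife, ?_, fun x hx => ?_⟩
  · have h2 : Tendsto (fun t => 1 + (mean f - 1) * (flowDenom μ e f t)⁻¹) (𝓝[<] T) atTop :=
      tendsto_atTop_add_const_left _ _ (hinv.const_mul_atTop (sub_pos.2 h1))
    refine h2.congr' ?_
    filter_upwards [hev] with t ht
    rw [h.mean_flow_sub_one hV hVpos hf ht]
  · have h2 : Tendsto (fun t => heat μ e t f x) (𝓝[<] T) (𝓝 (heat μ e T f x)) :=
      (h.hasDerivAt_heat hV hVpos hfc hT0 x hx).continuousAt.tendsto.mono_left nhdsWithin_le_nhds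
    have h3 := hinv.atTop_mul_pos (h.heat_pos hV hVpos hfc hf.2.2 hT0.le x hx) h2
    refine h3.congr' ?_
    filter_upwards [hev] with t ht
    exact (h.eqOn_flow hV hVpos hfc ht hx).symm

end IsNeumannSpectrum

end HeatFlow

namespace HeatFlow

namespace IsNeumannSpectrum

variable {V : ℝ → ℝ} {μ : ℕ → ℝ} {e : ℕ → ℝ → ℝ}

/-! ### The steady state -/

theorem mean_ground_pos (h : IsNeumannSpectrum V μ e) : 0 < mean (e 0) :=
  integral_pos_I01 (h.cont 0) h.ground_pos

theorem coeff_ground_pos (h : IsNeumannSpectrum V μ e) {f : ℝ → ℝ} (hf : f ∈ PPlus) :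
    0 < coeff (e 0) f :=
  integral_pos_I01 ((h.cont 0).mul hf.2.1) fun x hx =>
    mul_pos (h.ground_pos x hx) (hf.2.2 x (Ioo_subset_Icc_self hx))

theorem coeff_eigenfunction (h : IsNeumannSpectrum V μ e) (m n : ℕ) :
    coeff (e m) (e n) = if m = n then 1 else 0 := h.orthonormal m n

theorem memH1_eigenfunction (h : IsNeumannSpectrum V μ e) (n : ℕ) : MemH1 (e n) :=
  memH1_of_hasDerivWithinAt (h.isEigenFamily.neumann n).d1 (h.isEigenFamily.neumann n).cont1

theorem ground_mem_PPlus (h : IsNeumannSpectrum V μ e) (hV : ContinuousOn V I01) : e 0 ∈ PPlus :=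
  ⟨h.memH1_eigenfunction 0, h.cont 0, h.ground_pos_I01 hV⟩

/-- The eigenvalue equation paired with the constant `1`: the second derivative integrates to zero.
-/
theorem integral_potential_mul_ground (h : IsNeumannSpectrum V μ e) (hV : ContinuousOn V I01) :
    ∫ y in (0 : ℝ)..1, V y * e 0 y = μ 0 * mean (e 0) := by
  have h1 := coeff_operator hV (h.isEigenFamily.neumann 0) (NeumannC2.const 1)
  simp only [coeff, mul_one, sub_zero] at h1
  rw [mean, ← h1]
  simp_rw [mul_comm]

theorem ground_div_mean (h : IsNeumannSpectrum V μ e) (hV : ContinuousOn V I01)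
    (hVpos : ∀ x ∈ I01, 0 < V x) (x : ℝ) :
    e 0 x / mean (e 0) = μ 0 / (∫ y in (0 : ℝ)..1, V y * e 0 y) * e 0 x := by
  have h1 := h.mean_ground_pos.ne'
  have h2 := (h.eigenvalue_pos hV hVpos 0).ne'
  rw [h.integral_potential_mul_ground hV]
  field_simp

theorem coeff_steady (h : IsNeumannSpectrum V μ e) (n : ℕ) :
    coeff (e n) (fun x => e 0 x / mean (e 0)) = if n = 0 then (mean (e 0))⁻¹ else 0 := by
  simp_rw [div_eq_inv_mul]
  rw [coeff_const_mul, h.coeff_eigenfunction]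
  split_ifs <;> simp

theorem flow_steady (h : IsNeumannSpectrum V μ e) (hV : ContinuousOn V I01)
    (hVpos : ∀ x ∈ I01, 0 < V x) {s : ℝ → ℝ} (hs : s ∈ PPlus)
    (hse : EqOn s (fun x => e 0 x / mean (e 0)) I01) {t : ℝ} (ht : 0 ≤ t) :
    EqOn (flow V t s) s I01 := by
  have h1 : mean s = 1 := by
    rw [mean_congr hse]
    exact (div_mean_mem_POne (h.ground_mem_PPlus hV)).2
  have hheat : EqOn (heat μ e t s) (fun x => Real.exp (-μ 0 * t) * s x) I01 := by
    refine h.eqOn_of_coeff (h.heat_cont hV hVpos hs.2.1 t) (continuousOn_const.mul hs.2.1)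
      fun n => ?_
    rw [h.coeff_heat hV hVpos hs.2.1 ht, coeff_const_mul, coeff_congr hse, h.coeff_steady]
    split_ifs with hn
    · rw [hn]
    · simp
  intro x hx
  rw [h.eqOn_flow_of_POne hV hVpos ⟨hs, h1⟩ ht hx]
  simp only
  rw [mean_congr hheat, mean_const_mul, h1, hheat hx, mul_one,
    mul_div_cancel_left₀ _ (Real.exp_pos _).ne']

/-- A steady state is compared with its own flow at time `1` only: each coefficient is multiplied by
`exp (-μ n) / d`. Since the coefficient on `e 0` is positive, `d = exp (-μ 0)`, and the spectral gap
kills all other modes. The mean is then fixed by the definition of `d`. -/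
theorem isSteadyState_iff (h : IsNeumannSpectrum V μ e) (hV : ContinuousOn V I01)
    (hVpos : ∀ x ∈ I01, 0 < V x) {s : ℝ → ℝ} (hs : s ∈ PPlus) :
    IsSteadyState V s ↔ EqOn s (fun x => e 0 x / mean (e 0)) I01 := by
  constructor
  · intro hst
    obtain ⟨hd, he⟩ := h.eqOn_of_isNonlinearSolution hV hVpos hs.2.1 hst (t := 1)
      ⟨zero_le_one, EReal.coe_lt_top 1⟩
    set d := flowDenom μ e s 1 with hdef
    have hc : ∀ n, coeff (e n) s = d⁻¹ * (Real.exp (-μ n) * coeff (e n) s) := fun n => by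
      conv_lhs => rw [coeff_congr he, coeff_const_mul, h.coeff_heat hV hVpos hs.2.1 zero_le_one]
      rw [mul_one]
    have hc0 := h.coeff_ground_pos hs
    have hd0 : d = Real.exp (-μ 0) := by
      have := hc 0
      field_simp at this
      linarith
    have hms : mean s = 1 := by
      have h1 : mean s = d⁻¹ * mean (heat μ e 1 s) := by
        conv_lhs => rw [mean_congr he, mean_const_mul]
      have h2 : mean (heat μ e 1 s) = d * mean s := by
        rw [h1, mul_inv_cancel_left₀ hd.ne']
      have h3 : d = 1 + mean (heat μ e 1 s) - mean s := hdef
      rw [h2] at h3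
      have h4 : d < 1 := by
        rw [hd0]
        simpa using h.eigenvalue_pos hV hVpos 0
      -- Since `d < 1`, the relation `d = 1 + d * mean s - mean s` forces mean one.
      have h5 : (1 - d) * (mean s - 1) = 0 := by linarith
      rcases mul_eq_zero.1 h5 with h6 | h6 <;> linarith
    have hsc : EqOn s (fun x => coeff (e 0) s * e 0 x) I01 := by
      refine h.eqOn_of_coeff hs.2.1 (continuousOn_const.mul (h.cont 0)) fun n => ?_
      rw [coeff_const_mul, h.coeff_eigenfunction]
      split_ifs with hn
      · rw [hn, mul_one]
      · rw [mul_zero]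
        have h1 := hc n
        have h2 : Real.exp (-μ n) < d := by
          rw [hd0]
          exact Real.exp_lt_exp.2 (neg_lt_neg (h.lt_eigenvalue hV hn))
        field_simp at h1
        have h3 : (d - Real.exp (-μ n)) * coeff (e n) s = 0 := by linarith
        exact (mul_eq_zero.1 h3).resolve_left (sub_pos.2 h2).ne'
    have hm : coeff (e 0) s * mean (e 0) = 1 := by
      rw [← mean_const_mul, ← mean_congr hsc, hms]
    intro x hx
    rw [hsc hx]
    simp only
    rw [eq_div_iff h.mean_ground_pos.ne', mul_right_comm, hm, one_mul]
  · intro hse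
    have h1 : mean s = 1 := by
      rw [mean_congr hse]
      exact (div_mean_mem_POne (h.ground_mem_PPlus hV)).2
    have h2 := h.isNonlinearSolution_flow hV hVpos hs.2.1
    rw [h.lifespan_eq_top hV hVpos hs h1.le] at h2
    exact h2.congr (fun _ _ => nonlocal_congr) fun t ht =>
      (h.flow_steady hV hVpos hs hse ht.1).symm

/-! ### Control of the `H¹` norm by eigenfunction coefficients -/

theorem exists_h1norm_bound (h : IsNeumannSpectrum V μ e) (hV : ContinuousOn V I01)
    (hVpos : ∀ x ∈ I01, 0 < V x) :
    ∃ B, 0 < B ∧ ∀ w : ℝ → ℝ, ContinuousOn w I01 → RapidDecay μ (fun n => coeff (e n) w) →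
      (∀ x ∈ I01, |w x| ≤ B * ∑' n, |coeff (e n) w| * μ n ^ 2) ∧
      h1norm w ≤ B * ∑' n, |coeff (e n) w| * μ n ^ 2 := by
  obtain ⟨B, hB, hb⟩ := h.exists_expansion_bound hV hVpos
  refine ⟨2 * B, by positivity, fun w hw ha => ?_⟩
  have hN := h.expansion_neumann hV hVpos ha
  have heq : EqOn w (expansion e fun n => coeff (e n) w) I01 :=
    h.eqOn_of_coeff hw hN.cont fun n => (h.coeff_expansion hV hVpos ha n).symm
  have hS : 0 ≤ B * ∑' n, |coeff (e n) w| * μ n ^ 2 :=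
    mul_nonneg hB.le (tsum_nonneg fun n => by positivity)
  refine ⟨fun x hx => ?_, ?_⟩
  · rw [heq hx]
    exact ((hb _ ha x hx).1).trans (by linarith)
  · rw [h1norm_congr heq, mul_assoc]
    exact h1norm_le_of_abs_le hN.d1 hN.cont1 hS (fun x hx => (hb _ ha x hx).1)
      fun x hx => (hb _ ha x hx).2

theorem rapidDecay_coeff_flow (h : IsNeumannSpectrum V μ e) (hV : ContinuousOn V I01)
    (hVpos : ∀ x ∈ I01, 0 < V x) {f : ℝ → ℝ} (hf : f ∈ POne) {t : ℝ} (ht : 0 < t) :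
    RapidDecay μ (fun n => coeff (e n) (flow V t f)) := fun k => by
  refine ((h.rapidDecay hV hVpos hf.1.2.1 ht k).mul_left |(mean (heat μ e t f))⁻¹|).congr
    fun n => ?_
  simp only [h.coeff_flow hV hVpos hf ht.le, div_eq_inv_mul, abs_mul, mul_assoc]

/-- After rescaling by `exp (μ 0 t)` the gap leaves only the ground mode; the series is dominated by
its absolute values at `t = 0`. -/
theorem tendsto_exp_mul_mean_heat (h : IsNeumannSpectrum V μ e) (hV : ContinuousOn V I01)
    (hVpos : ∀ x ∈ I01, 0 < V x) {f : ℝ → ℝ} (hf : ContinuousOn f I01) :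
    Tendsto (fun t => Real.exp (μ 0 * t) * mean (heat μ e t f)) atTop
      (𝓝 (coeff (e 0) f * mean (e 0))) := by
  have h1c : ContinuousOn (fun _ : ℝ => (1 : ℝ)) I01 := continuousOn_const
  have hterm : ∀ n, Tendsto (fun t => Real.exp (-(μ n - μ 0) * t)
      * (coeff (e n) f * coeff (e n) fun _ => 1)) atTop
      (𝓝 (if n = 0 then coeff (e 0) f * coeff (e 0) (fun _ => 1) else 0)) := fun n => by
    split_ifs with hn
    · rw [hn]; simp
    · rw [← zero_mul (coeff (e n) f * coeff (e n) fun _ => 1)]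
      refine Tendsto.mul_const _ (Real.tendsto_exp_atBot.comp ?_)
      exact tendsto_id.const_mul_atTop_of_neg (neg_lt_zero.2 (sub_pos.2 (h.lt_eigenvalue hV hn)))
  have hlim := tendsto_tsum_of_dominated_convergence (h.hasSum_coeff hf h1c).summable.abs hterm (by
    filter_upwards [eventually_ge_atTop 0] with t ht n
    rw [Real.norm_eq_abs, abs_mul, Real.abs_exp]
    refine mul_le_of_le_one_left (abs_nonneg _) (Real.exp_le_one_iff.2 ?_)
    have := h.mono (Nat.zero_le n)
    nlinarith)
  rw [tsum_ite_eq] at hlim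
  have e1 : coeff (e 0) (fun _ => 1) = mean (e 0) := by
    rw [mean_eq_integral_mul_one]; rfl
  rw [e1] at hlim
  refine hlim.congr' ?_
  filter_upwards [eventually_ge_atTop 0] with t ht
  rw [mean_eq_integral_mul_one, ← (h.hasSum_coeff (h.heat_cont hV hVpos hf t) h1c).tsum_eq,
    ← tsum_mul_left]
  refine tsum_congr fun n => ?_
  rw [h.coeff_heat hV hVpos hf ht, ← mul_assoc, ← mul_assoc, ← mul_assoc, ← Real.exp_add]
  congr 3
  ring

/-- The coefficients of the difference tend to zero one by one. A dominating series, uniform for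
large times, turns this into convergence of the weighted sum that controls both the sup norm and the
`H¹` norm. -/
theorem tendsto_flow (h : IsNeumannSpectrum V μ e) (hV : ContinuousOn V I01)
    (hVpos : ∀ x ∈ I01, 0 < V x) {f : ℝ → ℝ} (hf : f ∈ POne) :
    TendstoUniformlyOn (fun (t : ℝ) (x : ℝ) => flow V t f x)
        (fun x => e 0 x / mean (e 0)) atTop I01 ∧
      Tendsto (fun t : ℝ => h1norm (flow V t f - fun x => e 0 x / mean (e 0))) atTop (𝓝 0) := by
  obtain ⟨B, hB, hb⟩ := h.exists_h1norm_bound hV hVpos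
  have hμ := h.eigenvalue_pos hV hVpos
  have hfc := hf.1.2.1
  have hsc : ContinuousOn (fun x => e 0 x / mean (e 0)) I01 := (h.cont 0).div_const _
  set r : ℝ → ℝ := fun t => (Real.exp (μ 0 * t) * mean (heat μ e t f))⁻¹ with hr
  have hlim0 : 0 < coeff (e 0) f * mean (e 0) :=
    mul_pos (h.coeff_ground_pos hf.1) h.mean_ground_pos
  have hrlim : Tendsto r atTop (𝓝 (coeff (e 0) f * mean (e 0))⁻¹) :=
    (h.tendsto_exp_mul_mean_heat hV hVpos hfc).inv₀ hlim0.ne'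
  set w : ℝ → ℝ → ℝ := fun t => flow V t f - fun x => e 0 x / mean (e 0) with hw
  set a : ℝ → ℕ → ℝ := fun t n => Real.exp (-(μ n - μ 0) * t) * r t * coeff (e n) f
    - if n = 0 then (mean (e 0))⁻¹ else 0 with ha
  have hwa : ∀ t, 0 ≤ t → ∀ n, coeff (e n) (w t) = a t n := fun t ht n => by
    have : w t = fun x => flow V t f x - e 0 x / mean (e 0) := rfl
    rw [this, coeff_sub (h.cont n) (h.flow_mem_POne hV hVpos hf ht).1.2.1 hsc, h.coeff_steady,
      h.coeff_flow hV hVpos hf ht, ha]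
    simp only [hr]
    congr 1
    rw [mul_inv, ← Real.exp_neg, ← mul_assoc, ← Real.exp_add, div_eq_mul_inv, mul_right_comm]
    congr 3
    ring
  have hdelta : ∀ k, Summable fun n => |if n = 0 then (mean (e 0))⁻¹ else 0| * μ n ^ k :=
    fun k => summable_of_ne_finset_zero (s := {0}) fun n hn => by
      rw [if_neg (by simpa using hn)]; simp
  have hdec : ∀ t, 0 < t → RapidDecay μ (fun n => coeff (e n) (w t)) := fun t ht => by
    have e1 : ∀ n, coeff (e n) (w t)
        = coeff (e n) (flow V t f) - if n = 0 then (mean (e 0))⁻¹ else 0 := fun n => by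
      rw [← h.coeff_steady, ← coeff_sub (h.cont n) (h.flow_mem_POne hV hVpos hf ht.le).1.2.1 hsc]
      rfl
    simp_rw [e1]
    exact RapidDecay.sub hμ (h.rapidDecay_coeff_flow hV hVpos hf ht) hdelta
  have hterm : ∀ n, Tendsto (fun t => |a t n| * μ n ^ 2) atTop (𝓝 0) := fun n => by
    suffices Tendsto (fun t => a t n) atTop (𝓝 0) by
      simpa using this.abs.mul_const (μ n ^ 2)
    by_cases hn : n = 0
    · have h1 := (hrlim.mul_const (coeff (e 0) f)).sub_const (mean (e 0))⁻¹
      have e1 : (coeff (e 0) f * mean (e 0))⁻¹ * coeff (e 0) f - (mean (e 0))⁻¹ = 0 := by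
        have := h.mean_ground_pos.ne'
        have := (h.coeff_ground_pos hf.1).ne'
        field_simp
        ring
      rw [e1] at h1
      refine h1.congr fun t => ?_
      simp [ha, hn]
    · have h1 : Tendsto (fun t => Real.exp (-(μ n - μ 0) * t)) atTop (𝓝 0) :=
        Real.tendsto_exp_atBot.comp (tendsto_id.const_mul_atTop_of_neg
          (neg_lt_zero.2 (sub_pos.2 (h.lt_eigenvalue hV hn))))
      have h2 := (h1.mul hrlim).mul_const (coeff (e n) f)
      rw [zero_mul, zero_mul] at h2
      refine h2.congr fun t => ?_
      simp [ha, hn]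
  -- An eventual bound for `r`: its limit plus one.
  set R := (coeff (e 0) f * mean (e 0))⁻¹ + 1 with hR
  have hR0 : 0 < R := by positivity
  have hsum : Summable fun n => R * Real.exp (μ 0) * l2norm f * (μ n ^ 2 * Real.exp (-μ n * 1))
      + |if n = 0 then (mean (e 0))⁻¹ else 0| * μ n ^ 2 :=
    ((h.summable_pow_mul_exp hV hVpos 2 one_pos).mul_left _).add (hdelta 2)
  have hS : Tendsto (fun t => ∑' n, |a t n| * μ n ^ 2) atTop (𝓝 0) := by
    have := tendsto_tsum_of_dominated_convergence hsum hterm (by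
      filter_upwards [eventually_ge_atTop 1, hrlim.abs.eventually_lt_const
        (show |(coeff (e 0) f * mean (e 0))⁻¹| < R by
          rw [abs_of_pos (inv_pos.2 hlim0)]; linarith)] with t ht hrt n
      have hn := h.mono (Nat.zero_le n)
      -- For `t ≥ 1` the relative decay is at least that at time `1`, which gives a summable
      -- majorant independent of `t`.
      have hex : Real.exp (-(μ n - μ 0) * t) ≤ Real.exp (μ 0) * Real.exp (-μ n * 1) := by
        rw [← Real.exp_add]
        exact Real.exp_le_exp.2 (by nlinarith)
      have hl := h.abs_coeff_le hfc n
      have hμn := hμ n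
      rw [Real.norm_eq_abs, abs_mul, abs_abs, abs_of_nonneg (by positivity : 0 ≤ μ n ^ 2)]
      have h1 : |Real.exp (-(μ n - μ 0) * t) * r t * coeff (e n) f|
          ≤ Real.exp (μ 0) * Real.exp (-μ n * 1) * R * l2norm f := by
        rw [abs_mul, abs_mul, Real.abs_exp]
        gcongr
      calc |a t n| * μ n ^ 2 ≤ (Real.exp (μ 0) * Real.exp (-μ n * 1) * R * l2norm f
            + |if n = 0 then (mean (e 0))⁻¹ else 0|) * μ n ^ 2 := by
            refine mul_le_mul_of_nonneg_right ((abs_sub _ _).trans ?_) (by positivity)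
            exact add_le_add_left h1 _
        _ = _ := by ring)
    simpa using this
  have hBS : Tendsto (fun t => B * ∑' n, |a t n| * μ n ^ 2) atTop (𝓝 0) := by
    simpa using hS.const_mul B
  have hkey : ∀ t, 0 < t → (∀ x ∈ I01, |w t x| ≤ B * ∑' n, |a t n| * μ n ^ 2) ∧
      h1norm (w t) ≤ B * ∑' n, |a t n| * μ n ^ 2 := fun t ht => by
    have := hb (w t) ((h.flow_mem_POne hV hVpos hf ht.le).1.2.1.sub hsc) (hdec t ht)
    simp only [hwa t ht.le] at this
    exact this
  refine ⟨?_, ?_⟩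
  · rw [Metric.tendstoUniformlyOn_iff]
    intro ε hε
    filter_upwards [hBS.eventually_lt_const hε, eventually_gt_atTop 0] with t h1 h2 x hx
    rw [dist_comm, Real.dist_eq]
    exact ((hkey t h2).1 x hx).trans_lt h1
  · refine tendsto_of_tendsto_of_tendsto_of_le_of_le' tendsto_const_nhds hBS
      (Eventually.of_forall fun t => Real.sqrt_nonneg _) ?_
    filter_upwards [eventually_gt_atTop 0] with t ht
    exact (hkey t ht).2

end IsNeumannSpectrum

end HeatFlow

namespace HeatFlow

/-! ### Observables -/

/-- The filter of `H¹` neighbourhoods of `f` in `P₁`. -/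
noncomputable def nhdsPOne (f : ℝ → ℝ) : Filter (ℝ → ℝ) :=
  comap (fun g => h1norm (g - f)) (𝓝 0) ⊓ 𝓟 POne

theorem h1norm_nonneg (f : ℝ → ℝ) : 0 ≤ h1norm f := Real.sqrt_nonneg _

theorem isObservable_iff {φ : (ℝ → ℝ) → ℝ} :
    IsObservable φ ↔ ∀ f ∈ POne, Tendsto φ (nhdsPOne f) (𝓝 (φ f)) := by
  refine forall₂_congr fun f _ => ?_
  rw [nhdsPOne, ((Metric.nhds_basis_ball.comap _).inf_principal POne).tendsto_iff
    Metric.nhds_basis_ball]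
  refine forall₂_congr fun ε _ => exists_congr fun δ => and_congr_right fun _ => ?_
  refine ⟨fun h g hg => ?_, fun h g hg hgf => ?_⟩
  · have := h g hg.2 (by
      simpa [Real.dist_eq, abs_of_nonneg (h1norm_nonneg _)] using hg.1)
    rwa [Metric.mem_ball, Real.dist_eq]
  · have := h g ⟨by simpa [Real.dist_eq, abs_of_nonneg (h1norm_nonneg _)] using hgf, hg⟩
    rwa [Metric.mem_ball, Real.dist_eq] at this

theorem eventually_mem_POne (f : ℝ → ℝ) : ∀ᶠ g in nhdsPOne f, g ∈ POne :=
  mem_inf_of_right (mem_principal_self _)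

theorem tendsto_h1norm_sub (f : ℝ → ℝ) :
    Tendsto (fun g => h1norm (g - f)) (nhdsPOne f) (𝓝 0) :=
  tendsto_comap.mono_left inf_le_left

theorem tendsto_l2norm_sub (f : ℝ → ℝ) :
    Tendsto (fun g => l2norm (g - f)) (nhdsPOne f) (𝓝 0) :=
  squeeze_zero (fun _ => l2norm_nonneg _) (fun _ => l2norm_le_h1norm _) (tendsto_h1norm_sub f)

theorem isObservable_coeff {k : ℝ → ℝ} (hk : ContinuousOn k I01) : IsObservable (coeff k) := by
  refine isObservable_iff.2 fun f hf => tendsto_iff_norm_sub_tendsto_zero.2 ?_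
  have hlim : Tendsto (fun g => l2norm k * l2norm (g - f)) (nhdsPOne f) (𝓝 0) := by
    simpa using (tendsto_l2norm_sub f).const_mul (l2norm k)
  refine squeeze_zero' (Eventually.of_forall fun _ => norm_nonneg _) ?_ hlim
  filter_upwards [eventually_mem_POne f] with g hg
  rw [← coeff_sub hk hg.1.2.1 hf.1.2.1]
  exact abs_integral_mul_le hk (hg.1.2.1.sub hf.1.2.1)

namespace IsNeumannSpectrum

variable {V : ℝ → ℝ} {μ : ℕ → ℝ} {e : ℕ → ℝ → ℝ}

/-- Self-adjointness of the semigroup moves it onto the constant `1`; the mean thereby becomes a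
coefficient functional, continuous in the datum. -/
theorem mean_heat_eq_coeff (h : IsNeumannSpectrum V μ e) (hV : ContinuousOn V I01)
    (hVpos : ∀ x ∈ I01, 0 < V x) {f : ℝ → ℝ} (hf : ContinuousOn f I01) {t : ℝ} (ht : 0 ≤ t) :
    mean (heat μ e t f) = coeff (heat μ e t fun _ => 1) f := by
  have h1c : ContinuousOn (fun _ : ℝ => (1 : ℝ)) I01 := continuousOn_const
  rw [mean_eq_integral_mul_one, coeff,
    ← (h.hasSum_coeff (h.heat_cont hV hVpos hf t) h1c).tsum_eq,
    ← (h.hasSum_coeff (h.heat_cont hV hVpos h1c t) hf).tsum_eq]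
  refine tsum_congr fun n => ?_
  rw [h.coeff_heat hV hVpos hf ht, h.coeff_heat hV hVpos h1c ht]
  ring

theorem tendsto_mean_heat_nhdsPOne (h : IsNeumannSpectrum V μ e) (hV : ContinuousOn V I01)
    (hVpos : ∀ x ∈ I01, 0 < V x) {f : ℝ → ℝ} (hf : f ∈ POne) {t : ℝ} (ht : 0 ≤ t) :
    Tendsto (fun g => mean (heat μ e t g)) (nhdsPOne f) (𝓝 (mean (heat μ e t f))) := by
  rw [h.mean_heat_eq_coeff hV hVpos hf.1.2.1 ht]
  refine (isObservable_iff.1 (isObservable_coeff (h.heat_cont hV hVpos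
    (f := fun _ => 1) continuousOn_const t)) f hf).congr' ?_
  filter_upwards [eventually_mem_POne f] with g hg
  rw [h.mean_heat_eq_coeff hV hVpos hg.1.2.1 ht]

/-- For `t > 0` smoothing bounds the `H¹` distance of the images by the `L²` distance of the data
and the difference of the normalising factors. At `t = 0` the flow is the identity on `P₁`. -/
theorem tendsto_h1norm_flow_sub (h : IsNeumannSpectrum V μ e) (hV : ContinuousOn V I01)
    (hVpos : ∀ x ∈ I01, 0 < V x) {f : ℝ → ℝ} (hf : f ∈ POne) {t : ℝ} (ht : 0 ≤ t) :
    Tendsto (fun g => h1norm (flow V t g - flow V t f)) (nhdsPOne f) (𝓝 0) := by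
  have hμ := h.eigenvalue_pos hV hVpos
  rcases eq_or_lt_of_le ht with rfl | h0
  · have hflow : ∀ g ∈ POne, EqOn (flow V 0 g) g I01 := fun g hg x hx => by
      rw [h.eqOn_flow_of_POne hV hVpos hg le_rfl hx]
      simp only [heat_zero, hg.2, div_one]
    refine (tendsto_h1norm_sub f).congr' ?_
    filter_upwards [eventually_mem_POne f] with g hg
    refine h1norm_congr fun x hx => ?_
    simp only [Pi.sub_apply, hflow g hg hx, hflow f hf hx]
  · obtain ⟨B, hB, hb⟩ := h.exists_h1norm_bound hV hVpos
    set m : (ℝ → ℝ) → ℝ := fun g => (mean (heat μ e t g))⁻¹ with hm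
    -- A bound, uniform in `n`, for the coefficients of `m g • g - m f • f`, the difference before
    -- the heat factor acts.
    set d : (ℝ → ℝ) → ℝ := fun g => |m g| * l2norm (g - f) + |m g - m f| * l2norm f with hd
    have hmlim : Tendsto m (nhdsPOne f) (𝓝 (m f)) :=
      (h.tendsto_mean_heat_nhdsPOne hV hVpos hf ht).inv₀
        (h.mean_heat_pos hV hVpos hf.1.2.1 hf.1.2.2 ht).ne'
    have hdlim : Tendsto d (nhdsPOne f) (𝓝 0) := by
      have := (hmlim.abs.mul (tendsto_l2norm_sub f)).add
        ((hmlim.sub_const (m f)).abs.mul_const (l2norm f))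
      simpa using this
    have hsum := h.summable_pow_mul_exp hV hVpos 2 h0
    have hlim : Tendsto (fun g => B * (d g * ∑' n, μ n ^ 2 * Real.exp (-μ n * t)))
        (nhdsPOne f) (𝓝 0) := by
      simpa using (hdlim.mul_const _).const_mul B
    refine squeeze_zero' (Eventually.of_forall fun _ => h1norm_nonneg _) ?_ hlim
    filter_upwards [eventually_mem_POne f] with g hg
    have hfc := (h.flow_mem_POne hV hVpos hf ht).1.2.1
    have hgc := (h.flow_mem_POne hV hVpos hg ht).1.2.1
    have hco : ∀ n, coeff (e n) (flow V t g - flow V t f)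
        = coeff (e n) (flow V t g) - coeff (e n) (flow V t f) :=
      fun n => coeff_sub (h.cont n) hgc hfc
    have hdec : RapidDecay μ fun n => coeff (e n) (flow V t g - flow V t f) := by
      simp_rw [hco]
      exact RapidDecay.sub hμ (h.rapidDecay_coeff_flow hV hVpos hg h0)
        (h.rapidDecay_coeff_flow hV hVpos hf h0)
    refine ((hb _ (hgc.sub hfc) hdec).2).trans (mul_le_mul_of_nonneg_left ?_ hB.le)
    rw [← tsum_mul_left]
    refine (hdec 2).tsum_le_tsum (fun n => ?_) (hsum.mul_left _)
    have hμn := hμ n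
    have e1 : coeff (e n) (flow V t g - flow V t f) = Real.exp (-μ n * t)
        * (m g * coeff (e n) (fun x => g x - f x) + (m g - m f) * coeff (e n) f) := by
      rw [hco, h.coeff_flow hV hVpos hg ht, h.coeff_flow hV hVpos hf ht,
        coeff_sub (h.cont n) hg.1.2.1 hf.1.2.1]
      simp only [hm]
      ring
    have h1 : |m g * coeff (e n) (fun x => g x - f x) + (m g - m f) * coeff (e n) f| ≤ d g := by
      refine (abs_add_le _ _).trans ?_
      rw [abs_mul, abs_mul]
      exact add_le_add
        (mul_le_mul_of_nonneg_left (h.abs_coeff_le (hg.1.2.1.sub hf.1.2.1) n) (abs_nonneg _))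
        (mul_le_mul_of_nonneg_left (h.abs_coeff_le hf.1.2.1 n) (abs_nonneg _))
    rw [e1, abs_mul, Real.abs_exp]
    calc Real.exp (-μ n * t) * _ * μ n ^ 2 ≤ Real.exp (-μ n * t) * d g * μ n ^ 2 := by gcongr
      _ = _ := by ring

theorem isObservable_koopman (h : IsNeumannSpectrum V μ e) (hV : ContinuousOn V I01)
    (hVpos : ∀ x ∈ I01, 0 < V x) {t : ℝ} (ht : 0 ≤ t) {φ : (ℝ → ℝ) → ℝ} (hφ : IsObservable φ) :
    IsObservable (koopman V t φ) := by
  refine isObservable_iff.2 fun f hf => ?_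
  refine (isObservable_iff.1 hφ _ (h.flow_mem_POne hV hVpos hf ht)).comp ?_
  refine tendsto_inf.2 ⟨tendsto_comap_iff.2 (h.tendsto_h1norm_flow_sub hV hVpos hf ht),
    tendsto_principal.2 ?_⟩
  filter_upwards [eventually_mem_POne f] with g hg
  exact h.flow_mem_POne hV hVpos hg ht

theorem isObservable_prod_coeff_div (h : IsNeumannSpectrum V μ e) {ι : Type*} [Fintype ι]
    (q : ι → ℕ) : IsObservable (fun f => ∏ i, coeff (e (q i)) f / coeff (e 0) f) :=
  isObservable_iff.2 fun f hf => tendsto_finsetProd _ fun i _ =>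
    (isObservable_iff.1 (isObservable_coeff (h.cont (q i))) f hf).div
      (isObservable_iff.1 (isObservable_coeff (h.cont 0)) f hf) (h.coeff_ground_pos hf.1).ne'

/-- The positive ground state tolerates a small multiple `ε` of `∑ i ∈ s, e i`; before normalisation
the coefficients become `ε`, or `1 + ε` for the index `0`. -/
theorem exists_coeff_ne_zero (h : IsNeumannSpectrum V μ e) (hV : ContinuousOn V I01)
    (s : Finset ℕ) : ∃ f ∈ POne, ∀ n ∈ s, coeff (e n) f ≠ 0 := by
  obtain ⟨δ, hδ, hm⟩ := exists_pos_le_of_pos (h.cont 0) (h.ground_pos_I01 hV)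
  have hSN := NeumannC2.sum s fun i _ => h.isEigenFamily.neumann i
  obtain ⟨C, hC, hb⟩ := exists_bound_I01 hSN.cont
  -- Then `ε C < δ`, so the perturbed function stays positive on `[0,1]`.
  set ε := δ / (C + 1) with hε
  have hε0 : 0 < ε := by positivity
  have hN := (h.isEigenFamily.neumann 0).add (hSN.const_mul ε)
  set u : ℝ → ℝ := fun x => e 0 x + ε * ∑ i ∈ s, e i x with hu
  have hup : u ∈ PPlus := ⟨memH1_of_hasDerivWithinAt hN.d1 hN.cont1, hN.cont, fun x hx => by
    have h1 := hm x hx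
    have h2 := (abs_le.1 (hb x hx)).1
    have h3 : ε * (C + 1) = δ := by rw [hε]; field_simp
    have h4 : ε * -C ≤ ε * ∑ i ∈ s, e i x := mul_le_mul_of_nonneg_left h2 hε0.le
    simp only [hu]
    linarith⟩
  refine ⟨_, div_mean_mem_POne hup, fun n hn => ?_⟩
  simp_rw [div_eq_inv_mul]
  rw [coeff_const_mul, hu, coeff_add (f := e 0) (g := fun x => ε * ∑ i ∈ s, e i x) (h.cont n) (h.cont 0)
      (hSN.const_mul ε).cont,
    coeff_const_mul, h.coeff_eigenfunction]
  have e1 : coeff (e n) (fun x => ∑ i ∈ s, e i x) = 1 := by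
    have hi : ∀ i ∈ s, IntervalIntegrable (fun x => e n x * e i x) volume 0 1 := fun i _ =>
      intervalIntegrable_of_continuousOn ((h.cont n).mul (h.cont i))
    unfold coeff
    simp_rw [Finset.mul_sum]
    rw [intervalIntegral.integral_finsetSum hi]
    simp_rw [h.orthonormal]
    simp [hn]
  rw [e1, mul_one]
  refine mul_ne_zero (inv_pos.2 (IsNeumannSpectrum.mean_pos_of_PPlus hup)).ne' ?_
  split_ifs <;> positivity

theorem exists_prod_coeff_div_ne_zero (h : IsNeumannSpectrum V μ e) (hV : ContinuousOn V I01)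
    {ι : Type*} [Fintype ι] (q : ι → ℕ) :
    ∃ f ∈ POne, ∏ i, coeff (e (q i)) f / coeff (e 0) f ≠ 0 := by
  obtain ⟨f, hf, hne⟩ := h.exists_coeff_ne_zero hV (Finset.univ.image q)
  exact ⟨f, hf, Finset.prod_ne_zero_iff.2 fun i _ =>
    div_ne_zero (hne _ (Finset.mem_image_of_mem q (Finset.mem_univ i)))
      (h.coeff_ground_pos hf.1).ne'⟩

/-- The normalising mean is the same for all coefficients and cancels in each quotient. -/
theorem koopman_prod_coeff_div (h : IsNeumannSpectrum V μ e) (hV : ContinuousOn V I01)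
    (hVpos : ∀ x ∈ I01, 0 < V x) {ι : Type*} [Fintype ι] (q : ι → ℕ) {t : ℝ} (ht : 0 ≤ t)
    {f : ℝ → ℝ} (hf : f ∈ POne) :
    koopman V t (fun f => ∏ i, coeff (e (q i)) f / coeff (e 0) f) f
      = Real.exp (-(∑ i, (μ (q i) - μ 0)) * t) * ∏ i, coeff (e (q i)) f / coeff (e 0) f := by
  rw [koopman, ← Finset.sum_neg_distrib, Finset.sum_mul, Real.exp_sum, ← Finset.prod_mul_distrib]
  refine Finset.prod_congr rfl fun i _ => ?_
  have h1 := (h.mean_heat_pos hV hVpos hf.1.2.1 hf.1.2.2 ht).ne'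
  have h2 := (h.coeff_ground_pos hf.1).ne'
  have h3 : Real.exp (-(μ (q i) - μ 0) * t)
      = Real.exp (-μ (q i) * t) / Real.exp (-μ 0 * t) := by
    rw [← Real.exp_sub]
    congr 1
    ring
  rw [h.coeff_flow hV hVpos hf ht, h.coeff_flow hV hVpos hf ht, h3]
  have h4 := (Real.exp_pos (-μ 0 * t)).ne'
  generalize Real.exp (-μ 0 * t) = x at h4
  generalize Real.exp (-μ (q i) * t) = y
  field_simp

end IsNeumannSpectrum

end HeatFlow

theorem mainTheorem7 (V : ℝ → ℝ) (hV : ContDiffOn ℝ ∞ V HeatFlow.I01)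
    (hVpos : ∀ x ∈ HeatFlow.I01, 0 < V x) :
    -- local existence and uniqueness: the flow solves the equation on `[0,T_*[`, classically for
    -- positive times, and every solution is a restriction of it
    (∀ v₀ ∈ HeatFlow.PPlus,
      HeatFlow.IsNonlinearSolution V v₀ (HeatFlow.lifespan V v₀) (fun t => HeatFlow.flow V t v₀) ∧
      (∀ (T : EReal) (w : ℝ → ℝ → ℝ), HeatFlow.IsNonlinearSolution V v₀ T w →
        T ≤ HeatFlow.lifespan V v₀ ∧
        ∀ t ∈ HeatFlow.timeSpan T, EqOn (w t) (HeatFlow.flow V t v₀) HeatFlow.I01) ∧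
      (∀ t ∈ HeatFlow.timeSpan (HeatFlow.lifespan V v₀), 0 < t →
        ContDiffOn ℝ ∞ (HeatFlow.flow V t v₀) HeatFlow.I01 ∧
        HeatFlow.D (HeatFlow.flow V t v₀) 0 = 0 ∧ HeatFlow.D (HeatFlow.flow V t v₀) 1 = 0 ∧
        ∀ x ∈ HeatFlow.I01,
          HasDerivAt (fun s => HeatFlow.flow V s v₀ x)
            (HeatFlow.D (HeatFlow.D (HeatFlow.flow V t v₀)) x - V x * HeatFlow.flow V t v₀ x
              + (∫ y in (0 : ℝ)..1, V y * HeatFlow.flow V t v₀ y) * HeatFlow.flow V t v₀ x) t)) ∧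
    -- positivity, and invariance of `P₊`
    (∀ v₀ ∈ HeatFlow.PPlus, ∀ t ∈ HeatFlow.timeSpan (HeatFlow.lifespan V v₀),
      HeatFlow.flow V t v₀ ∈ HeatFlow.PPlus ∧
      ∀ x ∈ HeatFlow.I01,
        Real.exp (-t * sSup (V '' HeatFlow.I01)) * sInf (v₀ '' HeatFlow.I01)
          ≤ HeatFlow.flow V t v₀ x) ∧
    -- evolution of the spatial mean
    (∀ v₀ ∈ HeatFlow.PPlus,
      (∀ t ∈ HeatFlow.timeSpan (HeatFlow.lifespan V v₀),
        HasDerivWithinAt (fun s => HeatFlow.mean (HeatFlow.flow V s v₀) - 1)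
          ((∫ x in (0 : ℝ)..1, V x * HeatFlow.flow V t v₀ x)
            * (HeatFlow.mean (HeatFlow.flow V t v₀) - 1))
          (HeatFlow.timeSpan (HeatFlow.lifespan V v₀)) t) ∧
      (1 < HeatFlow.mean v₀ →
        (∀ t ∈ HeatFlow.timeSpan (HeatFlow.lifespan V v₀),
          1 < HeatFlow.mean (HeatFlow.flow V t v₀)) ∧
        StrictMonoOn (fun t => HeatFlow.mean (HeatFlow.flow V t v₀))
          (HeatFlow.timeSpan (HeatFlow.lifespan V v₀))) ∧
      (HeatFlow.mean v₀ = 1 → ∀ t ∈ HeatFlow.timeSpan (HeatFlow.lifespan V v₀),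
        HeatFlow.mean (HeatFlow.flow V t v₀) = 1) ∧
      (HeatFlow.mean v₀ < 1 →
        (∀ t ∈ HeatFlow.timeSpan (HeatFlow.lifespan V v₀),
          HeatFlow.mean v₀ * Real.exp (-t * sSup (V '' HeatFlow.I01))
            ≤ HeatFlow.mean (HeatFlow.flow V t v₀) ∧
          HeatFlow.mean (HeatFlow.flow V t v₀) < 1) ∧
        StrictAntiOn (fun t => HeatFlow.mean (HeatFlow.flow V t v₀))
          (HeatFlow.timeSpan (HeatFlow.lifespan V v₀)))) ∧
    -- global existence when the initial mean is at most one
    (∀ v₀ ∈ HeatFlow.PPlus, HeatFlow.mean v₀ ≤ 1 →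
      HeatFlow.lifespan V v₀ = ⊤ ∧
      ∀ t : ℝ, 0 ≤ t → HeatFlow.l2norm (HeatFlow.flow V t v₀)
        ≤ Real.exp (t * sSup (V '' HeatFlow.I01)) * HeatFlow.l2norm v₀) ∧
    -- invariance of `P₁`, flow property, and link with the linear heat equation
    (∀ v₀ ∈ HeatFlow.POne,
      (∀ t : ℝ, 0 ≤ t → HeatFlow.flow V t v₀ ∈ HeatFlow.POne) ∧
      (∀ s t : ℝ, 0 ≤ s → 0 ≤ t →
        EqOn (HeatFlow.flow V (s + t) v₀) (HeatFlow.flow V t (HeatFlow.flow V s v₀))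
          HeatFlow.I01) ∧
      (∃ u : ℝ → ℝ → ℝ, HeatFlow.IsLinearSolution V v₀ ⊤ u) ∧
      (∀ u : ℝ → ℝ → ℝ, HeatFlow.IsLinearSolution V v₀ ⊤ u → ∀ t : ℝ, 0 ≤ t →
        0 < HeatFlow.mean (u t) ∧
        ∀ x ∈ HeatFlow.I01, HeatFlow.flow V t v₀ x = u t x / HeatFlow.mean (u t))) ∧
    -- reduction of `P₊` to `P₁`
    (∀ v₀ ∈ HeatFlow.PPlus, ∀ t ∈ HeatFlow.timeSpan (HeatFlow.lifespan V v₀),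
      ∀ x ∈ HeatFlow.I01,
        HeatFlow.flow V t v₀ x = HeatFlow.mean (HeatFlow.flow V t v₀)
          * HeatFlow.flow V t (fun y => v₀ y / HeatFlow.mean v₀) x) ∧
    -- blow-up in finite time, at all points simultaneously
    (∀ v₀ ∈ HeatFlow.PPlus, 1 < HeatFlow.mean v₀ →
      ∃ T : ℝ, 0 < T ∧ HeatFlow.lifespan V v₀ = (T : EReal) ∧
        Tendsto (fun t => HeatFlow.mean (HeatFlow.flow V t v₀)) (𝓝[<] T) atTop ∧
        ∀ x ∈ HeatFlow.I01, Tendsto (fun t => HeatFlow.flow V t v₀ x) (𝓝[<] T) atTop) ∧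
    -- eigenfunctions
    (∃ (μ : ℕ → ℝ) (e : ℕ → ℝ → ℝ), HeatFlow.IsNeumannSpectrum V μ e) ∧
    (∀ (μ : ℕ → ℝ) (e : ℕ → ℝ → ℝ), HeatFlow.IsNeumannSpectrum V μ e →
      -- the unique steady state
      (fun x => e 0 x / HeatFlow.mean (e 0)) ∈ HeatFlow.POne ∧
      (∀ x : ℝ, e 0 x / HeatFlow.mean (e 0) = μ 0 / (∫ y in (0 : ℝ)..1, V y * e 0 y) * e 0 x) ∧
      (∀ s ∈ HeatFlow.PPlus, HeatFlow.IsSteadyState V s ↔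
        EqOn s (fun x => e 0 x / HeatFlow.mean (e 0)) HeatFlow.I01) ∧
      -- it attracts every orbit in `P₁`
      (∀ v₀ ∈ HeatFlow.POne,
        TendstoUniformlyOn (fun (t : ℝ) (x : ℝ) => HeatFlow.flow V t v₀ x)
          (fun x => e 0 x / HeatFlow.mean (e 0)) atTop HeatFlow.I01 ∧
        Tendsto (fun t : ℝ => HeatFlow.h1norm
          (HeatFlow.flow V t v₀ - fun x => e 0 x / HeatFlow.mean (e 0))) atTop (𝓝 0)) ∧
      -- spectral elements of the Koopman operator on the observables of `P₁`
      (∀ t : ℝ, 0 ≤ t → ∀ φ : (ℝ → ℝ) → ℝ, HeatFlow.IsObservable φ →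
        HeatFlow.IsObservable (HeatFlow.koopman V t φ)) ∧
      (∀ n, HeatFlow.IsObservable (HeatFlow.coeff (e n))) ∧
      (∀ v₀ ∈ HeatFlow.POne, 0 < HeatFlow.coeff (e 0) v₀) ∧
      (∀ (m : ℕ) (q : Fin (m + 1) → ℕ),
        HeatFlow.IsObservable
          (fun f => ∏ i, HeatFlow.coeff (e (q i)) f / HeatFlow.coeff (e 0) f) ∧
        (∃ f ∈ HeatFlow.POne,
          ∏ i, HeatFlow.coeff (e (q i)) f / HeatFlow.coeff (e 0) f ≠ 0) ∧
        ∀ t : ℝ, 0 ≤ t → ∀ v₀ ∈ HeatFlow.POne,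
          HeatFlow.koopman V t
              (fun f => ∏ i, HeatFlow.coeff (e (q i)) f / HeatFlow.coeff (e 0) f) v₀
            = Real.exp (-(∑ i, (μ (q i) - μ 0)) * t)
              * ∏ i, HeatFlow.coeff (e (q i)) v₀ / HeatFlow.coeff (e 0) v₀)) := by
  have hVc := hV.continuousOn
  -- This spectrum serves the statements that mention none; the last block is proved for an
  -- arbitrary one.
  obtain ⟨μ, e, h⟩ := HeatFlow.exists_neumannSpectrum hVc hVpos
  refine ⟨fun f hf => ⟨h.isNonlinearSolution_flow hVc hVpos hf.2.1, fun T w hw => ?_,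
      fun t ht h0 => h.flow_classical hV hVpos hf ht h0⟩,
    fun f hf t ht => ⟨h.flow_mem_PPlus hVc hVpos hf ht, h.flow_lower_bound hVc hVpos hf ht⟩,
    fun f hf => ⟨fun t ht => h.hasDerivWithinAt_mean_flow hVc hVpos hf ht,
      h.mean_flow_of_one_lt hVc hVpos hf, fun h1 t ht => h.mean_flow_of_POne hVc hVpos hf h1 ht,
      h.mean_flow_of_lt_one hVc hVpos hf⟩,
    fun f hf h1 => ⟨h.lifespan_eq_top hVc hVpos hf h1,
      fun t ht => h.l2norm_flow_le hVc hVpos hf h1 ht⟩,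
    fun f hf => ⟨fun t ht => h.flow_mem_POne hVc hVpos hf ht,
      fun s t hs ht => h.flow_add hVc hVpos hf hs ht,
      ⟨_, h.isLinearSolution_heat hVc hVpos hf.1.2.1⟩, fun u hu t ht => ?_⟩,
    fun f hf t ht => h.flow_eq_mean_mul_flow hVc hVpos hf ht,
    fun f hf h1 => h.blow_up hVc hVpos hf h1, ⟨μ, e, h⟩, fun μ e h => ?_⟩
  · have hT : T ≤ HeatFlow.lifespan V f := le_sSup ⟨w, hw⟩
    refine ⟨hT, fun t ht => ?_⟩
    exact (h.eqOn_of_isNonlinearSolution hVc hVpos hf.2.1 hw ht).2.trans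
      (h.eqOn_flow hVc hVpos hf.2.1 ⟨ht.1, ht.2.trans_le hT⟩).symm
  · have hu := h.eqOn_heat_of_isLinearSolution hVc hVpos hf.1.2.1 hu ht
    rw [HeatFlow.mean_congr hu]
    refine ⟨h.mean_heat_pos hVc hVpos hf.1.2.1 hf.1.2.2 ht, fun x hx => ?_⟩
    rw [hu hx, h.eqOn_flow_of_POne hVc hVpos hf ht hx]
  · exact ⟨HeatFlow.div_mean_mem_POne (h.ground_mem_PPlus hVc), h.ground_div_mean hVc hVpos,
      fun s hs => h.isSteadyState_iff hVc hVpos hs, fun f hf => h.tendsto_flow hVc hVpos hf,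
      fun t ht φ hφ => h.isObservable_koopman hVc hVpos ht hφ,
      fun n => HeatFlow.isObservable_coeff (h.cont n), fun f hf => h.coeff_ground_pos hf.1,
      fun m q => ⟨h.isObservable_prod_coeff_div q, h.exists_prod_coeff_div_ne_zero hVc q,
        fun t ht f hf => h.koopman_prod_coeff_div hVc hVpos q ht hf⟩⟩
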